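/- Notation. For $\gamma\ge 1$ put $L^{\mathrm{cl}}_{\gamma,1}=\frac1{2\pi}\int_{\mathbb R}(1-\xi^2)_+^{\gamma}\,d\xi$. For $\alpha\in\mathbb R\setminus\mathbb Z$ put $\mathrm K_1(\alpha)=\mathrm k(\alpha)^2$, where $\mathrm k(\alpha)=1$ if $\frac14\le\alpha\bmod 1\le\frac34$ and $\mathrm k(\alpha)=1/|\sin(2\pi\alpha)|$ otherwise, and $$\mathrm K_2(\alpha)=\frac{5}{3\sqrt3\,\pi}\Bigl[\sup_{b\ge0}b^{5/3}\sum_{k\in\mathbb Z}\frac1{(|k+\alpha|^3+b)^2}\Bigr]^2 .$$ For $L>0$ and a real-valued $a\in L^1(0,L)$, the flux of $a$ is $\frac1{2\pi}\int_0^La(x)\,dx$. Let $\mathrm K(\alpha)$ be the best constant in the inequality $$\int_0^L\operatorname{Tr}[U(x)^3]\,dx\le \mathrm K(\alpha)\sum_{n=1}^N\int_0^L|i\psi_n'(x)-a(x)\psi_n(x)|^2_{\mathbb C^M}\,dx,\qquad U(x)=\sum_{n=1}^N\psi_n(x)\overline{\psi_n(x)}^{T},$$ for all $L>0$, all such $a$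 with flux $\alpha$, all $M,N$, and all families $\psi_1,\dots,\psi_N$ of absolutely continuous $L$-periodic functions with values in $\mathbb C^M$ that satisfy $i\psi_n'-a\psi_n\in L^2$ and are orthonormal in $L^2([0,L];\mathbb C^M)$. Corollary 3.1 (1D $\gamma$-moments). Let $\alpha\in\mathbb R\setminus\mathbb Z$ and $\gamma\ge1$. Then $\mathrm K(\alpha)\le\min(\mathrm K_1(\alpha),\mathrm K_2(\alpha))$, and there is a constant $L_{\gamma,1}$, depending only on $\gamma$ and $\alpha$, with $$L_{\gamma,1}\le\frac2{3\sqrt3}\sqrt{\mathrm K(\alpha)}\,\frac{L^{\mathrm{cl}}_{\gamma,1}}{L^{\mathrm{cl}}_{1,1}}=\frac{\pi}{\sqrt3}\sqrt{\mathrm K(\alpha)}\,L^{\mathrm{cl}}_{\gamma,1},$$ such that the following holds. Let $L>0$, let $a\in L^1(0,L)$ be real-valued with flux $\alpha$, let $M$ be a natural number, and let $V(x)\ge0$, $x\in(0,L)$, be a measurable function with values in the Hermitian $M\times M$ matrices such that $\operatorname{Tr}V^{\gamma+1/2}\in L^1(0,L)$. Then the negative eigenvalues $-\lambda_n<0$,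 repeated according to multiplicity, of the operator $$H=\Bigl(i\frac{d}{dx}-a(x)\Bigr)^2-V(x)\quad\text{in }L^2([0,L]_{\mathrm{per}};\mathbb C^M)$$ with its natural domain (those $\psi\in L^2$ for which $\psi$ and $i\psi'-a\psi$ are absolutely continuous and periodic and $H\psi\in L^2$) satisfy $$\sum_n\lambda_n^{\gamma}\le L_{\gamma,1}\int_0^L\operatorname{Tr}[V(x)^{\gamma+1/2}]\,dx .$$ -/

import Mathlib

open MeasureTheory Set
open scoped ComplexOrder

noncomputable section

namespace MagneticLT

/-- The Hilbert space `L²([0,L]; ℂ^M)`. -/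
abbrev L2 (L : ℝ) (M : ℕ) : Type :=
  Lp (EuclideanSpace ℂ (Fin M)) 2 (volume.restrict (Ioc 0 L))

/-- `u` is absolutely continuous on `[0,L]` with (a.e.) derivative `u' ∈ L¹(0,L)`, and is
periodic, `u(0) = u(L)`. -/
structure IsPeriodicAC {M : ℕ} (L : ℝ) (u u' : ℝ → EuclideanSpace ℂ (Fin M)) : Prop where
  integrable : IntervalIntegrable u' volume 0 L
  eq_integral : ∀ x ∈ Icc 0 L, u x = u 0 + ∫ y in (0 : ℝ)..x, u' y
  periodic : u L = u 0

/-- The magnetic derivative `i u' - a u` of a function `u` with derivative `u'`. -/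
def magDeriv {M : ℕ} (a : ℝ → ℝ) (u u' : ℝ → EuclideanSpace ℂ (Fin M)) (x : ℝ) :
    EuclideanSpace ℂ (Fin M) :=
  Complex.I • u' x - (a x : ℂ) • u x

/-- The magnetic flux `α = (1/2π) ∫₀ᴸ a(x) dx`. -/
def flux (L : ℝ) (a : ℝ → ℝ) : ℝ :=
  1 / (2 * Real.pi) * ∫ x in (0 : ℝ)..L, a x

section Closure

variable {M : ℕ} {L : ℝ} {u u' v v' : ℝ → EuclideanSpace ℂ (Fin M)}

theorem IsPeriodicAC.intervalIntegrable_of_mem (h : IsPeriodicAC L u u') {x : ℝ}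
    (hx : x ∈ Icc 0 L) : IntervalIntegrable u' volume 0 x :=
  h.integrable.mono_set (by
    rw [uIcc_of_le hx.1, uIcc_of_le (hx.1.trans hx.2)]
    exact Icc_subset_Icc_right hx.2)

theorem IsPeriodicAC.add (hu : IsPeriodicAC L u u') (hv : IsPeriodicAC L v v') :
    IsPeriodicAC L (fun x => u x + v x) (fun x => u' x + v' x) where
  integrable := hu.integrable.add hv.integrable
  eq_integral x hx := by
    rw [intervalIntegral.integral_add (hu.intervalIntegrable_of_mem hx)
      (hv.intervalIntegrable_of_mem hx), hu.eq_integral x hx, hv.eq_integral x hx]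
    abel
  periodic := by simp only [hu.periodic, hv.periodic]

theorem IsPeriodicAC.smul (c : ℂ) (hu : IsPeriodicAC L u u') :
    IsPeriodicAC L (fun x => c • u x) (fun x => c • u' x) where
  integrable := hu.integrable.smul c
  eq_integral x hx := by
    rw [intervalIntegral.integral_smul, hu.eq_integral x hx, smul_add]
  periodic := by simp only [hu.periodic]

end Closure

/-- The graph of the magnetic Schrödinger operator `H = (i d/dx - a)² - V` in
`L²([0,L]_per; ℂ^M)`, on its natural domain.  A pair `(ψ, f)` belongs to it iff `ψ` has an absolutely
continuous periodic representative `u`, the function `v = i u' - a u` is (a.e. equal to) an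
absolutely continuous periodic function, and `f = i v' - a v - V u` almost everywhere; here
`f ∈ L²`. -/
def operatorGraph {M : ℕ} (L : ℝ) (a : ℝ → ℝ) (V : ℝ → Matrix (Fin M) (Fin M) ℂ) :
    Submodule ℂ (L2 L M × L2 L M) where
  carrier := {p | ∃ u u' v v' : ℝ → EuclideanSpace ℂ (Fin M),
    IsPeriodicAC L u u' ∧ IsPeriodicAC L v v' ∧
    (∀ᵐ x ∂(volume.restrict (Ioc 0 L)), p.1 x = u x) ∧
    (∀ᵐ x ∂(volume.restrict (Ioc 0 L)), v x = magDeriv a u u' x) ∧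
    (∀ᵐ x ∂(volume.restrict (Ioc 0 L)),
      p.2 x = magDeriv a v v' x - Matrix.toEuclideanLin (V x) (u x))}
  zero_mem' := by
    refine ⟨fun _ => 0, fun _ => 0, fun _ => 0, fun _ => 0, ⟨by simp, by simp, rfl⟩,
      ⟨by simp, by simp, rfl⟩, ?_, ?_, ?_⟩
    · filter_upwards [Lp.coeFn_zero (EuclideanSpace ℂ (Fin M)) 2 (volume.restrict (Ioc 0 L))]
        with x hx
      simpa using hx
    · simp [magDeriv]
    · filter_upwards [Lp.coeFn_zero (EuclideanSpace ℂ (Fin M)) 2 (volume.restrict (Ioc 0 L))]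
        with x hx
      simpa [magDeriv] using hx
  add_mem' := by
    rintro p q ⟨u, u', v, v', hu, hv, h1, h2, h3⟩ ⟨w, w', z, z', hw, hz, k1, k2, k3⟩
    refine ⟨_, _, _, _, hu.add hw, hv.add hz, ?_, ?_, ?_⟩
    · filter_upwards [Lp.coeFn_add p.1 q.1, h1, k1] with x hx hx1 hx2
      rw [Prod.fst_add, hx, Pi.add_apply, hx1, hx2]
    · filter_upwards [h2, k2] with x hx1 hx2
      rw [hx1, hx2]
      simp only [magDeriv, smul_add]
      abel
    · filter_upwards [Lp.coeFn_add p.2 q.2, h3, k3] with x hx hx1 hx2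
      rw [Prod.snd_add, hx, Pi.add_apply, hx1, hx2]
      simp only [magDeriv, smul_add, map_add]
      abel
  smul_mem' := by
    rintro c p ⟨u, u', v, v', hu, hv, h1, h2, h3⟩
    refine ⟨_, _, _, _, hu.smul c, hv.smul c, ?_, ?_, ?_⟩
    · filter_upwards [Lp.coeFn_smul c p.1, h1] with x hx hx1
      rw [Prod.smul_fst, hx, Pi.smul_apply, hx1]
    · filter_upwards [h2] with x hx1
      rw [hx1]
      simp only [magDeriv, smul_sub, smul_comm c]
    · filter_upwards [Lp.coeFn_smul c p.2, h3] with x hx hx1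
      rw [Prod.smul_snd, hx, Pi.smul_apply, hx1]
      simp only [magDeriv, smul_sub, smul_comm c, map_smul]

/-- The eigenspace `{ψ ∈ D(H) : H ψ = E ψ}`. -/
def eigenspace {M : ℕ} (L : ℝ) (a : ℝ → ℝ) (V : ℝ → Matrix (Fin M) (Fin M) ℂ) (E : ℝ) :
    Submodule ℂ (L2 L M) :=
  (operatorGraph L a V).comap (LinearMap.prod LinearMap.id ((E : ℂ) • LinearMap.id))

/-- `∑ₙ λₙ^γ` over the negative eigenvalues `-λₙ` of `H`, each repeated according to its
multiplicity (a possibly infinite sum of possibly infinite multiplicities, in `[0,∞]`). -/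
def rieszMean {M : ℕ} (L : ℝ) (a : ℝ → ℝ) (V : ℝ → Matrix (Fin M) (Fin M) ℂ) (γ : ℝ) :
    ENNReal :=
  ∑' l : Ioi (0 : ℝ),
    ((Module.rank ℂ (eigenspace L a V (-(l : ℝ)))).toENat : ENNReal) *
      ENNReal.ofReal ((l : ℝ) ^ γ)

/-- `Tr A^p` for a positive semidefinite matrix `A` and a real exponent `p`, with `A^p` given by the
functional calculus. -/
def trPow {M : ℕ} (A : Matrix (Fin M) (Fin M) ℂ) (p : ℝ) : ℝ :=
  (Matrix.trace (cfc (fun t : ℝ => t ^ p) A)).re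

/-- The semiclassical constant `L^cl_{γ,1} = (1/2π) ∫_ℝ (1 - ξ²)₊^γ dξ`. -/
def Lcl (γ : ℝ) : ℝ :=
  1 / (2 * Real.pi) * ∫ ξ : ℝ, (max (1 - ξ ^ 2) 0) ^ γ

/-- `k(α)`, in terms of `α mod 1`. -/
def kConst (α : ℝ) : ℝ :=
  if Int.fract α < 1 / 4 ∨ 3 / 4 < Int.fract α then 1 / |Real.sin (2 * Real.pi * α)| else 1

/-- `K₁(α) = k(α)²`. -/
def K₁ (α : ℝ) : ℝ := kConst α ^ 2

/-- `K₂(α) = 5/(3√3π) · [sup_{b ≥ 0} b^{5/3} ∑_{k ∈ ℤ} (|k+α|³ + b)⁻²]²`. -/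
def K₂ (α : ℝ) : ℝ :=
  5 / (3 * √3 * Real.pi) *
    (sSup ((fun b : ℝ => b ^ (5 / 3 : ℝ) * ∑' k : ℤ, 1 / (|(k : ℝ) + α| ^ 3 + b) ^ 2) ''
      Ici 0)) ^ 2

/-- The matrix `U(x) = ∑ₙ ψₙ(x) ψₙ(x)^*`. -/
def densityMatrix {M N : ℕ} (ψ : Fin N → ℝ → EuclideanSpace ℂ (Fin M)) (x : ℝ) :
    Matrix (Fin M) (Fin M) ℂ :=
  ∑ n, Matrix.of fun i j => ψ n x i * star (ψ n x j)

/-- `K` is an admissible constant, for the flux `α`, in the inequality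
`∫₀ᴸ Tr U³ ≤ K ∑ₙ ∫₀ᴸ |i ψₙ' - a ψₙ|²` for periodic `ℂ^M`-valued functions `ψ₁, …, ψ_N` of finite
magnetic energy that are orthonormal in `L²([0,L]; ℂ^M)`. -/
def IsAdmissible (α K : ℝ) : Prop :=
  0 ≤ K ∧ ∀ (L : ℝ) (a : ℝ → ℝ), 0 < L → IntervalIntegrable a volume 0 L → flux L a = α →
    ∀ (M N : ℕ) (ψ ψ' : Fin N → ℝ → EuclideanSpace ℂ (Fin M)),
      (∀ n, IsPeriodicAC L (ψ n) (ψ' n)) →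
      (∀ n, MemLp (magDeriv a (ψ n) (ψ' n)) 2 (volume.restrict (Ioc 0 L))) →
      (∀ n m, ∫ x in (0 : ℝ)..L, inner ℂ (ψ n x) (ψ m x) = if n = m then 1 else 0) →
      ∫ x in (0 : ℝ)..L, (Matrix.trace (densityMatrix ψ x ^ 3)).re ≤
        K * ∑ n, ∫ x in (0 : ℝ)..L, ‖magDeriv a (ψ n) (ψ' n) x‖ ^ 2

/-- `K(α)`: the best constant in the above inequality for orthonormal systems. -/
def KConst (α : ℝ) : ℝ := sInf {K : ℝ | IsAdmissible α K}

end MagneticLT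

end

/-!
The theorem combines a duality argument, two proofs of the inequality for orthonormal systems (one
for each of `K₁` and `K₂`), and the Aizenman–Lieb lifting from `γ = 1` to `γ ≥ 1`. No compactness or
spectral theory of the operator is used: the eigenvalue sum is bounded through finite orthonormal
families of eigenfunctions.

*Gauge transformation* (`isAdmissible_of_quasiperiodic`). Multiplication by `exp(i ∫ a)` leaves
`Tr U³` unchanged, replaces `‖i ψ' - a ψ‖` by `‖w'‖`, and turns periodicity into
`w(L) = exp(2πiα) w(0)`. Only quasi-periodic functions without magnetic potential remain.

*The constant `K₁`* (`isAdmissible_K₁`). For scalar quasi-periodic functions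
`|w(x)|⁴ ≤ K₁ ‖w‖² ‖w'‖²` (`norm_sq_sq_le_K₁`). The factor `1/|sin 2πα|` comes from integrating
`(w²)'` around the circle. If `cos 2πα ≤ 0` the constant `1` is obtained by calibrating
`‖w'‖² + μ² ‖w‖²` with the decaying exponential centred at `x` and its images, a finite substitute
for the Green's function. The Eden–Foias argument passes to systems: the inequality is applied, at
each `x`, to combinations whose coefficients are the components of the `wₙ(x)` along an eigenvector
of `U(x)`, and integration over `x` uses orthonormality.

*The constant `K₂`* (`isAdmissible_K₂`). With the multiplier `m_s(t) = s³/(s³ + t³)` in momentum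
space, `∫₀^∞ 2t m_s(t)² dt` is a multiple of `s²`, so the kinetic energy is an integral over `t` of
the low-momentum densities. By Bessel's inequality the high-momentum parts at `x` have size at most
`t · sup_b b^{5/3} ∑_k (|k+α|³ + b)⁻² / L`, which bounds the low-momentum densities below in terms of
the eigenvalues of `U(x)`; integrating in `t` yields `Tr U³`.

*Duality* (`sum_max_sub_le_lintegral`). For an orthonormal family of eigenfunctions with eigenvalues
`-λₙ`, the sum of `λₙ - τ` is `∫ Tr (V - τ) U` minus the kinetic energy, and hence at most
`∫ Tr (V - τ) U - K⁻¹ ∫ Tr U³`. Maximizing over `U` pointwise, by Young's inequality in an eigenbasis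
of `V(x)`, gives `(2/(3√3)) √K ∫ Tr (V - τ)₊^{3/2}`.

*Lifting* (`sum_rpow_le_lintegral`). Integrating the previous bound against `γ(γ-1) τ^{γ-2} dτ`
produces `∑ λₙ^γ` on the left, and on the right `Tr V^{γ+1/2}` with the ratio of semiclassical
constants, since `Lcl` satisfies the same relation (`lintegral_rpow_mul_max_sub_rpow`).

Multiplicities are exhausted by finite families (`rieszMean_le_lintegral`). The bound holds for every
`K > K(α)`, and the limit `K ↓ K(α)` gives it for `K(α)`.
-/


namespace MagneticLT

/-! ### Absolutely continuous functions on an interval -/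

section AbsolutelyContinuous

variable {E F : Type*} [NormedAddCommGroup E] [NormedSpace ℝ E] [NormedAddCommGroup F]
  [NormedSpace ℝ F]

theorem absolutelyContinuousOnInterval_of_dist_le {X Y : Type*} [PseudoMetricSpace X]
    [PseudoMetricSpace Y] {f : ℝ → X} {g : ℝ → Y} {a b C : ℝ} (hC : 0 ≤ C)
    (hg : AbsolutelyContinuousOnInterval g a b)
    (h : ∀ x ∈ uIcc a b, ∀ y ∈ uIcc a b, dist (f x) (f y) ≤ C * dist (g x) (g y)) :
    AbsolutelyContinuousOnInterval f a b := by
  rw [absolutelyContinuousOnInterval_iff] at hg ⊢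
  intro ε hε
  obtain ⟨δ, hδ, H⟩ := hg (ε / (C + 1)) (by positivity)
  refine ⟨δ, hδ, fun E hE hlt => ?_⟩
  have h1 := H E hE hlt
  calc ∑ i ∈ Finset.range E.1, dist (f (E.2 i).1) (f (E.2 i).2)
      ≤ ∑ i ∈ Finset.range E.1, C * dist (g (E.2 i).1) (g (E.2 i).2) :=
        Finset.sum_le_sum fun i hi => h _ (hE.1 i hi).1 _ (hE.1 i hi).2
    _ = C * ∑ i ∈ Finset.range E.1, dist (g (E.2 i).1) (g (E.2 i).2) := by rw [Finset.mul_sum]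
    _ ≤ C * (ε / (C + 1)) := by gcongr
    _ < ε := by
        rw [mul_div_assoc', div_lt_iff₀ (by positivity)]
        nlinarith

theorem absolutelyContinuousOnInterval_integral {f : ℝ → E} {a b : ℝ}
    (hf : IntervalIntegrable f volume a b) :
    AbsolutelyContinuousOnInterval (fun x => ∫ y in a..x, f y) a b := by
  refine absolutelyContinuousOnInterval_of_dist_le zero_le_one
    (hf.norm.absolutelyContinuousOnInterval_intervalIntegral left_mem_uIcc) ?_
  intro x hx y hy
  have hi : ∀ z ∈ uIcc a b, IntervalIntegrable f volume a z := fun z hz =>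
    hf.mono_set (uIcc_subset_uIcc_left hz)
  rw [one_mul, dist_eq_norm, dist_eq_norm, intervalIntegral.integral_interval_sub_left (hi x hx)
    (hi y hy), intervalIntegral.integral_interval_sub_left (hi x hx).norm (hi y hy).norm]
  exact intervalIntegral.norm_integral_le_abs_integral_norm

/-- The fundamental theorem of calculus for vector-valued absolutely continuous functions. -/
theorem eq_add_integral_of_absolutelyContinuous [CompleteSpace E] {u u' : ℝ → E} {a b : ℝ}
    (hu : AbsolutelyContinuousOnInterval u a b) (hi : IntervalIntegrable u' volume a b)
    (hd : ∀ᵐ x, x ∈ uIcc a b → HasDerivAt u (u' x) x) {x : ℝ} (hx : x ∈ uIcc a b) :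
    u x = u a + ∫ y in a..x, u' y := by
  have h1 := hu.sub (absolutelyContinuousOnInterval_integral hi)
  obtain ⟨C, hC⟩ := h1.const_of_ae_hasDerivAt_zero (by
    filter_upwards [hd, hi.ae_hasDerivAt_integral] with y h1 h2 hy
    simpa using (h1 hy).sub (h2 hy a left_mem_uIcc))
  have h2 := hC x hx
  have h3 := hC a left_mem_uIcc
  simp only [Pi.sub_apply, intervalIntegral.integral_same, sub_zero] at h2 h3
  rw [h3, ← h2]
  abel

/-- `u` is absolutely continuous on `[a,b]` with derivative `u' ∈ L¹(a,b)`, expressed, as in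
`IsPeriodicAC`, by saying that `u` is a primitive of `u'`. -/
structure IsPrimitive (a b : ℝ) (u u' : ℝ → E) : Prop where
  integrable : IntervalIntegrable u' volume a b
  eq_integral : ∀ x ∈ Icc a b, u x = u a + ∫ y in a..x, u' y

namespace IsPrimitive

variable {a b : ℝ} {u u' v v' : ℝ → E}

theorem absolutelyContinuous (h : IsPrimitive a b u u') (hab : a ≤ b) :
    AbsolutelyContinuousOnInterval u a b := by
  refine absolutelyContinuousOnInterval_of_dist_le zero_le_one
    (absolutelyContinuousOnInterval_integral h.integrable) ?_
  intro x hx y hy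
  rw [uIcc_of_le hab] at hx hy
  rw [h.eq_integral x hx, h.eq_integral y hy, one_mul, dist_add_left]

theorem continuousOn (h : IsPrimitive a b u u') (hab : a ≤ b) : ContinuousOn u (Icc a b) := by
  simpa [uIcc_of_le hab] using (h.absolutelyContinuous hab).continuousOn

theorem ae_hasDerivAt [CompleteSpace E] (h : IsPrimitive a b u u') (hab : a ≤ b) :
    ∀ᵐ x, x ∈ uIcc a b → HasDerivAt u (u' x) x := by
  have ha : ∀ᵐ x : ℝ, x ≠ a := by simp [ae_iff, measure_singleton]
  have hb : ∀ᵐ x : ℝ, x ≠ b := by simp [ae_iff, measure_singleton]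
  filter_upwards [ha, hb, h.integrable.ae_hasDerivAt_integral] with x hxa hxb hx hm
  have h1 := (hx hm a left_mem_uIcc).const_add (u a)
  rw [uIcc_of_le hab] at hm
  refine h1.congr_of_eventuallyEq ?_
  filter_upwards [Ioo_mem_nhds (lt_of_le_of_ne hm.1 (Ne.symm hxa)) (lt_of_le_of_ne hm.2 hxb)]
    with y hy
  exact h.eq_integral y (Ioo_subset_Icc_self hy)

theorem of_absolutelyContinuous [CompleteSpace E] (hab : a ≤ b)
    (hu : AbsolutelyContinuousOnInterval u a b) (hi : IntervalIntegrable u' volume a b)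
    (hd : ∀ᵐ x, x ∈ uIcc a b → HasDerivAt u (u' x) x) : IsPrimitive a b u u' :=
  ⟨hi, fun _ hx => eq_add_integral_of_absolutelyContinuous hu hi hd (by rwa [uIcc_of_le hab])⟩

theorem integral_eq_sub (h : IsPrimitive a b u u') (hab : a ≤ b) :
    ∫ y in a..b, u' y = u b - u a := by
  rw [h.eq_integral b (right_mem_Icc.2 hab)]
  abel

theorem mono (h : IsPrimitive a b u u') {c d : ℝ} (hac : a ≤ c) (hcd : c ≤ d) (hdb : d ≤ b) :
    IsPrimitive c d u u' := by
  have hab : a ≤ b := hac.trans (hcd.trans hdb)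
  have hs : ∀ x ∈ Icc a b, ∀ y ∈ Icc a b, IntervalIntegrable u' volume x y := fun x hx y hy =>
    h.integrable.mono_set (by
      rw [← uIcc_of_le hab] at hx hy
      exact uIcc_subset_uIcc hx hy)
  refine ⟨hs c ⟨hac, hcd.trans hdb⟩ d ⟨hac.trans hcd, hdb⟩, fun x hx => ?_⟩
  have hx' : x ∈ Icc a b := ⟨hac.trans hx.1, hx.2.trans hdb⟩
  have hc' : c ∈ Icc a b := ⟨hac, hcd.trans hdb⟩
  rw [h.eq_integral x hx', h.eq_integral c hc', add_assoc,
    intervalIntegral.integral_add_adjacent_intervals (hs a ⟨le_rfl, hab⟩ c hc') (hs c hc' x hx')]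

theorem of_hasDerivAt [CompleteSpace E] (hd : ∀ x, HasDerivAt u (u' x) x)
    (hc : Continuous u') : IsPrimitive a b u u' :=
  ⟨hc.intervalIntegrable _ _, fun x _ => by
    rw [intervalIntegral.integral_eq_sub_of_hasDerivAt (fun y _ => hd y)
      (hc.intervalIntegrable _ _)]
    abel⟩

theorem intervalIntegrable_of_mem (h : IsPrimitive a b u u') {x : ℝ} (hx : x ∈ Icc a b) :
    IntervalIntegrable u' volume a x :=
  (h.mono le_rfl hx.1 hx.2).integrable

theorem clm_comp [CompleteSpace E] [CompleteSpace F] (h : IsPrimitive a b u u') (T : E →L[ℝ] F) :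
    IsPrimitive a b (fun x => T (u x)) (fun x => T (u' x)) := by
  refine ⟨⟨T.integrable_comp h.integrable.1, T.integrable_comp h.integrable.2⟩, fun x hx => ?_⟩
  rw [h.eq_integral x hx, map_add,
    T.intervalIntegral_comp_comm (h.intervalIntegrable_of_mem hx)]

theorem sum {ι : Type*} (s : Finset ι) {u u' : ι → ℝ → E}
    (h : ∀ i ∈ s, IsPrimitive a b (u i) (u' i)) :
    IsPrimitive a b (fun x => ∑ i ∈ s, u i x) (fun x => ∑ i ∈ s, u' i x) := by
  refine ⟨?_, fun x hx => ?_⟩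
  · have e : (fun x => ∑ i ∈ s, u' i x) = ∑ i ∈ s, u' i := by
      funext x
      simp
    rw [e]
    exact IntervalIntegrable.sum s (fun i hi => (h i hi).integrable)
  · rw [intervalIntegral.integral_finsetSum
      (fun i hi => (h i hi).intervalIntegrable_of_mem hx), ← Finset.sum_add_distrib]
    exact Finset.sum_congr rfl fun i hi => (h i hi).eq_integral x hx

/-- The product rule. -/
theorem smul {G : Type*} [NormedAddCommGroup G] [NormedSpace ℝ G] [CompleteSpace G]
    [NormedSpace ℂ G] [IsScalarTower ℝ ℂ G] {u u' : ℝ → ℂ} {v v' : ℝ → G} (hab : a ≤ b)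
    (hu : IsPrimitive a b u u') (hv : IsPrimitive a b v v') :
    IsPrimitive a b (fun x => u x • v x) (fun x => u x • v' x + u' x • v x) := by
  have hcu : ContinuousOn u (uIcc a b) := by rw [uIcc_of_le hab]; exact hu.continuousOn hab
  have hcv : ContinuousOn v (uIcc a b) := by rw [uIcc_of_le hab]; exact hv.continuousOn hab
  refine of_absolutelyContinuous hab
    ((hu.absolutelyContinuous hab).smul (hv.absolutelyContinuous hab))
    ((hv.integrable.continuousOn_smul hcu).add (hu.integrable.smul_continuousOn hcv)) ?_
  filter_upwards [hu.ae_hasDerivAt hab, hv.ae_hasDerivAt hab] with x h1 h2 hx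
  exact (h1 hx).smul (h2 hx)

theorem mul {u u' v v' : ℝ → ℂ} (hab : a ≤ b) (hu : IsPrimitive a b u u')
    (hv : IsPrimitive a b v v') :
    IsPrimitive a b (fun x => u x * v x) (fun x => u x * v' x + u' x * v x) :=
  hu.smul hab hv

theorem add (hu : IsPrimitive a b u u') (hv : IsPrimitive a b v v') :
    IsPrimitive a b (fun x => u x + v x) (fun x => u' x + v' x) := by
  refine ⟨hu.integrable.add hv.integrable, fun x hx => ?_⟩
  rw [intervalIntegral.integral_add (hu.intervalIntegrable_of_mem hx)
    (hv.intervalIntegrable_of_mem hx), hu.eq_integral x hx, hv.eq_integral x hx]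
  abel

theorem conj {u u' : ℝ → ℂ} (hu : IsPrimitive a b u u') :
    IsPrimitive a b (fun x => star (u x)) (fun x => star (u' x)) :=
  hu.clm_comp (Complex.conjCLE : ℂ →L[ℝ] ℂ)

theorem const_mul {u u' : ℝ → ℂ} (c : ℂ) (hu : IsPrimitive a b u u') :
    IsPrimitive a b (fun x => c * u x) (fun x => c * u' x) :=
  hu.clm_comp ((ContinuousLinearMap.mul ℂ ℂ c).restrictScalars ℝ)

/-- The phase factor `exp(i ∫ A')` is absolutely continuous. -/
theorem cexp_I {A A' : ℝ → ℝ} (hab : a ≤ b) (hA : IsPrimitive a b A A') :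
    IsPrimitive a b (fun x => Complex.exp (A x * Complex.I))
      (fun x => Complex.exp (A x * Complex.I) * (A' x * Complex.I)) := by
  have hcA : ContinuousOn A (uIcc a b) := by rw [uIcc_of_le hab]; exact hA.continuousOn hab
  have hce : ContinuousOn (fun x => Complex.exp (A x * Complex.I)) (uIcc a b) := by fun_prop
  refine of_absolutelyContinuous hab ?_ ?_ ?_
  · refine absolutelyContinuousOnInterval_of_dist_le zero_le_one (hA.absolutelyContinuous hab) ?_
    intro x _ y _
    have h1 : Complex.exp (A x * Complex.I) - Complex.exp (A y * Complex.I) =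
        Complex.exp (A y * Complex.I) * (Complex.exp (Complex.I * ((A x - A y : ℝ) : ℂ)) - 1) := by
      rw [mul_sub, ← Complex.exp_add, mul_one]
      congr 2
      push_cast
      ring
    rw [dist_eq_norm, h1, norm_mul, Complex.norm_exp_ofReal_mul_I, one_mul, one_mul, dist_eq_norm]
    exact Real.norm_exp_I_mul_ofReal_sub_one_le
  · have h : IntervalIntegrable (fun x => ((A' x : ℝ) : ℂ) * Complex.I) volume a b :=
      IntervalIntegrable.mul_const ⟨hA.integrable.1.ofReal, hA.integrable.2.ofReal⟩ _
    exact h.continuousOn_mul hce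
  · filter_upwards [hA.ae_hasDerivAt hab] with x h1 hx
    exact (((h1 hx).ofReal_comp).mul_const Complex.I).cexp

end IsPrimitive

end AbsolutelyContinuous

/-! ### Removing the magnetic potential by a gauge transformation -/

section Gauge

theorem IsPeriodicAC.isPrimitive {M : ℕ} {L : ℝ} {u u' : ℝ → EuclideanSpace ℂ (Fin M)}
    (h : IsPeriodicAC L u u') : IsPrimitive 0 L u u' :=
  ⟨h.integrable, h.eq_integral⟩

theorem densityMatrix_smul {M N : ℕ} (ψ : Fin N → ℝ → EuclideanSpace ℂ (Fin M)) (z : ℝ → ℂ)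
    {x : ℝ} (hz : z x * star (z x) = 1) :
    densityMatrix (fun n x => z x • ψ n x) x = densityMatrix ψ x := by
  ext i j
  simp only [densityMatrix, Matrix.sum_apply, Matrix.of_apply, PiLp.smul_apply, smul_eq_mul,
    star_mul']
  refine Finset.sum_congr rfl fun n _ => ?_
  linear_combination (ψ n x i * star (ψ n x j)) * hz

/-- It suffices to prove the inequality for vanishing magnetic potential and quasi-periodic
functions: the gauge transformation `w = exp(i ∫ a) ψ` turns `‖i ψ' - a ψ‖` into `‖w'‖` and
periodicity into `w(L) = exp(2πiα) w(0)`. -/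
theorem isAdmissible_of_quasiperiodic {α K : ℝ} (hK : 0 ≤ K)
    (H : ∀ L : ℝ, 0 < L → ∀ (M N : ℕ) (w w' : Fin N → ℝ → EuclideanSpace ℂ (Fin M)),
      (∀ n, IsPrimitive 0 L (w n) (w' n)) →
      (∀ n, w n L = Complex.exp ((2 * Real.pi * α : ℝ) * Complex.I) • w n 0) →
      (∀ n, MemLp (w' n) 2 (volume.restrict (Ioc 0 L))) →
      (∀ n m, ∫ x in (0 : ℝ)..L, inner ℂ (w n x) (w m x) = if n = m then 1 else 0) →
      ∫ x in (0 : ℝ)..L, (Matrix.trace (densityMatrix w x ^ 3)).re ≤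
        K * ∑ n, ∫ x in (0 : ℝ)..L, ‖w' n x‖ ^ 2) : IsAdmissible α K := by
  refine ⟨hK, fun L a hL ha hflux M N ψ ψ' hψ hmem horth => ?_⟩
  set A : ℝ → ℝ := fun x => ∫ y in (0 : ℝ)..x, a y with hA
  have hAp : IsPrimitive 0 L A a := ⟨ha, fun x _ => by simp [hA]⟩
  have hAL : A L = 2 * Real.pi * α := by
    rw [← hflux, flux, hA]
    field_simp
  set z : ℝ → ℂ := fun x => Complex.exp (A x * Complex.I) with hz
  have hz1 : ∀ x, ‖z x‖ = 1 := fun x => Complex.norm_exp_ofReal_mul_I _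
  have hzz : ∀ x, z x * star (z x) = 1 := fun x => by
    rw [Complex.star_def, Complex.mul_conj, Complex.normSq_eq_norm_sq, hz1]
    simp
  have hd : ∀ n x, z x • ψ' n x + (z x * (a x * Complex.I)) • ψ n x =
      (-Complex.I * z x) • magDeriv a (ψ n) (ψ' n) x := fun n x => by
    rw [magDeriv, smul_sub, smul_smul, smul_smul, sub_eq_add_neg, ← neg_smul]
    congr 2
    · linear_combination z x * Complex.I_mul_I
    · ring
  have hnorm : ∀ n x, ‖z x • ψ' n x + (z x * (a x * Complex.I)) • ψ n x‖ =
      ‖magDeriv a (ψ n) (ψ' n) x‖ := fun n x => by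
    rw [hd, norm_smul, norm_mul, hz1]
    simp
  have hprim : ∀ n, IsPrimitive 0 L (fun x => z x • ψ n x)
      (fun x => z x • ψ' n x + (z x * (a x * Complex.I)) • ψ n x) := fun n =>
    (hAp.cexp_I hL.le).smul hL.le (hψ n).isPrimitive
  have key := H L hL M N (fun n x => z x • ψ n x)
    (fun n x => z x • ψ' n x + (z x * (a x * Complex.I)) • ψ n x) hprim ?_ ?_ ?_
  · simp only [hnorm] at key
    simpa only [densityMatrix_smul ψ z (hzz _)] using key
  · intro n
    simp only [hz, hAL, (hψ n).periodic]
    simp [hA]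
  · intro n
    refine (hmem n).of_le ?_ (ae_of_all _ fun x => (hnorm n x).le)
    have := (hprim n).integrable.1.aestronglyMeasurable
    exact this
  · intro n m
    rw [← horth n m]
    refine intervalIntegral.integral_congr fun x _ => ?_
    simp only [inner_smul_left, inner_smul_right]
    rw [← mul_assoc]
    exact (congrArg (· * _) (hzz x)).trans (one_mul _)

end Gauge

/-! ### Trace inequalities for Hermitian matrices -/

section Trace

variable {M N : ℕ}

theorem trace_cfc_re {A : Matrix (Fin M) (Fin M) ℂ} (hA : A.IsHermitian) (f : ℝ → ℝ) :
    (Matrix.trace (cfc f A)).re = ∑ j, f (hA.eigenvalues j) := by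
  rw [hA.cfc_eq, Matrix.IsHermitian.cfc, Unitary.conjStarAlgAut_apply, Matrix.trace_mul_comm,
    ← mul_assoc]
  simp [Matrix.trace]

theorem trace_pow_re {A : Matrix (Fin M) (Fin M) ℂ} (hA : A.IsHermitian) (k : ℕ) :
    (Matrix.trace (A ^ k)).re = ∑ j, hA.eigenvalues j ^ k := by
  rw [← trace_cfc_re hA (fun t => t ^ k), cfc_pow_id (R := ℝ) A k hA.isSelfAdjoint]

theorem toEuclideanLin_eigenvectorBasis {A : Matrix (Fin M) (Fin M) ℂ} (hA : A.IsHermitian)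
    (j : Fin M) : Matrix.toEuclideanLin A (hA.eigenvectorBasis j) =
      (hA.eigenvalues j : ℂ) • hA.eigenvectorBasis j := by
  have h := hA.mulVec_eigenvectorBasis j
  ext i
  have := congrFun h i
  simpa [Matrix.toLpLin_apply] using this

theorem inner_toEuclideanLin_comm {A : Matrix (Fin M) (Fin M) ℂ} (hA : A.IsHermitian)
    (v w : EuclideanSpace ℂ (Fin M)) :
    inner ℂ (Matrix.toEuclideanLin A v) w = inner ℂ v (Matrix.toEuclideanLin A w) :=
  Matrix.isSymmetric_toEuclideanLin_iff.2 hA v w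

theorem inner_toEuclideanLin_self {A : Matrix (Fin M) (Fin M) ℂ} (hA : A.IsHermitian)
    (v : EuclideanSpace ℂ (Fin M)) :
    inner ℂ v (Matrix.toEuclideanLin A v) =
      ((∑ j, hA.eigenvalues j * ‖inner ℂ (hA.eigenvectorBasis j) v‖ ^ 2 : ℝ) : ℂ) := by
  rw [← OrthonormalBasis.sum_inner_mul_inner hA.eigenvectorBasis, Complex.ofReal_sum]
  refine Finset.sum_congr rfl fun j _ => ?_
  rw [← inner_toEuclideanLin_comm hA, toEuclideanLin_eigenvectorBasis, inner_smul_left,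
    Complex.conj_ofReal, ← inner_conj_symm v, mul_left_comm, ← Complex.normSq_eq_conj_mul_self,
    Complex.normSq_eq_norm_sq]
  push_cast
  rfl

theorem isHermitian_densityMatrix (ψ : Fin N → ℝ → EuclideanSpace ℂ (Fin M)) (x : ℝ) :
    (densityMatrix ψ x).IsHermitian := by
  ext i j
  simp only [densityMatrix, Matrix.conjTranspose_apply, Matrix.sum_apply, Matrix.of_apply,
    star_sum, star_mul', star_star]
  exact Finset.sum_congr rfl fun n _ => mul_comm _ _

theorem toEuclideanLin_densityMatrix (ψ : Fin N → ℝ → EuclideanSpace ℂ (Fin M)) (x : ℝ)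
    (v : EuclideanSpace ℂ (Fin M)) :
    Matrix.toEuclideanLin (densityMatrix ψ x) v = ∑ n, inner ℂ (ψ n x) v • ψ n x := by
  ext i
  simp only [densityMatrix, Matrix.toLpLin_apply, Matrix.mulVec, dotProduct, Matrix.sum_apply,
    Matrix.of_apply, WithLp.ofLp_sum, Finset.sum_apply, WithLp.ofLp_smul, Pi.smul_apply,
    smul_eq_mul, PiLp.inner_apply, RCLike.inner_apply, Finset.sum_mul]
  rw [Finset.sum_comm]
  refine Finset.sum_congr rfl fun n _ => Finset.sum_congr rfl fun j _ => ?_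
  rw [Complex.star_def]
  ring

theorem inner_densityMatrix (ψ : Fin N → ℝ → EuclideanSpace ℂ (Fin M)) (x : ℝ)
    (v : EuclideanSpace ℂ (Fin M)) :
    inner ℂ v (Matrix.toEuclideanLin (densityMatrix ψ x) v) =
      ((∑ n, ‖inner ℂ v (ψ n x)‖ ^ 2 : ℝ) : ℂ) := by
  rw [toEuclideanLin_densityMatrix, inner_sum, Complex.ofReal_sum]
  refine Finset.sum_congr rfl fun n _ => ?_
  rw [inner_smul_right, ← inner_conj_symm (ψ n x), ← Complex.normSq_eq_conj_mul_self,
    Complex.normSq_eq_norm_sq]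

theorem eigenvalues_densityMatrix (ψ : Fin N → ℝ → EuclideanSpace ℂ (Fin M)) (x : ℝ)
    (j : Fin M) : (isHermitian_densityMatrix ψ x).eigenvalues j =
      ∑ n, ‖inner ℂ ((isHermitian_densityMatrix ψ x).eigenvectorBasis j) (ψ n x)‖ ^ 2 := by
  have h := inner_densityMatrix ψ x ((isHermitian_densityMatrix ψ x).eigenvectorBasis j)
  rw [toEuclideanLin_eigenvectorBasis, inner_smul_right, inner_self_eq_norm_sq_to_K,
    OrthonormalBasis.norm_eq_one] at h
  simpa only [map_one, one_pow, mul_one, Complex.ofReal_re] using congrArg Complex.re h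

theorem eigenvalues_densityMatrix_nonneg (ψ : Fin N → ℝ → EuclideanSpace ℂ (Fin M)) (x : ℝ)
    (j : Fin M) : 0 ≤ (isHermitian_densityMatrix ψ x).eigenvalues j := by
  rw [eigenvalues_densityMatrix]
  positivity

/-- Peierls' inequality for the cube: by Jensen, the cubes of the diagonal entries of `U` in any
orthonormal basis add up to at most `Tr U³`. -/
theorem sum_diagonal_pow_three_le (ψ : Fin N → ℝ → EuclideanSpace ℂ (Fin M)) (x : ℝ)
    (e : OrthonormalBasis (Fin M) ℂ (EuclideanSpace ℂ (Fin M))) :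
    ∑ i, (∑ n, ‖inner ℂ (e i) (ψ n x)‖ ^ 2) ^ 3 ≤ (Matrix.trace (densityMatrix ψ x ^ 3)).re := by
  set hU := isHermitian_densityMatrix ψ x
  have hdiag : ∀ i, ∑ n, ‖inner ℂ (e i) (ψ n x)‖ ^ 2 =
      ∑ j, ‖inner ℂ (hU.eigenvectorBasis j) (e i)‖ ^ 2 * hU.eigenvalues j := fun i => by
    have h := (inner_densityMatrix ψ x (e i)).symm.trans (inner_toEuclideanLin_self hU (e i))
    rw [Complex.ofReal_inj.1 h]
    exact Finset.sum_congr rfl fun j _ => mul_comm _ _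
  have hw : ∀ i, ∑ j, ‖inner ℂ (hU.eigenvectorBasis j) (e i)‖ ^ 2 = 1 := fun i => by
    rw [OrthonormalBasis.sum_sq_norm_inner_right, e.norm_eq_one, one_pow]
  have hw' : ∀ j, ∑ i, ‖inner ℂ (hU.eigenvectorBasis j) (e i)‖ ^ 2 = 1 := fun j => by
    rw [OrthonormalBasis.sum_sq_norm_inner_left, hU.eigenvectorBasis.norm_eq_one, one_pow]
  calc ∑ i, (∑ n, ‖inner ℂ (e i) (ψ n x)‖ ^ 2) ^ 3
      ≤ ∑ i, ∑ j, ‖inner ℂ (hU.eigenvectorBasis j) (e i)‖ ^ 2 * hU.eigenvalues j ^ 3 := by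
        refine Finset.sum_le_sum fun i _ => ?_
        rw [hdiag]
        exact Real.pow_arith_mean_le_arith_mean_pow _ _ _ (fun j _ => by positivity) (hw i)
          (fun j _ => eigenvalues_densityMatrix_nonneg ψ x j) 3
    _ = ∑ j, hU.eigenvalues j ^ 3 := by
        rw [Finset.sum_comm]
        refine Finset.sum_congr rfl fun j _ => ?_
        rw [← Finset.sum_mul, hw', one_mul]
    _ = _ := (trace_pow_re hU 3).symm

/-- Young's inequality with exponents `3/2` and `3`; its constant is the one relating `K` to the
moment inequality with exponent `1`. -/
theorem mul_le_young {K : ℝ} (hK : 0 < K) (s : ℝ) {q : ℝ} (hq : 0 ≤ q) :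
    s * q ≤ 2 / (3 * √3) * √K * (max s 0) ^ (3 / 2 : ℝ) + 1 / K * q ^ 3 := by
  set y := √(max s 0) with hy
  have hy0 : 0 ≤ y := Real.sqrt_nonneg _
  have hy2 : y ^ 2 = max s 0 := Real.sq_sqrt (le_max_right _ _)
  have hpow : (max s 0) ^ (3 / 2 : ℝ) = y ^ 3 := by
    rw [← hy2, ← Real.rpow_natCast y 2, ← Real.rpow_mul hy0, ← Real.rpow_natCast y 3]
    norm_num
  have h3 : (0 : ℝ) < √3 := by positivity
  have h33 : √3 ^ 2 = (3 : ℝ) := Real.sq_sqrt (by norm_num)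
  have hr : 0 < √K := Real.sqrt_pos.2 hK
  have hr2 : √K ^ 2 = K := Real.sq_sqrt hK.le
  set z := q * √3 / √K with hz
  have hz0 : 0 ≤ z := by positivity
  have hqz : q = √K / √3 * z := by rw [hz]; field_simp
  have hs : s * q ≤ y ^ 2 * q := mul_le_mul_of_nonneg_right (hy2 ▸ le_max_left _ _) hq
  have hK3 : 1 / K * q ^ 3 = √K / √3 * (z ^ 3 / 3) := by
    have hK' : 1 / K = 1 / √K ^ 2 := by rw [hr2]
    rw [hK', hqz, mul_pow, div_pow, pow_succ (√3) 2, h33]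
    field_simp
  -- after rescaling, the inequality is that of arithmetic and geometric means for `y, y, z`
  have hamgm : y ^ 2 * z ≤ (2 * y ^ 3 + z ^ 3) / 3 := by
    nlinarith [mul_nonneg (sq_nonneg (y - z)) (by positivity : 0 ≤ 2 * y + z)]
  have hc : 2 / (3 * √3) * √K = √K / √3 * (2 / 3) := by field_simp
  rw [hpow, hK3, hc]
  have := mul_le_mul_of_nonneg_left hamgm (by positivity : 0 ≤ √K / √3)
  calc s * q ≤ y ^ 2 * q := hs
    _ = √K / √3 * (y ^ 2 * z) := by rw [hqz]; ring
    _ ≤ _ := by linarith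

/-- The Young-type duality between `Tr (A - τ)₊^{3/2}` and `Tr U³`, pointwise in `x`. -/
theorem sum_inner_le_trace {A : Matrix (Fin M) (Fin M) ℂ} (hA : A.IsHermitian) {K : ℝ}
    (hK : 0 < K) (τ : ℝ) (ψ : Fin N → ℝ → EuclideanSpace ℂ (Fin M)) (x : ℝ) :
    ∑ n, ((inner ℂ (ψ n x) (Matrix.toEuclideanLin A (ψ n x))).re - τ * ‖ψ n x‖ ^ 2) ≤
      2 / (3 * √3) * √K *
        (Matrix.trace (cfc (fun t : ℝ => max (t - τ) 0 ^ (3 / 2 : ℝ)) A)).re +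
      1 / K * (Matrix.trace (densityMatrix ψ x ^ 3)).re := by
  set e := hA.eigenvectorBasis
  have h1 : ∑ n, ((inner ℂ (ψ n x) (Matrix.toEuclideanLin A (ψ n x))).re - τ * ‖ψ n x‖ ^ 2) =
      ∑ j, (hA.eigenvalues j - τ) * ∑ n, ‖inner ℂ (e j) (ψ n x)‖ ^ 2 := by
    simp_rw [Finset.mul_sum]
    rw [Finset.sum_comm]
    refine Finset.sum_congr rfl fun n _ => ?_
    rw [inner_toEuclideanLin_self hA, Complex.ofReal_re, ← e.sum_sq_norm_inner_right,
      Finset.mul_sum, ← Finset.sum_sub_distrib]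
    exact Finset.sum_congr rfl fun j _ => by ring
  rw [h1, trace_cfc_re hA, Finset.mul_sum]
  calc ∑ j, (hA.eigenvalues j - τ) * ∑ n, ‖inner ℂ (e j) (ψ n x)‖ ^ 2
      ≤ ∑ j, (2 / (3 * √3) * √K * (max (hA.eigenvalues j - τ) 0) ^ (3 / 2 : ℝ) +
          1 / K * (∑ n, ‖inner ℂ (e j) (ψ n x)‖ ^ 2) ^ 3) :=
        Finset.sum_le_sum fun j _ => mul_le_young hK _ (by positivity)
    _ ≤ _ := by
        rw [Finset.sum_add_distrib, ← Finset.mul_sum (a := 1 / K)]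
        gcongr
        exact sum_diagonal_pow_three_le ψ x e

end Trace

/-! ### The sharp one-dimensional interpolation inequality -/

section Interpolation

theorem IsPrimitive.memLp {E : Type*} [NormedAddCommGroup E] [NormedSpace ℝ E] [CompleteSpace E]
    [SecondCountableTopology E]
    {a b : ℝ} {u u' : ℝ → E} (h : IsPrimitive a b u u') (hab : a ≤ b) (p : ENNReal) :
    MemLp u p (volume.restrict (Ioc a b)) := by
  have hc := h.continuousOn hab
  obtain ⟨C, hC⟩ := isCompact_Icc.exists_bound_of_continuousOn hc
  have hm : AEStronglyMeasurable u (volume.restrict (Ioc a b)) := by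
    borelize E
    exact ((hc.mono Ioc_subset_Icc_self).aemeasurable measurableSet_Ioc).aestronglyMeasurable
  exact MemLp.of_bound hm C ((ae_restrict_iff' measurableSet_Ioc).2
    (ae_of_all _ fun x hx => hC x (Ioc_subset_Icc_self hx)))

theorem MemLp.intervalIntegrable_norm_sq {E : Type*} [NormedAddCommGroup E] {a b : ℝ}
    (hab : a ≤ b) {f : ℝ → E} (hf : MemLp f 2 (volume.restrict (Ioc a b))) :
    IntervalIntegrable (fun x => ‖f x‖ ^ 2) volume a b :=
  (intervalIntegrable_iff_integrableOn_Ioc_of_le hab).2 (hf.integrable_norm_pow two_ne_zero)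

/-- The Cauchy–Schwarz inequality for interval integrals. -/
theorem sq_integral_mul_le {f g : ℝ → ℝ} {a b : ℝ} (hab : a ≤ b)
    (hf : MemLp f 2 (volume.restrict (Ioc a b))) (hg : MemLp g 2 (volume.restrict (Ioc a b))) :
    (∫ x in a..b, f x * g x) ^ 2 ≤ (∫ x in a..b, f x ^ 2) * ∫ x in a..b, g x ^ 2 := by
  have hff : IntervalIntegrable (fun x => f x ^ 2) volume a b := by
    simpa using MemLp.intervalIntegrable_norm_sq hab hf
  have hgg : IntervalIntegrable (fun x => g x ^ 2) volume a b := by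
    simpa using MemLp.intervalIntegrable_norm_sq hab hg
  have hfg : IntervalIntegrable (fun x => f x * g x) volume a b :=
    (intervalIntegrable_iff_integrableOn_Ioc_of_le hab).2 (hf.integrable_mul hg)
  have h : ∀ s : ℝ, 0 ≤ (∫ x in a..b, f x ^ 2) * (s * s) + (2 * ∫ x in a..b, f x * g x) * s +
      ∫ x in a..b, g x ^ 2 := fun s => by
    have e : ∫ x in a..b, (s * f x + g x) ^ 2 = (∫ x in a..b, f x ^ 2) * (s * s) +
        (2 * ∫ x in a..b, f x * g x) * s + ∫ x in a..b, g x ^ 2 := by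
      rw [← intervalIntegral.integral_mul_const, ← intervalIntegral.integral_const_mul,
        ← intervalIntegral.integral_mul_const,
        ← intervalIntegral.integral_add (hff.mul_const _) ((hfg.const_mul _).mul_const _),
        ← intervalIntegral.integral_add ((hff.mul_const _).add ((hfg.const_mul _).mul_const _)) hgg]
      exact intervalIntegral.integral_congr fun x _ => by ring
    rw [← e]
    exact intervalIntegral.integral_nonneg hab fun x _ => sq_nonneg _
  have := discrim_le_zero h
  rw [discrim] at this
  nlinarith

variable {L θ : ℝ} {w w' : ℝ → ℂ}

/-- Since `(w²)' = 2 w w'`, quasi-periodicity gives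
`(e^{2iθ} - 1) w(x)² = e^{2iθ} ∫₀ˣ 2 w w' + ∫ₓᴸ 2 w w'`. -/
theorem sin_sq_mul_norm_le (hL : 0 < L) (hw : IsPrimitive 0 L w w')
    (hq : w L = Complex.exp (θ * Complex.I) * w 0)
    (hm : MemLp w' 2 (volume.restrict (Ioc 0 L))) {x : ℝ} (hx : x ∈ Icc 0 L) :
    Real.sin θ ^ 2 * (‖w x‖ ^ 2) ^ 2 ≤
      (∫ y in (0 : ℝ)..L, ‖w y‖ ^ 2) * ∫ y in (0 : ℝ)..L, ‖w' y‖ ^ 2 := by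
  set c := Complex.exp (θ * Complex.I) with hc
  have hc1 : ‖c‖ = 1 := Complex.norm_exp_ofReal_mul_I θ
  have h1 := ((hw.mono le_rfl hx.1 hx.2).mul hx.1 (hw.mono le_rfl hx.1 hx.2)).integral_eq_sub hx.1
  have h2 := ((hw.mono hx.1 hx.2 le_rfl).mul hx.2 (hw.mono hx.1 hx.2 le_rfl)).integral_eq_sub hx.2
  have hwL := hw.memLp hL.le 2
  have hi : IntervalIntegrable (fun y => ‖w y‖ * ‖w' y‖) volume 0 L :=
    (intervalIntegrable_iff_integrableOn_Ioc_of_le hL.le).2 (hwL.norm.integrable_mul hm.norm)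
  have hi1 : IntervalIntegrable (fun y => ‖w y‖ * ‖w' y‖) volume 0 x := hi.mono_set (by
    rw [uIcc_of_le hx.1, uIcc_of_le hL.le]; exact Icc_subset_Icc_right hx.2)
  have hi2 : IntervalIntegrable (fun y => ‖w y‖ * ‖w' y‖) volume x L := hi.mono_set (by
    rw [uIcc_of_le hx.2, uIcc_of_le hL.le]; exact Icc_subset_Icc_left hx.1)
  have bound : ∀ a b : ℝ, a ≤ b → IntervalIntegrable (fun y => ‖w y‖ * ‖w' y‖) volume a b →
      ‖∫ y in a..b, (w y * w' y + w' y * w y)‖ ≤ 2 * ∫ y in a..b, ‖w y‖ * ‖w' y‖ := by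
    intro a b hab h
    rw [← intervalIntegral.integral_const_mul]
    refine intervalIntegral.norm_integral_le_of_norm_le hab ?_ (h.const_mul 2)
    refine ae_of_all _ fun y _ => ?_
    rw [mul_comm (w' y), ← two_mul, norm_mul, norm_mul]
    simp
  have hid : (c ^ 2 - 1) * (w x * w x) = c ^ 2 * (∫ y in (0 : ℝ)..x, (w y * w' y + w' y * w y)) +
      ∫ y in x..L, (w y * w' y + w' y * w y) := by
    rw [h1, h2, hq]
    ring
  have hsin : ‖c ^ 2 - 1‖ = 2 * |Real.sin θ| := by
    have hcc : c ^ 2 - 1 = c * (2 * Real.sin θ * Complex.I) := by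
      have h3 : c = Real.cos θ + Real.sin θ * Complex.I := by
        rw [hc, Complex.exp_mul_I]; simp
      have h4 : (Real.cos θ : ℂ) ^ 2 + (Real.sin θ : ℂ) ^ 2 = 1 := by
        exact_mod_cast Real.cos_sq_add_sin_sq θ
      rw [h3]
      linear_combination h4 - (Real.sin θ : ℂ) ^ 2 * Complex.I_sq
    rw [hcc, norm_mul, hc1, norm_mul, norm_mul, Complex.norm_real]
    simp [-Complex.ofReal_sin]
  have hle : 2 * |Real.sin θ| * ‖w x‖ ^ 2 ≤ 2 * ∫ y in (0 : ℝ)..L, ‖w y‖ * ‖w' y‖ := by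
    rw [← hsin, sq ‖w x‖, ← norm_mul, ← norm_mul, hid,
      ← intervalIntegral.integral_add_adjacent_intervals hi1 hi2, mul_add]
    refine (norm_add_le _ _).trans (add_le_add ?_ (bound _ _ hx.2 hi2))
    rw [norm_mul, norm_pow, hc1, one_pow, one_mul]
    exact bound _ _ hx.1 hi1
  have hcs := sq_integral_mul_le hL.le hwL.norm hm.norm
  refine le_trans ?_ hcs
  have h5 : |Real.sin θ| * ‖w x‖ ^ 2 ≤ ∫ y in (0 : ℝ)..L, ‖w y‖ * ‖w' y‖ := by linarith
  calc Real.sin θ ^ 2 * (‖w x‖ ^ 2) ^ 2 = (|Real.sin θ| * ‖w x‖ ^ 2) ^ 2 := by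
        rw [mul_pow, sq_abs]
    _ ≤ _ := pow_le_pow_left₀ (by positivity) h5 2

/-- Calibration: for a solution `p` of `p'' = μ² p`, the pointwise inequality
`|w' - p'|² + μ² |w - p|² ≥ 0` bounds the energy of `w` below by boundary terms. -/
theorem boundary_le_energy {a b : ℝ} (hab : a ≤ b) (hw : IsPrimitive a b w w')
    (hm : MemLp w' 2 (volume.restrict (Ioc a b))) (μ : ℝ) {p q : ℝ → ℂ}
    (hp : ∀ y, HasDerivAt p (q y) y) (hq : ∀ y, HasDerivAt q (μ ^ 2 * p y) y) :
    ((2 * w b - p b) * star (q b)).re - ((2 * w a - p a) * star (q a)).re ≤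
      (∫ y in a..b, ‖w' y‖ ^ 2) + μ ^ 2 * ∫ y in a..b, ‖w y‖ ^ 2 := by
  have hcp : Continuous p := continuous_iff_continuousAt.2 fun y => (hp y).continuousAt
  have hcq : Continuous q := continuous_iff_continuousAt.2 fun y => (hq y).continuousAt
  have hP : IsPrimitive a b p q := .of_hasDerivAt hp hcq
  have hQ : IsPrimitive a b q (fun y => μ ^ 2 * p y) := .of_hasDerivAt hq (by fun_prop)
  have h1 := ((((hw.const_mul 2).add (hP.const_mul (-1))).mul hab hQ.conj).clm_comp
    Complex.reCLM)
  have h2 := h1.integral_eq_sub hab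
  simp only [Complex.reCLM_apply] at h2
  have e : ∀ y, (2 * w y - p y) = 2 * w y + -1 * p y := fun y => by ring
  rw [e, e, ← h2, ← intervalIntegral.integral_const_mul, ← intervalIntegral.integral_add
    (MemLp.intervalIntegrable_norm_sq hab hm)
    ((MemLp.intervalIntegrable_norm_sq hab (hw.memLp hab 2)).const_mul _)]
  refine intervalIntegral.integral_mono_on hab h1.integrable
    ((MemLp.intervalIntegrable_norm_sq hab hm).add
      ((MemLp.intervalIntegrable_norm_sq hab (hw.memLp hab 2)).const_mul _)) fun y _ => ?_
  simp only [Complex.sq_norm, Complex.normSq_apply, Complex.star_def]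
  simp [← Complex.ofReal_pow]
  nlinarith [sq_nonneg ((w' y).re - (q y).re), sq_nonneg ((w' y).im - (q y).im),
    sq_nonneg (μ * ((w y).re - (p y).re)), sq_nonneg (μ * ((w y).im - (p y).im))]

/-- If `cos θ ≤ 0`, the energy `‖w'‖² + μ² ‖w‖²` controls `2 μ |w(x)|²`.  The calibrating function
is `w(x)` times the sum of the decaying exponential centred at `x` and its two neighbouring
images under the quasi-periodic translation. -/
theorem two_mul_norm_sq_le_energy (hw : IsPrimitive 0 L w w')
    (hq : w L = Complex.exp (θ * Complex.I) * w 0) (hθ : Real.cos θ ≤ 0)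
    (hm : MemLp w' 2 (volume.restrict (Ioc 0 L))) {x : ℝ} (hx : x ∈ Icc 0 L) {μ : ℝ}
    (hμ : 0 < μ) :
    2 * μ * ‖w x‖ ^ 2 ≤
      (∫ y in (0 : ℝ)..L, ‖w' y‖ ^ 2) + μ ^ 2 * ∫ y in (0 : ℝ)..L, ‖w y‖ ^ 2 := by
  set c := Complex.exp (θ * Complex.I) with hc
  have hcre : c.re = Real.cos θ := Complex.exp_ofReal_mul_I_re θ
  have hcim : c.im = Real.sin θ := Complex.exp_ofReal_mul_I_im θ
  have hcc : star c * c = 1 := by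
    rw [Complex.star_def, ← Complex.normSq_eq_conj_mul_self, Complex.normSq_eq_norm_sq,
      Complex.norm_exp_ofReal_mul_I]
    simp
  have hexp : ∀ s r : ℝ, ∀ y, HasDerivAt (fun y : ℝ => ((Real.exp (s * y + r) : ℝ) : ℂ))
      (s * (Real.exp (s * y + r) : ℝ)) y := fun s r y => by
    have h := ((((hasDerivAt_id y).const_mul s).add_const r).exp).ofReal_comp
    simpa [mul_comm] using h
  -- the calibrations on `[0, x]` and on `[x, L]`, and their derivatives
  set p₁ : ℝ → ℂ := fun y => w x * (star c * (Real.exp (-μ * y + (-μ * (L - x))) : ℝ) +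
    (Real.exp (μ * y + (-μ * x)) : ℝ)) with hp₁
  set q₁ : ℝ → ℂ := fun y => w x * (star c * ((-μ : ℝ) * (Real.exp (-μ * y + (-μ * (L - x))) : ℝ)) +
    μ * (Real.exp (μ * y + (-μ * x)) : ℝ)) with hq₁
  set p₂ : ℝ → ℂ := fun y => w x * (c * (Real.exp (μ * y + (-μ * (L + x))) : ℝ) +
    (Real.exp (-μ * y + (μ * x)) : ℝ)) with hp₂
  set q₂ : ℝ → ℂ := fun y => w x * (c * (μ * (Real.exp (μ * y + (-μ * (L + x))) : ℝ)) +
    (-μ : ℝ) * (Real.exp (-μ * y + (μ * x)) : ℝ)) with hq₂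
  have d1 : ∀ y, HasDerivAt p₁ (q₁ y) y := fun y =>
    (((hexp (-μ) (-μ * (L - x)) y).const_mul (star c)).add (hexp μ (-μ * x) y)).const_mul (w x)
  have d2 : ∀ y, HasDerivAt q₁ (μ ^ 2 * p₁ y) y := fun y => by
    refine (((((hexp (-μ) (-μ * (L - x)) y).const_mul ((-μ : ℝ) : ℂ)).const_mul (star c)).add
      ((hexp μ (-μ * x) y).const_mul (μ : ℂ))).const_mul (w x)).congr_deriv ?_
    simp only [hp₁]; push_cast; ring
  have d3 : ∀ y, HasDerivAt p₂ (q₂ y) y := fun y =>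
    (((hexp μ (-μ * (L + x)) y).const_mul c).add (hexp (-μ) (μ * x) y)).const_mul (w x)
  have d4 : ∀ y, HasDerivAt q₂ (μ ^ 2 * p₂ y) y := fun y => by
    refine (((((hexp μ (-μ * (L + x)) y).const_mul (μ : ℂ)).const_mul c).add
      ((hexp (-μ) (μ * x) y).const_mul ((-μ : ℝ) : ℂ))).const_mul (w x)).congr_deriv ?_
    simp only [hp₂]; push_cast; ring
  have hm1 : MemLp w' 2 (volume.restrict (Ioc 0 x)) :=
    hm.mono_measure (Measure.restrict_mono (Ioc_subset_Ioc_right hx.2) le_rfl)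
  have hm2 : MemLp w' 2 (volume.restrict (Ioc x L)) :=
    hm.mono_measure (Measure.restrict_mono (Ioc_subset_Ioc_left hx.1) le_rfl)
  have hw1 := hw.mono le_rfl hx.1 hx.2
  have hw2 := hw.mono hx.1 hx.2 le_rfl
  have b1 := boundary_le_energy hx.1 hw1 hm1 μ d1 d2
  have b2 := boundary_le_energy hx.2 hw2 hm2 μ d3 d4
  have s1 := intervalIntegral.integral_add_adjacent_intervals
    (MemLp.intervalIntegrable_norm_sq hx.1 hm1) (MemLp.intervalIntegrable_norm_sq hx.2 hm2)
  have s2 := intervalIntegral.integral_add_adjacent_intervals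
    (MemLp.intervalIntegrable_norm_sq hx.1 (hw1.memLp hx.1 2))
    (MemLp.intervalIntegrable_norm_sq hx.2 (hw2.memLp hx.2 2))
  rw [← s1, ← s2]
  -- the boundary terms at `0` and at `L` cancel by quasi-periodicity
  have hLp : p₂ L = c * p₁ 0 := by
    simp only [hp₁, hp₂]
    rw [show μ * L + -μ * (L + x) = μ * 0 + -μ * x by ring,
      show -μ * L + μ * x = -μ * 0 + -μ * (L - x) by ring]
    linear_combination
      (-w x * ((Real.exp (-μ * 0 + -μ * (L - x)) : ℝ) : ℂ)) * hcc
  have hLq : q₂ L = c * q₁ 0 := by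
    simp only [hq₁, hq₂]
    rw [show μ * L + -μ * (L + x) = μ * 0 + -μ * x by ring,
      show -μ * L + μ * x = -μ * 0 + -μ * (L - x) by ring]
    linear_combination
      (-w x * ((-μ : ℝ) : ℂ) * ((Real.exp (-μ * 0 + -μ * (L - x)) : ℝ) : ℂ)) * hcc
  have hcancel : (2 * w L - p₂ L) * star (q₂ L) = (2 * w 0 - p₁ 0) * star (q₁ 0) := by
    rw [hq, hLp, hLq, star_mul']
    linear_combination ((2 * w 0 - p₁ 0) * star (q₁ 0)) * hcc
  rw [hcancel] at b2
  -- the jump at `x`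
  set ε := Real.exp (-μ * L) with hε
  have hp1x : p₁ x = w x * (star c * ε + 1) := by
    simp only [hp₁]
    rw [show -μ * x + -μ * (L - x) = -μ * L by ring, show μ * x + -μ * x = 0 by ring, Real.exp_zero,
      ← hε]
    simp
  have hq1x : q₁ x = w x * (μ * (1 - star c * ε)) := by
    simp only [hq₁]
    rw [show -μ * x + -μ * (L - x) = -μ * L by ring, show μ * x + -μ * x = 0 by ring, Real.exp_zero,
      ← hε]
    push_cast; ring
  have hp2x : p₂ x = w x * (c * ε + 1) := by
    simp only [hp₂]
    rw [show μ * x + -μ * (L + x) = -μ * L by ring, show -μ * x + μ * x = 0 by ring, Real.exp_zero,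
      ← hε]
    simp
  have hq2x : q₂ x = w x * (μ * (c * ε - 1)) := by
    simp only [hq₂]
    rw [show μ * x + -μ * (L + x) = -μ * L by ring, show -μ * x + μ * x = 0 by ring, Real.exp_zero,
      ← hε]
    push_cast; ring
  have hjump : ((2 * w x - p₁ x) * star (q₁ x)).re - ((2 * w x - p₂ x) * star (q₂ x)).re =
      2 * μ * ‖w x‖ ^ 2 * (1 - 2 * ε * Real.cos θ + ε ^ 2) := by
    have h1 : Real.cos θ ^ 2 + Real.sin θ ^ 2 = 1 := Real.cos_sq_add_sin_sq θ
    rw [hp1x, hq1x, hp2x, hq2x, Complex.sq_norm, Complex.normSq_apply]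
    simp [hcre, hcim]
    linear_combination (2 * μ * ε ^ 2 * ((w x).re ^ 2 + (w x).im ^ 2)) * h1
  -- the only use of `cos θ ≤ 0`: the interaction of the images does not lower the jump
  have hε0 : 0 < ε := Real.exp_pos _
  have hge : 2 * μ * ‖w x‖ ^ 2 ≤ 2 * μ * ‖w x‖ ^ 2 * (1 - 2 * ε * Real.cos θ + ε ^ 2) :=
    le_mul_of_one_le_right (by positivity) (by nlinarith)
  linarith

/-- The previous bound holds for all `μ`, so the discriminant of the quadratic polynomial in `μ` is
nonpositive. -/
theorem norm_sq_sq_le_of_cos_nonpos (hL : 0 < L) (hw : IsPrimitive 0 L w w')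
    (hq : w L = Complex.exp (θ * Complex.I) * w 0) (hθ : Real.cos θ ≤ 0)
    (hm : MemLp w' 2 (volume.restrict (Ioc 0 L))) {x : ℝ} (hx : x ∈ Icc 0 L) :
    (‖w x‖ ^ 2) ^ 2 ≤
      (∫ y in (0 : ℝ)..L, ‖w y‖ ^ 2) * ∫ y in (0 : ℝ)..L, ‖w' y‖ ^ 2 := by
  have h0 : 0 ≤ ∫ y in (0 : ℝ)..L, ‖w y‖ ^ 2 :=
    intervalIntegral.integral_nonneg hL.le fun y _ => by positivity
  have h0' : 0 ≤ ∫ y in (0 : ℝ)..L, ‖w' y‖ ^ 2 :=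
    intervalIntegral.integral_nonneg hL.le fun y _ => by positivity
  have h : ∀ μ : ℝ, 0 ≤ (∫ y in (0 : ℝ)..L, ‖w y‖ ^ 2) * (μ * μ) + (-2 * ‖w x‖ ^ 2) * μ +
      ∫ y in (0 : ℝ)..L, ‖w' y‖ ^ 2 := fun μ => by
    rcases le_or_gt μ 0 with hμ | hμ
    · have h1 : 0 ≤ -2 * ‖w x‖ ^ 2 * μ := by nlinarith [sq_nonneg ‖w x‖]
      have h2 := mul_nonneg h0 (mul_self_nonneg μ)
      linarith
    · have := two_mul_norm_sq_le_energy hw hq hθ hm hx hμ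
      linarith
  have := discrim_le_zero h
  rw [discrim] at this
  linarith

/-- The interpolation inequality `|w(x)|² ≤ k(α) ‖w‖ ‖w'‖` for quasi-periodic functions. -/
theorem norm_sq_sq_le_K₁ {α : ℝ} (hα : ∀ m : ℤ, α ≠ m) (hL : 0 < L) (hw : IsPrimitive 0 L w w')
    (hq : w L = Complex.exp ((2 * Real.pi * α : ℝ) * Complex.I) * w 0)
    (hm : MemLp w' 2 (volume.restrict (Ioc 0 L))) {x : ℝ} (hx : x ∈ Icc 0 L) :
    (‖w x‖ ^ 2) ^ 2 ≤
      K₁ α * ((∫ y in (0 : ℝ)..L, ‖w y‖ ^ 2) * ∫ y in (0 : ℝ)..L, ‖w' y‖ ^ 2) := by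
  have hf0 : 0 < Int.fract α := by
    refine lt_of_le_of_ne (Int.fract_nonneg α) fun h => hα ⌊α⌋ ?_
    have := Int.fract_add_floor α
    linarith
  have hf1 := Int.fract_lt_one α
  have hα' : 2 * Real.pi * α = 2 * Real.pi * Int.fract α + ⌊α⌋ * (2 * Real.pi) := by
    have := Int.fract_add_floor α
    linear_combination -(2 * Real.pi) * this
  have hpi := Real.pi_pos
  rw [K₁, kConst]
  split_ifs with h
  -- the sine does not vanish, so that `k(α)` is not a division by zero
  · have hs : Real.sin (2 * Real.pi * α) ≠ 0 := by
      rw [hα', Real.sin_add_int_mul_two_pi]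
      rcases h with h | h
      · exact (Real.sin_pos_of_pos_of_lt_pi (by positivity) (by nlinarith)).ne'
      · have h1 := Real.sin_neg_of_neg_of_neg_pi_lt
          (x := 2 * Real.pi * Int.fract α - 2 * Real.pi) (by nlinarith) (by nlinarith)
        rw [Real.sin_sub_two_pi] at h1
        exact h1.ne
    rw [div_pow, one_pow, sq_abs, one_div, inv_mul_eq_div, le_div_iff₀ (by positivity), mul_comm]
    exact sin_sq_mul_norm_le hL hw hq hm hx
  · push Not at h
    rw [one_pow, one_mul]
    refine norm_sq_sq_le_of_cos_nonpos hL hw hq ?_ hm hx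
    rw [hα', Real.cos_add_int_mul_two_pi]
    exact Real.cos_nonpos_of_pi_div_two_le_of_le (by nlinarith) (by nlinarith)

end Interpolation

/-! ### Orthonormal systems and the bound by `K₁` -/

section OrthonormalSystems

variable {M N : ℕ} {L : ℝ}

theorem intervalIntegrable_inner {a b : ℝ} (hab : a ≤ b) {f g : ℝ → EuclideanSpace ℂ (Fin M)}
    (hf : MemLp f 2 (volume.restrict (Ioc a b))) (hg : MemLp g 2 (volume.restrict (Ioc a b))) :
    IntervalIntegrable (fun x => inner ℂ (f x) (g x)) volume a b := by
  refine (intervalIntegrable_iff_integrableOn_Ioc_of_le hab).2 ?_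
  refine Integrable.mono' (hf.norm.integrable_mul hg.norm)
    (hf.aestronglyMeasurable.inner hg.aestronglyMeasurable) ?_
  exact ae_of_all _ fun x => norm_inner_le_norm _ _

theorem norm_sq_sum_smul (c : Fin N → ℂ) (v : Fin N → EuclideanSpace ℂ (Fin M)) :
    ‖∑ n, c n • v n‖ ^ 2 = (∑ n, ∑ m, star (c n) * c m * inner ℂ (v n) (v m)).re := by
  rw [← inner_self_eq_norm_sq (𝕜 := ℂ), sum_inner]
  refine congrArg Complex.re (Finset.sum_congr rfl fun n _ => ?_)
  rw [inner_sum]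
  refine Finset.sum_congr rfl fun m _ => ?_
  rw [inner_smul_left, inner_smul_right, ← mul_assoc]
  rfl

theorem integral_norm_sq_sum_smul (hL : 0 ≤ L) {v : Fin N → ℝ → EuclideanSpace ℂ (Fin M)}
    (hv : ∀ n, MemLp (v n) 2 (volume.restrict (Ioc 0 L))) (c : Fin N → ℂ) :
    ∫ x in (0 : ℝ)..L, ‖∑ n, c n • v n x‖ ^ 2 =
      (∑ n, ∑ m, star (c n) * c m * ∫ x in (0 : ℝ)..L, inner ℂ (v n x) (v m x)).re := by
  have hi : ∀ n m, IntervalIntegrable (fun x => star (c n) * c m * inner ℂ (v n x) (v m x))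
      volume 0 L := fun n m => (intervalIntegrable_inner hL (hv n) (hv m)).const_mul _
  have hi2 : ∀ n, IntervalIntegrable
      (fun x => ∑ m, star (c n) * c m * inner ℂ (v n x) (v m x)) volume 0 L := fun n => by
    have e : (fun x => ∑ m, star (c n) * c m * inner ℂ (v n x) (v m x)) =
        ∑ m, fun x => star (c n) * c m * inner ℂ (v n x) (v m x) := by
      funext x; simp
    rw [e]
    exact IntervalIntegrable.sum _ fun m _ => hi n m
  have hi3 : IntervalIntegrable
      (fun x => ∑ n, ∑ m, star (c n) * c m * inner ℂ (v n x) (v m x)) volume 0 L := by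
    have e : (fun x => ∑ n, ∑ m, star (c n) * c m * inner ℂ (v n x) (v m x)) =
        ∑ n, fun x => ∑ m, star (c n) * c m * inner ℂ (v n x) (v m x) := by
      funext x; simp
    rw [e]
    exact IntervalIntegrable.sum _ fun n _ => hi2 n
  simp_rw [norm_sq_sum_smul, ← intervalIntegral.integral_const_mul]
  simp_rw [← intervalIntegral.integral_finsetSum fun m _ => hi _ m]
  rw [← intervalIntegral.integral_finsetSum fun n _ => hi2 n]
  exact (Complex.reCLM.intervalIntegral_comp_comm hi3)

theorem integral_norm_sq_sum_smul_of_orthonormal (hL : 0 ≤ L)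
    {v : Fin N → ℝ → EuclideanSpace ℂ (Fin M)}
    (hv : ∀ n, MemLp (v n) 2 (volume.restrict (Ioc 0 L)))
    (ho : ∀ n m, ∫ x in (0 : ℝ)..L, inner ℂ (v n x) (v m x) = if n = m then 1 else 0)
    (c : Fin N → ℂ) :
    ∫ x in (0 : ℝ)..L, ‖∑ n, c n • v n x‖ ^ 2 = ∑ n, ‖c n‖ ^ 2 := by
  rw [integral_norm_sq_sum_smul hL hv]
  simp only [ho, mul_ite, mul_one, mul_zero, Finset.sum_ite_eq, Finset.mem_univ, if_true]
  rw [Complex.re_sum]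
  refine Finset.sum_congr rfl fun n _ => ?_
  rw [Complex.star_def, ← Complex.normSq_eq_conj_mul_self, Complex.normSq_eq_norm_sq,
    Complex.ofReal_re]

theorem continuousOn_trace_densityMatrix_pow {w : Fin N → ℝ → EuclideanSpace ℂ (Fin M)}
    {s : Set ℝ} (hw : ∀ n, ContinuousOn (w n) s) (k : ℕ) :
    ContinuousOn (fun x => (Matrix.trace (densityMatrix w x ^ k)).re) s := by
  have h : ∀ n i, ContinuousOn (fun x => w n x i) s := fun n i =>
    (EuclideanSpace.proj (𝕜 := ℂ) i).continuous.comp_continuousOn (hw n)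
  have hU : ContinuousOn (fun x => densityMatrix w x) s := by
    refine continuousOn_pi.2 fun i => continuousOn_pi.2 fun j => ?_
    simp only [densityMatrix, Matrix.sum_apply, Matrix.of_apply]
    exact continuousOn_finsetSum _ fun n _ => (h n i).mul (h n j).star
  have hF : Continuous fun U : Matrix (Fin M) (Fin M) ℂ => (Matrix.trace (U ^ k)).re := by
    refine Complex.continuous_re.comp ?_
    exact Continuous.matrix_trace (continuous_pow k)
  exact hF.comp_continuousOn hU

theorem trace_densityMatrix_pow_three_nonneg (w : Fin N → ℝ → EuclideanSpace ℂ (Fin M)) (x : ℝ) :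
    0 ≤ (Matrix.trace (densityMatrix w x ^ 3)).re := by
  rw [trace_pow_re (isHermitian_densityMatrix w x)]
  exact Finset.sum_nonneg fun j _ => pow_nonneg (eigenvalues_densityMatrix_nonneg w x j) 3

/-- A component of a linear combination of an orthonormal system has norm at most that of the
coefficient vector. -/
theorem integral_norm_sq_inner_le (hL : 0 ≤ L) {v : Fin N → ℝ → EuclideanSpace ℂ (Fin M)}
    (hv : ∀ n, MemLp (v n) 2 (volume.restrict (Ioc 0 L))) (c : Fin N → ℂ)
    {e : EuclideanSpace ℂ (Fin M)} (he : ‖e‖ = 1) :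
    ∫ x in (0 : ℝ)..L, ‖inner ℂ e (∑ n, c n • v n x)‖ ^ 2 ≤
      ∫ x in (0 : ℝ)..L, ‖∑ n, c n • v n x‖ ^ 2 := by
  have hs : MemLp (fun x => ∑ n, c n • v n x) 2 (volume.restrict (Ioc 0 L)) :=
    memLp_finsetSum _ fun n _ => (hv n).const_smul (c n)
  refine intervalIntegral.integral_mono_on hL ?_ (MemLp.intervalIntegrable_norm_sq hL hs) ?_
  · exact MemLp.intervalIntegrable_norm_sq hL
      (f := fun x => inner ℂ e (∑ n, c n • v n x)) (hs.const_inner e)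
  · intro x _
    have := norm_inner_le_norm (𝕜 := ℂ) e (∑ n, c n • v n x)
    rw [he, one_mul] at this
    gcongr

theorem isPrimitive_inner_sum (e : EuclideanSpace ℂ (Fin M)) (c : Fin N → ℂ)
    {w w' : Fin N → ℝ → EuclideanSpace ℂ (Fin M)} (hw : ∀ n, IsPrimitive 0 L (w n) (w' n)) :
    IsPrimitive 0 L (fun x => inner ℂ e (∑ n, c n • w n x))
      (fun x => inner ℂ e (∑ n, c n • w' n x)) := by
  have h : ∀ n, IsPrimitive 0 L (fun x => c n • w n x) (fun x => c n • w' n x) := fun n =>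
    (hw n).clm_comp ((c n • ContinuousLinearMap.id ℂ (EuclideanSpace ℂ (Fin M))).restrictScalars ℝ)
  exact (IsPrimitive.sum Finset.univ fun n _ => h n).clm_comp
    ((innerSL ℂ e).restrictScalars ℝ)

/-- The Eden–Foias argument: at each point `x`, the interpolation inequality is applied to the
combination of the `wₙ` whose coefficients are their components at `x` along an eigenvector
of `U(x)`, and the results are added up over an eigenbasis. -/
theorem trace_densityMatrix_pow_three_le {α : ℝ} (hα : ∀ m : ℤ, α ≠ m) (hL : 0 < L)
    {w w' : Fin N → ℝ → EuclideanSpace ℂ (Fin M)} (hw : ∀ n, IsPrimitive 0 L (w n) (w' n))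
    (hq : ∀ n, w n L = Complex.exp ((2 * Real.pi * α : ℝ) * Complex.I) • w n 0)
    (hm : ∀ n, MemLp (w' n) 2 (volume.restrict (Ioc 0 L)))
    (ho : ∀ n m, ∫ x in (0 : ℝ)..L, inner ℂ (w n x) (w m x) = if n = m then 1 else 0)
    {x : ℝ} (hx : x ∈ Icc 0 L) :
    (Matrix.trace (densityMatrix w x ^ 3)).re ≤
      K₁ α * (∑ n, ∑ m, inner ℂ (w m x) (w n x) *
        ∫ y in (0 : ℝ)..L, inner ℂ (w' n y) (w' m y)).re := by
  set hU := isHermitian_densityMatrix w x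
  set e := hU.eigenvectorBasis
  have hK : 0 ≤ K₁ α := sq_nonneg _
  have hwL : ∀ n, MemLp (w n) 2 (volume.restrict (Ioc 0 L)) := fun n => (hw n).memLp hL.le 2
  have hj : ∀ j, hU.eigenvalues j ^ 3 ≤ K₁ α * (∑ n, ∑ m,
      inner ℂ (e j) (w n x) * star (inner ℂ (e j) (w m x)) *
        ∫ y in (0 : ℝ)..L, inner ℂ (w' n y) (w' m y)).re := by
    intro j
    -- the interpolated function is the `e j`-component of `∑ d n • w n`; its value at `x` is the
    -- eigenvalue, which is also the squared norm of `d` and hence bounds its `L²` norm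
    set d : Fin N → ℂ := fun n => star (inner ℂ (e j) (w n x)) with hd
    have hu : hU.eigenvalues j = ∑ n, ‖inner ℂ (e j) (w n x)‖ ^ 2 := eigenvalues_densityMatrix w x j
    have hu0 : 0 ≤ hU.eigenvalues j := eigenvalues_densityMatrix_nonneg w x j
    have hint := norm_sq_sq_le_K₁ hα hL (isPrimitive_inner_sum (e j) d hw) (by
      simp only [hq, smul_comm (d _), ← Finset.smul_sum, inner_smul_right])
      ((memLp_finsetSum _ fun n _ => (hm n).const_smul (d n)).const_inner (e j)) hx
    have hGx : inner ℂ (e j) (∑ n, d n • w n x) = ((hU.eigenvalues j : ℝ) : ℂ) := by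
      rw [hu, inner_sum, Complex.ofReal_sum]
      refine Finset.sum_congr rfl fun n _ => ?_
      rw [inner_smul_right, hd, Complex.star_def, ← Complex.normSq_eq_conj_mul_self,
        Complex.normSq_eq_norm_sq]
    have h1 := integral_norm_sq_inner_le hL.le hwL d (e.norm_eq_one j)
    rw [integral_norm_sq_sum_smul_of_orthonormal hL.le hwL ho] at h1
    have hdn : ∑ n, ‖d n‖ ^ 2 = hU.eigenvalues j := by
      rw [hu]
      exact Finset.sum_congr rfl fun n _ => by rw [hd, norm_star]
    have h2 := integral_norm_sq_inner_le hL.le hm d (e.norm_eq_one j)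
    rw [integral_norm_sq_sum_smul hL.le hm] at h2
    simp only [hd, star_star] at h2
    rw [hdn] at h1
    have h20 : 0 ≤ ∫ y in (0 : ℝ)..L, ‖inner ℂ (e j) (∑ n, d n • w' n y)‖ ^ 2 :=
      intervalIntegral.integral_nonneg hL.le fun y _ => by positivity
    rw [hGx, Complex.norm_real, Real.norm_eq_abs, sq_abs] at hint
    rcases hu0.eq_or_lt with h | h
    · rw [← h, zero_pow three_ne_zero]
      exact mul_nonneg hK (h20.trans h2)
    · have h3 : hU.eigenvalues j * hU.eigenvalues j ^ 3 ≤ hU.eigenvalues j *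
          (K₁ α * ∫ y in (0 : ℝ)..L, ‖inner ℂ (e j) (∑ n, d n • w' n y)‖ ^ 2) := by
        calc _ = (hU.eigenvalues j ^ 2) ^ 2 := by ring
          _ ≤ _ := hint
          _ ≤ K₁ α * (hU.eigenvalues j *
              ∫ y in (0 : ℝ)..L, ‖inner ℂ (e j) (∑ n, d n • w' n y)‖ ^ 2) := by gcongr
          _ = _ := by ring
      exact (le_of_mul_le_mul_left h3 h).trans (mul_le_mul_of_nonneg_left h2 hK)
  -- the sum over the eigenbasis is evaluated by Parseval's identity in `ℂ^M`
  rw [trace_pow_re hU]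
  refine (Finset.sum_le_sum fun j _ => hj j).trans_eq ?_
  rw [← Finset.mul_sum, ← Complex.re_sum, Finset.sum_comm]
  congr 2
  refine Finset.sum_congr rfl fun n _ => ?_
  rw [Finset.sum_comm]
  refine Finset.sum_congr rfl fun m _ => ?_
  rw [← Finset.sum_mul, ← e.sum_inner_mul_inner (w m x)]
  congr 1
  refine Finset.sum_congr rfl fun j _ => ?_
  rw [Complex.star_def, inner_conj_symm, mul_comm]

/-- Integrated over `x`, the pointwise bound involves the Gram matrix of the orthonormal system, which
is the identity, so that only the diagonal terms `‖wₙ'‖²` survive. -/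
theorem isAdmissible_K₁ {α : ℝ} (hα : ∀ m : ℤ, α ≠ m) : IsAdmissible α (K₁ α) := by
  refine isAdmissible_of_quasiperiodic (sq_nonneg _) ?_
  intro L hL M N w w' hw hq hm ho
  have hwL : ∀ n, MemLp (w n) 2 (volume.restrict (Ioc 0 L)) := fun n => (hw n).memLp hL.le 2
  have hi : ∀ n m, IntervalIntegrable (fun x => inner ℂ (w m x) (w n x) *
      ∫ y in (0 : ℝ)..L, inner ℂ (w' n y) (w' m y)) volume 0 L := fun n m =>
    (intervalIntegrable_inner hL.le (hwL m) (hwL n)).mul_const _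
  have hi2 : ∀ n, IntervalIntegrable (fun x => ∑ m, inner ℂ (w m x) (w n x) *
      ∫ y in (0 : ℝ)..L, inner ℂ (w' n y) (w' m y)) volume 0 L := fun n => by
    have h := IntervalIntegrable.sum Finset.univ fun m _ => hi n m
    rwa [Finset.sum_fn] at h
  have hi3 : IntervalIntegrable (fun x => ∑ n, ∑ m, inner ℂ (w m x) (w n x) *
      ∫ y in (0 : ℝ)..L, inner ℂ (w' n y) (w' m y)) volume 0 L := by
    have h := IntervalIntegrable.sum Finset.univ fun n _ => hi2 n
    rwa [Finset.sum_fn] at h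
  have hi4 : IntervalIntegrable (fun x => K₁ α * (∑ n, ∑ m, inner ℂ (w m x) (w n x) *
      ∫ y in (0 : ℝ)..L, inner ℂ (w' n y) (w' m y)).re) volume 0 L :=
    IntervalIntegrable.const_mul ⟨hi3.1.re, hi3.2.re⟩ _
  calc ∫ x in (0 : ℝ)..L, (Matrix.trace (densityMatrix w x ^ 3)).re
      ≤ ∫ x in (0 : ℝ)..L, K₁ α * (∑ n, ∑ m, inner ℂ (w m x) (w n x) *
          ∫ y in (0 : ℝ)..L, inner ℂ (w' n y) (w' m y)).re := by
        refine intervalIntegral.integral_mono_on hL.le ?_ hi4 fun x hx =>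
          trace_densityMatrix_pow_three_le hα hL hw hq hm ho hx
        refine ContinuousOn.intervalIntegrable ?_
        rw [uIcc_of_le hL.le]
        exact continuousOn_trace_densityMatrix_pow (fun n => (hw n).continuousOn hL.le) 3
    _ = K₁ α * ∑ n, ∫ x in (0 : ℝ)..L, ‖w' n x‖ ^ 2 := by
        rw [intervalIntegral.integral_const_mul]
        congr 1
        have h := Complex.reCLM.intervalIntegral_comp_comm hi3
        simp only [Complex.reCLM_apply] at h
        rw [h, intervalIntegral.integral_finsetSum fun n _ => hi2 n, Complex.re_sum]
        refine Finset.sum_congr rfl fun n _ => ?_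
        rw [intervalIntegral.integral_finsetSum fun m _ => hi n m]
        simp only [intervalIntegral.integral_mul_const, ho, ite_mul, one_mul, zero_mul,
          Finset.sum_ite_eq', Finset.mem_univ, if_true]
        have h2 := Complex.reCLM.intervalIntegral_comp_comm
          (intervalIntegrable_inner hL.le (hm n) (hm n))
        simp only [Complex.reCLM_apply] at h2
        rw [← h2]
        exact intervalIntegral.integral_congr fun x _ => inner_self_eq_norm_sq (𝕜 := ℂ) _

end OrthonormalSystems

/-! ### Fourier series of quasi-periodic functions -/

section Fourier

/-- The frequencies `ν_k = 2π(k + α)/L` of quasi-periodic functions on `[0,L]`. -/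
noncomputable def freq (L α : ℝ) (k : ℤ) : ℝ := 2 * Real.pi * (k + α) / L

/-- The quasi-periodic plane wave `exp(i ν_k x)`. -/
noncomputable def mode (L α : ℝ) (k : ℤ) (x : ℝ) : ℂ :=
  Complex.exp (((freq L α k * x : ℝ) : ℂ) * Complex.I)

/-- The coefficient of `f` with respect to `mode L α k`; the modes have norm `√L` in `L²(0,L)`. -/
noncomputable def modeCoeff (L α : ℝ) (f : ℝ → ℂ) (k : ℤ) : ℂ :=
  1 / L * ∫ x in (0 : ℝ)..L, f x * star (mode L α k x)

/-- The sum of the quasi-periodic Fourier series with coefficients `c`. -/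
noncomputable def modeSum (L α : ℝ) (c : ℤ → ℂ) (x : ℝ) : ℂ := ∑' k, c k * mode L α k x

variable {L α : ℝ}

theorem norm_mode (k : ℤ) (x : ℝ) : ‖mode L α k x‖ = 1 := Complex.norm_exp_ofReal_mul_I _

theorem star_mode (k : ℤ) (x : ℝ) :
    star (mode L α k x) = Complex.exp (-((freq L α k * x : ℝ) : ℂ) * Complex.I) := by
  rw [mode, Complex.star_def, ← Complex.exp_conj]
  simp

theorem mode_mul_star (k : ℤ) (x : ℝ) : mode L α k x * star (mode L α k x) = 1 := by
  rw [Complex.star_def, Complex.mul_conj, Complex.normSq_eq_norm_sq, norm_mode]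
  simp

theorem continuous_mode (k : ℤ) : Continuous (mode L α k) := by
  unfold mode
  fun_prop

theorem star_mode_eq_fourier (k : ℤ) (x : ℝ) : star (mode L α k x) =
    fourier (T := L) (-k) (x : AddCircle L) * star (mode L α 0 x) := by
  rw [star_mode, star_mode, fourier_coe_apply, ← Complex.exp_add, freq, freq]
  congr 1
  push_cast
  ring

/-- Removing the phase `mode L α 0` turns the quasi-periodic coefficients into Mathlib's Fourier
coefficients. The interval is written with an endpoint `b = L`, to cover the expression `0 + L`
coming from functions lifted to the circle. -/
theorem fourierCoeffOn_eq_modeCoeff {b : ℝ} (hb : b = L) (hab : 0 < b) (f : ℝ → ℂ) (k : ℤ) :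
    fourierCoeffOn hab (fun x => star (mode L α 0 x) * f x) k = modeCoeff L α f k := by
  subst hb
  rw [fourierCoeffOn_eq_integral, modeCoeff]
  have hT : b - 0 = b := sub_zero b
  rw [Complex.real_smul]
  push_cast
  rw [sub_zero]
  congr 1
  refine intervalIntegral.integral_congr fun x _ => ?_
  have h := star_mode_eq_fourier (L := b) (α := α) k x
  simp only [smul_eq_mul]
  rw [h, fourier_coe_apply, fourier_coe_apply, hT]
  ring

theorem memLp_mode_mul {f : ℝ → ℂ} {μ : Measure ℝ} (hf : MemLp f 2 μ) (k : ℤ) :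
    MemLp (fun x => star (mode L α k x) * f x) 2 μ := by
  refine hf.of_le ?_ (ae_of_all _ fun x => ?_)
  · exact (continuous_mode k).star.aestronglyMeasurable.mul hf.aestronglyMeasurable
  · rw [norm_mul, norm_star, norm_mode, one_mul]

/-- Parseval's identity. -/
theorem hasSum_norm_sq_modeCoeff (hL : 0 < L) {f : ℝ → ℂ}
    (hf : MemLp f 2 (volume.restrict (Ioc 0 L))) :
    HasSum (fun k => ‖modeCoeff L α f k‖ ^ 2) (1 / L * ∫ x in (0 : ℝ)..L, ‖f x‖ ^ 2) := by
  have h := hasSum_sq_fourierCoeffOn hL (memLp_mode_mul (L := L) (α := α) hf 0)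
  simp only [fourierCoeffOn_eq_modeCoeff rfl, norm_mul, norm_star, norm_mode, one_mul, sub_zero,
    smul_eq_mul] at h
  rwa [one_div]

/-- The coefficients of a derivative: the boundary terms vanish by quasi-periodicity. -/
theorem modeCoeff_deriv (hL : 0 < L) {f f' : ℝ → ℂ} (hf : IsPrimitive 0 L f f')
    (hq : f L = Complex.exp ((2 * Real.pi * α : ℝ) * Complex.I) * f 0) (k : ℤ) :
    modeCoeff L α f' k = freq L α k * Complex.I * modeCoeff L α f k := by
  have hd : ∀ x, HasDerivAt (fun x => star (mode L α k x))
      (-(freq L α k * Complex.I) * star (mode L α k x)) x := fun x => by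
    simp only [star_mode]
    have h := ((((hasDerivAt_id x).const_mul (freq L α k)).ofReal_comp).neg.mul_const
      Complex.I).cexp
    refine h.congr_deriv ?_
    simp
    ring
  have hc : Continuous fun x => -(freq L α k * Complex.I) * star (mode L α k x) :=
    continuous_const.mul (continuous_mode k).star
  have h1 := hf.mul hL.le (.of_hasDerivAt hd hc)
  have h2 := h1.integral_eq_sub hL.le
  have hb : f L * star (mode L α k L) - f 0 * star (mode L α k 0) = 0 := by
    have hm : star (mode L α k L) = star (Complex.exp ((2 * Real.pi * α : ℝ) * Complex.I)) := by
      rw [mode]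
      congr 1
      rw [show freq L α k * L = 2 * Real.pi * α + k * (2 * Real.pi) by
        rw [freq]; field_simp; ring]
      push_cast
      rw [show (2 * (Real.pi : ℂ) * α + k * (2 * Real.pi)) * Complex.I =
        2 * Real.pi * α * Complex.I + k * (2 * Real.pi * Complex.I) by ring, Complex.exp_add,
        Complex.exp_int_mul_two_pi_mul_I, mul_one]
    have h0 : star (mode L α k 0) = 1 := by simp [mode]
    have hcc : Complex.exp ((2 * Real.pi * α : ℝ) * Complex.I) *
        star (Complex.exp ((2 * Real.pi * α : ℝ) * Complex.I)) = 1 := by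
      rw [Complex.star_def, Complex.mul_conj, Complex.normSq_eq_norm_sq,
        Complex.norm_exp_ofReal_mul_I]
      simp
    rw [hm, h0, hq]
    linear_combination f 0 * hcc
  have hcf : ContinuousOn f (uIcc 0 L) := by rw [uIcc_of_le hL.le]; exact hf.continuousOn hL.le
  have i1 : IntervalIntegrable (fun x => f x * (-(freq L α k * Complex.I) * star (mode L α k x)))
      volume 0 L := (hcf.mul hc.continuousOn).intervalIntegrable
  have i2 : IntervalIntegrable (fun x => f' x * star (mode L α k x)) volume 0 L :=
    hf.integrable.mul_continuousOn (continuous_mode k).star.continuousOn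
  rw [hb, intervalIntegral.integral_add i1 i2] at h2
  have h3 : ∫ x in (0 : ℝ)..L, f x * (-(freq L α k * Complex.I) * star (mode L α k x)) =
      -(freq L α k * Complex.I) * ∫ x in (0 : ℝ)..L, f x * star (mode L α k x) := by
    rw [← intervalIntegral.integral_const_mul]
    exact intervalIntegral.integral_congr fun x _ => by ring
  rw [h3] at h2
  rw [modeCoeff, modeCoeff]
  linear_combination (1 / L : ℂ) * h2

theorem abs_add_pos (hα : ∀ m : ℤ, α ≠ m) (k : ℤ) : 0 < |(k : ℝ) + α| := by
  rw [abs_pos]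
  intro h
  refine hα (-k) ?_
  push_cast
  linarith

theorem freq_ne_zero (hα : ∀ m : ℤ, α ≠ m) (hL : 0 < L) (k : ℤ) : freq L α k ≠ 0 := by
  have := abs_pos.1 (abs_add_pos hα k)
  have := Real.pi_pos
  unfold freq
  positivity

/-- By the arithmetic-geometric mean inequality, `‖c_k‖ ≤ ν_k² ‖c_k‖² + ν_k⁻²`. -/
theorem summable_modeCoeff (hα : ∀ m : ℤ, α ≠ m) (hL : 0 < L) {f f' : ℝ → ℂ}
    (hf : IsPrimitive 0 L f f')
    (hq : f L = Complex.exp ((2 * Real.pi * α : ℝ) * Complex.I) * f 0)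
    (hm : MemLp f' 2 (volume.restrict (Ioc 0 L))) :
    Summable fun k => ‖modeCoeff L α f k‖ := by
  have h1 := (hasSum_norm_sq_modeCoeff (α := α) hL hm).summable
  have h2 : Summable fun k : ℤ => 1 / freq L α k ^ 2 := by
    have h := ((Real.summable_one_div_int_add_rpow α 2).2 (by norm_num)).mul_left
      ((L / (2 * Real.pi)) ^ 2)
    refine h.congr fun k => ?_
    rw [freq, Real.rpow_ofNat, sq_abs]
    field_simp
  refine Summable.of_nonneg_of_le (fun k => norm_nonneg _) (fun k => ?_) (h1.add h2)
  have hk := freq_ne_zero hα hL k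
  rw [modeCoeff_deriv hL hf hq, norm_mul, norm_mul, Complex.norm_real, Complex.norm_I, mul_one,
    Real.norm_eq_abs, mul_pow, sq_abs]
  have h3 : 0 ≤ (|freq L α k| * ‖modeCoeff L α f k‖ - 1 / |freq L α k|) ^ 2 := sq_nonneg _
  have h4 : 0 < |freq L α k| := abs_pos.2 hk
  have h5 : |freq L α k| * ‖modeCoeff L α f k‖ * (1 / |freq L α k|) = ‖modeCoeff L α f k‖ := by
    field_simp
  have h6 : (1 / |freq L α k|) ^ 2 = 1 / freq L α k ^ 2 := by rw [div_pow, sq_abs, one_pow]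
  have h7 : 0 ≤ ‖modeCoeff L α f k‖ := norm_nonneg _
  rw [sub_sq, mul_assoc 2, h5, h6, mul_pow, sq_abs] at h3
  linarith

/-- Pointwise convergence of the Fourier series. -/
theorem hasSum_modeCoeff (hL : 0 < L) {f : ℝ → ℂ} (hc : ContinuousOn f (Icc 0 L))
    (hq : f L = Complex.exp ((2 * Real.pi * α : ℝ) * Complex.I) * f 0)
    (hs : Summable fun k => ‖modeCoeff L α f k‖) {x : ℝ} (hx : x ∈ Ico 0 L) :
    HasSum (fun k => modeCoeff L α f k * mode L α k x) (f x) := by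
  have : Fact (0 < L) := ⟨hL⟩
  set g : ℝ → ℂ := fun x => star (mode L α 0 x) * f x with hg
  have hcg : ContinuousOn g (Icc 0 (0 + L)) := by
    rw [zero_add]
    exact (continuous_mode 0).star.continuousOn.mul hc
  have hper : g 0 = g (0 + L) := by
    simp only [hg, zero_add, hq]
    rw [star_mode, star_mode, ← mul_assoc, ← Complex.exp_add]
    have : freq L α 0 * L = 2 * Real.pi * α := by
      rw [freq]; field_simp; simp
    rw [this]
    simp
  set F : C(AddCircle L, ℂ) := ⟨AddCircle.liftIco L 0 g, AddCircle.liftIco_continuous hper hcg⟩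
  have hF : ∀ k, fourierCoeff F k = modeCoeff L α f k := fun k =>
    (fourierCoeff_liftIco_eq g k).trans (fourierCoeffOn_eq_modeCoeff (zero_add L) _ f k)
  have hsF : Summable (fourierCoeff F) := by
    refine Summable.of_norm (hs.congr fun k => ?_)
    rw [hF]
  have h := has_pointwise_sum_fourier_series_of_summable hsF (x : AddCircle L)
  have hx' : x ∈ Ico 0 (0 + L) := by rwa [zero_add]
  have hFx : F (x : AddCircle L) = g x := by
    change AddCircle.liftIco L 0 g (x : AddCircle L) = g x
    exact AddCircle.liftIco_coe_apply hx'
  rw [hFx] at h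
  have h2 := h.mul_left (mode L α 0 x)
  have e : mode L α 0 x * g x = f x := by
    rw [hg]
    simp only
    rw [← mul_assoc, mode_mul_star, one_mul]
  rw [e] at h2
  refine h2.congr_fun fun k => ?_
  have h3 : mode L α k x = fourier (T := L) k (x : AddCircle L) * mode L α 0 x := by
    have := congrArg star (star_mode_eq_fourier (L := L) (α := α) k x)
    rw [star_star, star_mul', star_star, fourier_neg] at this
    simpa using this
  rw [hF, h3, smul_eq_mul]
  ring

theorem summable_mul_mode {c : ℤ → ℂ} (hc : Summable fun k => ‖c k‖) (x : ℝ) :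
    Summable fun k => c k * mode L α k x :=
  Summable.of_norm (by simpa [norm_mode] using hc)

theorem continuous_modeSum {c : ℤ → ℂ} (hc : Summable fun k => ‖c k‖) :
    Continuous (modeSum L α c) :=
  continuous_tsum (fun k => continuous_const.mul (continuous_mode k)) hc fun k x => by
    rw [norm_mul, norm_mode, mul_one]

theorem integral_mode_mul_star (hL : 0 < L) (j k : ℤ) :
    ∫ x in (0 : ℝ)..L, mode L α j x * star (mode L α k x) = if j = k then (L : ℂ) else 0 := by
  split_ifs with h
  · subst h
    simp only [mode_mul_star, intervalIntegral.integral_const, sub_zero]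
    simp
  · have hne : ((freq L α j - freq L α k : ℝ) : ℂ) * Complex.I ≠ 0 := by
      refine mul_ne_zero ?_ Complex.I_ne_zero
      norm_cast
      intro h0
      rw [freq, freq, ← sub_div, div_eq_zero_iff] at h0
      rcases h0 with h0 | h0
      · have h1 : 2 * Real.pi * ((j : ℝ) - k) = 0 := by linarith
        have h2 : (j : ℝ) - k = 0 := by
          rcases mul_eq_zero.1 h1 with h3 | h3
          · exact absurd h3 (by positivity)
          · exact h3
        exact h (by exact_mod_cast sub_eq_zero.1 h2)
      · exact hL.ne' h0
    have e : ∀ x : ℝ, mode L α j x * star (mode L α k x) =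
        Complex.exp (((freq L α j - freq L α k : ℝ) : ℂ) * Complex.I * x) := fun x => by
      rw [star_mode, mode, ← Complex.exp_add]
      congr 1
      push_cast
      ring
    simp_rw [e]
    rw [integral_exp_mul_complex hne, div_eq_zero_iff]
    left
    rw [Complex.ofReal_zero, mul_zero, Complex.exp_zero, sub_eq_zero]
    rw [show ((freq L α j - freq L α k : ℝ) : ℂ) * Complex.I * L =
      ((j - k : ℤ) : ℂ) * (2 * Real.pi * Complex.I) by
        rw [freq, freq]
        have : (L : ℂ) ≠ 0 := by exact_mod_cast hL.ne'
        push_cast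
        field_simp
        ring]
    exact Complex.exp_int_mul_two_pi_mul_I _

theorem modeCoeff_modeSum (hL : 0 < L) {c : ℤ → ℂ} (hc : Summable fun k => ‖c k‖) (k : ℤ) :
    modeCoeff L α (modeSum L α c) k = c k := by
  have hcont : ∀ j, Continuous fun x => c j * mode L α j x * star (mode L α k x) := fun j =>
    (continuous_const.mul (continuous_mode j)).mul (continuous_mode k).star
  have h := hasSum_integral_of_summable_integral_norm (μ := volume.restrict (Ioc 0 L))
    (F := fun j x => c j * mode L α j x * star (mode L α k x))
    (fun j => ((intervalIntegrable_iff_integrableOn_Ioc_of_le hL.le).1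
      ((hcont j).intervalIntegrable 0 L))) (by
      simp only [norm_mul, norm_star, norm_mode, mul_one, integral_const]
      exact hc.mul_left _)
  simp only [tsum_mul_right] at h
  have e1 : ∀ j, ∫ x in Ioc 0 L, c j * mode L α j x * star (mode L α k x) =
      if j = k then c k * L else 0 := fun j => by
    rw [← intervalIntegral.integral_of_le hL.le]
    simp_rw [mul_assoc]
    rw [intervalIntegral.integral_const_mul, integral_mode_mul_star hL]
    split_ifs with hjk
    · rw [hjk]
    · simp
  simp only [e1] at h
  have h2 := h.unique (hasSum_ite_eq k (c k * (L : ℂ)))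
  rw [modeCoeff, intervalIntegral.integral_of_le hL.le]
  have hLC : (L : ℂ) ≠ 0 := by exact_mod_cast hL.ne'
  unfold modeSum
  rw [h2]
  field_simp

theorem hasSum_norm_sq_modeSum (hL : 0 < L) {c : ℤ → ℂ} (hc : Summable fun k => ‖c k‖) :
    HasSum (fun k => ‖c k‖ ^ 2) (1 / L * ∫ x in (0 : ℝ)..L, ‖modeSum L α c x‖ ^ 2) := by
  have hcont := continuous_modeSum (L := L) (α := α) hc
  have hm : MemLp (modeSum L α c) 2 (volume.restrict (Ioc 0 L)) := by
    obtain ⟨C, hC⟩ := isCompact_Icc.exists_bound_of_continuousOn (hcont.continuousOn (s := Icc 0 L))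
    exact MemLp.of_bound hcont.aestronglyMeasurable C ((ae_restrict_iff' measurableSet_Ioc).2
      (ae_of_all _ fun x hx => hC x (Ioc_subset_Icc_self hx)))
  simpa only [modeCoeff_modeSum hL hc] using hasSum_norm_sq_modeCoeff (α := α) hL hm

theorem modeCoeff_sum {N : ℕ} (c : Fin N → ℂ) {f : Fin N → ℝ → ℂ}
    (hf : ∀ n, IntervalIntegrable (f n) volume 0 L) (k : ℤ) :
    modeCoeff L α (fun x => ∑ n, c n * f n x) k = ∑ n, c n * modeCoeff L α (f n) k := by
  unfold modeCoeff
  simp only [Finset.sum_mul]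
  rw [intervalIntegral.integral_finsetSum, Finset.mul_sum]
  · refine Finset.sum_congr rfl fun n _ => ?_
    simp_rw [mul_assoc]
    rw [intervalIntegral.integral_const_mul]
    ring
  · intro n _
    exact ((hf n).const_mul (c n)).mul_continuousOn (continuous_mode k).star.continuousOn

end Fourier

/-! ### The momentum cut-off and the constants entering `K₂` -/

section CutOff

open Filter Topology

/-- The multiplier `m_s(t) = s³ / (s³ + t³)` applied to the momentum `s` at the cut-off scale `t > 0`;
the absolute value makes it continuous in `t ∈ ℝ`. -/
noncomputable def lowPass (s t : ℝ) : ℝ := s ^ 3 / (s ^ 3 + |t| ^ 3)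

theorem lowPass_nonneg {s : ℝ} (hs : 0 < s) (t : ℝ) : 0 ≤ lowPass s t := by
  unfold lowPass; positivity

theorem lowPass_le_one {s : ℝ} (hs : 0 < s) (t : ℝ) : lowPass s t ≤ 1 := by
  unfold lowPass
  rw [div_le_one (by positivity)]
  have : 0 ≤ |t| ^ 3 := by positivity
  linarith

theorem continuous_lowPass {s : ℝ} (hs : 0 < s) : Continuous (lowPass s) := by
  unfold lowPass
  refine continuous_const.div (by fun_prop) fun t => ?_
  positivity

theorem one_sub_lowPass {s t : ℝ} (hs : 0 < s) (ht : 0 < t) :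
    1 - lowPass s t = t ^ 3 / (s ^ 3 + t ^ 3) := by
  rw [lowPass, abs_of_pos ht]
  field_simp
  ring

/-- A primitive of `r ↦ 2 r / (1 + r³)²` on `[0,∞)`. -/
noncomputable def lowPassPrimitive (r : ℝ) : ℝ :=
  2 / 3 * (r ^ 2 / (1 + r ^ 3) - 1 / 3 * Real.log (1 + r) + 1 / 6 * Real.log (r ^ 2 - r + 1) +
    1 / √3 * Real.arctan ((2 * r - 1) / √3))

theorem hasDerivAt_lowPassPrimitive {r : ℝ} (hr : 0 ≤ r) :
    HasDerivAt lowPassPrimitive (2 * r / (1 + r ^ 3) ^ 2) r := by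
  have h3 : 0 < √3 := by positivity
  have h33 : √3 ^ 2 = (3 : ℝ) := Real.sq_sqrt (by norm_num)
  have p1 : 0 < 1 + r := by positivity
  have p2 : 0 < r ^ 2 - r + 1 := by nlinarith [sq_nonneg (r - 1 / 2)]
  have p3 : 1 + r ^ 3 = (1 + r) * (r ^ 2 - r + 1) := by ring
  have p4 : 0 < 1 + r ^ 3 := by positivity
  have d1 : HasDerivAt (fun r : ℝ => r ^ 2 / (1 + r ^ 3))
      ((2 * r * (1 + r ^ 3) - r ^ 2 * (3 * r ^ 2)) / (1 + r ^ 3) ^ 2) r := by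
    have h := (hasDerivAt_pow 2 r).fun_div ((hasDerivAt_pow 3 r).const_add 1) p4.ne'
    simpa using h
  have d2 : HasDerivAt (fun r : ℝ => Real.log (1 + r)) (1 / (1 + r)) r :=
    ((hasDerivAt_id r).const_add 1).log p1.ne'
  have d3 : HasDerivAt (fun r : ℝ => Real.log (r ^ 2 - r + 1))
      ((2 * r - 1) / (r ^ 2 - r + 1)) r := by
    have h := (((hasDerivAt_pow 2 r).sub (hasDerivAt_id r)).add_const 1).log p2.ne'
    simpa using h
  have d4 : HasDerivAt (fun r : ℝ => Real.arctan ((2 * r - 1) / √3))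
      (1 / (1 + ((2 * r - 1) / √3) ^ 2) * (2 / √3)) r := by
    have h := ((((hasDerivAt_id r).const_mul 2).sub_const 1).div_const (√3)).arctan
    simpa using h
  have h := (((d1.sub (d2.const_mul (1 / 3))).add (d3.const_mul (1 / 6))).add
    (d4.const_mul (1 / √3))).const_mul (2 / 3)
  refine h.congr_deriv ?_
  have e4 : 1 / √3 * (1 / (1 + ((2 * r - 1) / √3) ^ 2) * (2 / √3)) =
      1 / (2 * (r ^ 2 - r + 1)) := by
    rw [div_pow, h33]
    have : 1 + (2 * r - 1) ^ 2 / 3 = 4 / 3 * (r ^ 2 - r + 1) := by ring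
    rw [this]
    field_simp
    rw [h33]
    norm_num
  have e5 : -(1 / 3 * (1 / (1 + r))) + 1 / 6 * ((2 * r - 1) / (r ^ 2 - r + 1)) +
      1 / (2 * (r ^ 2 - r + 1)) = r / (1 + r ^ 3) := by
    rw [p3]
    generalize hq : r ^ 2 - r + 1 = q at p2 ⊢
    field_simp
    rw [← hq]
    ring
  have e6 : (2 * r * (1 + r ^ 3) - r ^ 2 * (3 * r ^ 2)) / (1 + r ^ 3) ^ 2 =
      3 * r / (1 + r ^ 3) ^ 2 - r / (1 + r ^ 3) := by
    field_simp
    ring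
  rw [e4, e6]
  linear_combination (2 / 3) * e5

/-- The two logarithms combine to one of a quotient tending to `1`, and only the arctangent
contributes to the limit. -/
theorem tendsto_lowPassPrimitive :
    Tendsto lowPassPrimitive atTop (𝓝 (2 / 3 * (1 / √3 * (Real.pi / 2)))) := by
  have h3 : 0 < √3 := by positivity
  have t1 : Tendsto (fun r : ℝ => r ^ 2 / (1 + r ^ 3)) atTop (𝓝 0) := by
    refine squeeze_zero' (g := fun r : ℝ => r⁻¹) ?_ ?_ tendsto_inv_atTop_zero
    · filter_upwards [eventually_gt_atTop 0] with r hr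
      positivity
    · filter_upwards [eventually_gt_atTop 0] with r hr
      rw [div_le_iff₀ (by positivity), inv_mul_eq_div, le_div_iff₀ hr]
      nlinarith
  have t2 : Tendsto (fun r : ℝ => 3 * r / (1 + r) ^ 2) atTop (𝓝 0) := by
    refine squeeze_zero' (g := fun r : ℝ => 3 * r⁻¹) ?_ ?_
      (by simpa using tendsto_inv_atTop_zero.const_mul (3 : ℝ))
    · filter_upwards [eventually_gt_atTop 0] with r hr
      positivity
    · filter_upwards [eventually_gt_atTop 0] with r hr
      rw [div_le_iff₀ (by positivity), ← div_eq_mul_inv, div_mul_eq_mul_div, le_div_iff₀ hr]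
      nlinarith
  have t3 : Tendsto (fun r : ℝ => Real.log (1 - 3 * r / (1 + r) ^ 2)) atTop (𝓝 0) := by
    have := (Real.continuousAt_log one_ne_zero).tendsto.comp
      (show Tendsto (fun r : ℝ => 1 - 3 * r / (1 + r) ^ 2) atTop (𝓝 1) by
        simpa using t2.const_sub 1)
    simpa [Function.comp_def] using this
  have t4 : Tendsto (fun r : ℝ => Real.arctan ((2 * r - 1) / √3)) atTop (𝓝 (Real.pi / 2)) := by
    refine (tendsto_nhds_of_tendsto_nhdsWithin Real.tendsto_arctan_atTop).comp ?_
    refine Tendsto.atTop_div_const h3 ?_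
    exact tendsto_atTop_add_const_right _ _ (tendsto_id.const_mul_atTop two_pos)
  have t := ((t1.add (t3.const_mul (1 / 6))).add (t4.const_mul (1 / √3))).const_mul (2 / 3)
  rw [mul_zero, zero_add, zero_add] at t
  refine t.congr' ?_
  filter_upwards [eventually_gt_atTop 0] with r hr
  have p2 : 0 < r ^ 2 - r + 1 := by nlinarith [sq_nonneg (r - 1 / 2)]
  have e : 1 - 3 * r / (1 + r) ^ 2 = (r ^ 2 - r + 1) / (1 + r) ^ 2 := by
    field_simp
    ring
  rw [e, Real.log_div p2.ne' (by positivity), Real.log_pow, lowPassPrimitive]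
  push_cast
  ring

/-- The normalisation `∫₀^∞ 2 t m_s(t)² dt = 4π/(9√3) s²` of the cut-off, which recovers the kinetic
energy from the cut-off functions. -/
theorem lintegral_lowPass {s : ℝ} (hs : 0 < s) :
    ∫⁻ t in Ioi (0 : ℝ), ENNReal.ofReal (2 * t * lowPass s t ^ 2) =
      ENNReal.ofReal (4 * Real.pi / (9 * √3) * s ^ 2) := by
  have h3 : 0 < √3 := by positivity
  have hd : ∀ t ∈ Ici (0 : ℝ), HasDerivAt (fun t => s ^ 2 * lowPassPrimitive (t / s))
      (2 * t * (s ^ 3 / (s ^ 3 + t ^ 3)) ^ 2) t := fun t ht => by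
    have ht0 : (0 : ℝ) ≤ t := ht
    have h := ((hasDerivAt_lowPassPrimitive (r := t / s) (by positivity)).comp t
      ((hasDerivAt_id t).div_const s)).const_mul (s ^ 2)
    refine h.congr_deriv ?_
    have : 0 < s ^ 3 + t ^ 3 := by positivity
    have e : 1 + (t / s) ^ 3 = (s ^ 3 + t ^ 3) / s ^ 3 := by field_simp
    rw [e]
    field_simp
  have hpos : ∀ t ∈ Ioi (0 : ℝ), 0 ≤ 2 * t * (s ^ 3 / (s ^ 3 + t ^ 3)) ^ 2 := fun t ht => by
    have ht0 : (0 : ℝ) < t := ht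
    positivity
  have hlim : Tendsto (fun t => s ^ 2 * lowPassPrimitive (t / s)) atTop
      (𝓝 (s ^ 2 * (2 / 3 * (1 / √3 * (Real.pi / 2))))) :=
    (tendsto_lowPassPrimitive.comp (tendsto_id.atTop_div_const hs)).const_mul _
  have hint := integrableOn_Ioi_deriv_of_nonneg' hd hpos hlim
  have hval := integral_Ioi_of_hasDerivAt_of_nonneg' hd hpos hlim
  have hcongr : ∫⁻ t in Ioi (0 : ℝ), ENNReal.ofReal (2 * t * lowPass s t ^ 2) =
      ∫⁻ t in Ioi (0 : ℝ), ENNReal.ofReal (2 * t * (s ^ 3 / (s ^ 3 + t ^ 3)) ^ 2) :=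
    setLIntegral_congr_fun measurableSet_Ioi fun t ht => by
      simp only [lowPass, abs_of_pos (show (0 : ℝ) < t from ht)]
  rw [hcongr, ← ofReal_integral_eq_lintegral_ofReal hint
    ((ae_restrict_iff' measurableSet_Ioi).2 (ae_of_all _ hpos)), hval]
  congr 1
  have h0 : lowPassPrimitive (0 / s) = 2 / 3 * (1 / √3 * (-(Real.pi / 6))) := by
    have ha : Real.arctan ((2 * 0 - 1) / √3) = -(Real.pi / 6) := by
      rw [show (2 * 0 - 1) / √3 = -(1 / √3) by ring, Real.arctan_neg, one_div,
        Real.arctan_inv_sqrt_three]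
    rw [zero_div, lowPassPrimitive, ha]
    simp
  rw [h0]
  field_simp
  ring

/-- The substitution recovering `u³` from the density left after the cut-off: integrating over
`t ≤ u/κ`, where the positive part is active, gives equality, and `15` enters `K₂` here. -/
theorem ofReal_le_lintegral_sq_sub {u κ : ℝ} (hu : 0 ≤ u) (hκ : 0 < κ) :
    ENNReal.ofReal (u ^ 3 / (15 * κ ^ 2)) ≤
      ∫⁻ t in Ioi (0 : ℝ), ENNReal.ofReal (2 * t * max (√u - √(t * κ)) 0 ^ 2) := by
  set T := u / κ with hT
  have hT0 : 0 ≤ T := by positivity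
  have hcont : Continuous fun t : ℝ => 2 * t * (u - 2 * (√u * √κ) * √t + κ * t) := by fun_prop
  have hF : ∀ t ∈ Ioo 0 T, HasDerivAt
      (fun t : ℝ => u * t ^ 2 - 8 / 5 * (√u * √κ) * (t ^ 2 * √t) + 2 / 3 * κ * t ^ 3)
      (2 * t * (u - 2 * (√u * √κ) * √t + κ * t)) t := fun t ht => by
    have ht0 : 0 < t := ht.1
    have h := (((hasDerivAt_pow 2 t).const_mul u).sub
      (((hasDerivAt_pow 2 t).mul (Real.hasDerivAt_sqrt ht0.ne')).const_mul
        (8 / 5 * (√u * √κ)))).add ((hasDerivAt_pow 3 t).const_mul (2 / 3 * κ))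
    refine h.congr_deriv ?_
    have hs : t = √t * √t := (Real.mul_self_sqrt ht0.le).symm
    have hs0 : 0 < √t := Real.sqrt_pos.2 ht0
    have e : t ^ 2 * (1 / (2 * √t)) = t * √t / 2 := by
      nth_rewrite 1 [sq, hs]
      field_simp
    rw [e]
    simp
    ring
  have hval := intervalIntegral.integral_eq_sub_of_hasDerivAt_of_le hT0
    (Continuous.continuousOn (by fun_prop)) hF (hcont.intervalIntegrable 0 T)
  have hsq : √T * √κ = √u := by
    rw [← Real.sqrt_mul hT0, hT, div_mul_cancel₀ _ hκ.ne']
  have hval2 : ∫ t in (0 : ℝ)..T, 2 * t * (u - 2 * (√u * √κ) * √t + κ * t) =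
      u ^ 3 / (15 * κ ^ 2) := by
    rw [hval]
    have e : √u * √κ * (T ^ 2 * √T) = u * T ^ 2 := by
      calc _ = √u * (√T * √κ) * T ^ 2 := by ring
        _ = _ := by rw [hsq, Real.mul_self_sqrt hu]
    have e2 : 8 / 5 * (√u * √κ) * (T ^ 2 * √T) = 8 / 5 * (u * T ^ 2) := by rw [← e]; ring
    rw [e2, hT]
    field_simp
    ring
  have hnn : ∀ t ∈ Ioc 0 T, u - 2 * (√u * √κ) * √t + κ * t = (√u - √(t * κ)) ^ 2 := fun t ht => by
    rw [Real.sqrt_mul ht.1.le, sub_sq, mul_pow, Real.sq_sqrt hu, Real.sq_sqrt ht.1.le,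
      Real.sq_sqrt hκ.le]
    ring
  have hle : ∀ t ∈ Ioc 0 T, √(t * κ) ≤ √u := fun t ht => by
    refine Real.sqrt_le_sqrt ?_
    have := ht.2
    rwa [hT, le_div_iff₀ hκ] at this
  calc ENNReal.ofReal (u ^ 3 / (15 * κ ^ 2))
      = ENNReal.ofReal (∫ t in Ioc 0 T, 2 * t * (u - 2 * (√u * √κ) * √t + κ * t)) := by
        rw [← hval2, intervalIntegral.integral_of_le hT0]
    _ = ∫⁻ t in Ioc 0 T, ENNReal.ofReal (2 * t * (u - 2 * (√u * √κ) * √t + κ * t)) := by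
        refine ofReal_integral_eq_lintegral_ofReal
          ((intervalIntegrable_iff_integrableOn_Ioc_of_le hT0).1 (hcont.intervalIntegrable 0 T))
          ((ae_restrict_iff' measurableSet_Ioc).2 (ae_of_all _ fun t ht => ?_))
        have ht0 : 0 < t := ht.1
        simp only [hnn t ht, Pi.zero_apply]
        positivity
    _ = ∫⁻ t in Ioc 0 T, ENNReal.ofReal (2 * t * max (√u - √(t * κ)) 0 ^ 2) :=
        setLIntegral_congr_fun measurableSet_Ioc fun t ht => by
          simp only [hnn t ht, max_eq_left (sub_nonneg.2 (hle t ht))]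
    _ ≤ _ := lintegral_mono_set Ioc_subset_Ioi_self

variable {α : ℝ}

/-- The quantity whose square enters `K₂ α`: it controls the kernel of the high-momentum part of the
cut-off at all scales. -/
noncomputable def latticeSup (α : ℝ) : ℝ :=
  sSup ((fun b : ℝ => b ^ (5 / 3 : ℝ) * ∑' k : ℤ, 1 / (|(k : ℝ) + α| ^ 3 + b) ^ 2) '' Ici 0)

theorem summable_inv_pow_six (α : ℝ) :
    Summable fun k : ℤ => 1 / (|(k : ℝ) + α| ^ 3) ^ 2 := by
  refine ((Real.summable_one_div_int_add_rpow α 6).2 (by norm_num)).congr fun k => ?_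
  rw [← pow_mul]
  norm_cast

theorem summable_lattice (hα : ∀ m : ℤ, α ≠ m) {b : ℝ} (hb : 0 ≤ b) :
    Summable fun k : ℤ => 1 / (|(k : ℝ) + α| ^ 3 + b) ^ 2 := by
  refine Summable.of_nonneg_of_le (fun k => by positivity) (fun k => ?_) (summable_inv_pow_six α)
  have := abs_add_pos hα k
  gcongr
  linarith

/-- Comparison of the lattice sum of the Poisson kernel with its integral `π`: on a unit interval the
kernel varies by at most a factor `3`, because `β ≥ 1`. -/
theorem sum_poisson_le {β : ℝ} (hβ : 1 ≤ β) :
    Summable (fun k : ℤ => β / (β ^ 2 + ((k : ℝ) + α) ^ 2)) ∧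
      ∑' k : ℤ, β / (β ^ 2 + ((k : ℝ) + α) ^ 2) ≤ 3 * Real.pi := by
  have hβ0 : 0 < β := by linarith
  have e : (fun u : ℝ => β / (β ^ 2 + u ^ 2)) = fun u => β⁻¹ * (1 + (u / β) ^ 2)⁻¹ := by
    funext u
    field_simp
  have hi : Integrable fun u : ℝ => β / (β ^ 2 + u ^ 2) := by
    rw [e]
    exact (integrable_inv_one_add_sq.comp_div hβ0.ne').const_mul _
  have hv : ∫ u : ℝ, β / (β ^ 2 + u ^ 2) = Real.pi := by
    rw [e, integral_const_mul, Measure.integral_comp_div (fun u : ℝ => (1 + u ^ 2)⁻¹) β,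
      integral_univ_inv_one_add_sq, abs_of_pos hβ0, smul_eq_mul, ← mul_assoc,
      inv_mul_cancel₀ hβ0.ne', one_mul]
  have hs := hi.hasSum_intervalIntegral α
  rw [hv] at hs
  have hcont : Continuous fun u : ℝ => β / (β ^ 2 + u ^ 2) :=
    continuous_const.div (by fun_prop) fun u => by positivity
  have hle : ∀ k : ℤ, β / (β ^ 2 + ((k : ℝ) + α) ^ 2) ≤
      3 * ∫ u in (α + k)..(α + k + 1), β / (β ^ 2 + u ^ 2) := fun k => by
    have h1 : ∫ u in (α + k)..(α + k + 1), β / (β ^ 2 + ((k : ℝ) + α) ^ 2) / 3 ≤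
        ∫ u in (α + k)..(α + k + 1), β / (β ^ 2 + u ^ 2) := by
      refine intervalIntegral.integral_mono_on (by linarith) (by simp)
        (hcont.intervalIntegrable _ _) fun u hu => ?_
      rw [div_div]
      refine div_le_div_of_nonneg_left hβ0.le (by positivity) ?_
      obtain ⟨h1, h2⟩ := hu
      have h3 : (u - (k + α)) ^ 2 ≤ 1 := by nlinarith
      nlinarith [sq_nonneg (u - 2 * (k + α))]
    rw [intervalIntegral.integral_const] at h1
    simp only [add_sub_cancel_left, one_smul] at h1
    linarith
  have hs3 := hs.mul_left 3
  have hsum : Summable (fun k : ℤ => β / (β ^ 2 + ((k : ℝ) + α) ^ 2)) :=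
    Summable.of_nonneg_of_le (fun k => by positivity) hle hs3.summable
  exact ⟨hsum, (hsum.tsum_le_tsum hle hs3.summable).trans_eq hs3.tsum_eq⟩

theorem pow_five_mul_le {s t : ℝ} (hs : 0 < s) (ht : 0 < t) :
    t ^ 5 * (1 / (s ^ 3 + t ^ 3) ^ 2) ≤ 2 * (t / (t ^ 2 + s ^ 2)) := by
  rw [mul_one_div, ← mul_div_assoc, div_le_div_iff₀ (by positivity) (by positivity)]
  have key : t ^ 4 * (t ^ 2 + s ^ 2) ≤ 2 * (s ^ 3 + t ^ 3) ^ 2 := by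
    have h1 : t ^ 4 * s ^ 2 ≤ (s ^ 3 + t ^ 3) ^ 2 := by
      rcases le_total s t with h | h
      · have : t ^ 4 * s ^ 2 ≤ t ^ 4 * t ^ 2 := by gcongr
        nlinarith [pow_pos hs 3, pow_pos ht 3]
      · have : t ^ 3 * s ^ 2 * t ≤ t ^ 3 * s ^ 2 * s := by gcongr
        nlinarith [pow_pos hs 3, pow_pos ht 3]
    nlinarith [pow_pos hs 3, pow_pos ht 3, mul_pos (pow_pos hs 3) (pow_pos ht 3)]
  calc t ^ 5 * (t ^ 2 + s ^ 2) = t * (t ^ 4 * (t ^ 2 + s ^ 2)) := by ring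
    _ ≤ t * (2 * (s ^ 3 + t ^ 3) ^ 2) := by gcongr
    _ = _ := by ring

theorem rpow_five_thirds_pow_three {t : ℝ} (ht : 0 ≤ t) : (t ^ 3) ^ (5 / 3 : ℝ) = t ^ 5 := by
  rw [← Real.rpow_natCast t 3, ← Real.rpow_mul ht, ← Real.rpow_natCast t 5]
  norm_num

/-- The set defining `latticeSup` is bounded, so that the supremum is not a junk value. With
`b = t³`, the sum is bounded by its value at `b = 0` if `t ≤ 1`, and by a sum of Poisson kernels if
`t ≥ 1`. -/
theorem bddAbove_lattice (hα : ∀ m : ℤ, α ≠ m) : BddAbove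
    ((fun b : ℝ => b ^ (5 / 3 : ℝ) * ∑' k : ℤ, 1 / (|(k : ℝ) + α| ^ 3 + b) ^ 2) '' Ici 0) := by
  refine ⟨max (∑' k : ℤ, 1 / (|(k : ℝ) + α| ^ 3) ^ 2) (6 * Real.pi), ?_⟩
  rintro _ ⟨b, hb, rfl⟩
  have hb0 : (0 : ℝ) ≤ b := hb
  obtain ⟨t, ht, rfl⟩ : ∃ t : ℝ, 0 ≤ t ∧ b = t ^ 3 := ⟨b ^ (1 / 3 : ℝ), by positivity, by
    rw [← Real.rpow_natCast, ← Real.rpow_mul hb0]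
    norm_num⟩
  simp only [rpow_five_thirds_pow_three ht]
  rcases le_total t 1 with h | h
  · refine le_max_of_le_left ?_
    have h1 : ∑' k : ℤ, 1 / (|(k : ℝ) + α| ^ 3 + t ^ 3) ^ 2 ≤
        ∑' k : ℤ, 1 / (|(k : ℝ) + α| ^ 3) ^ 2 := by
      refine (summable_lattice hα hb0).tsum_le_tsum (fun k => ?_) (summable_inv_pow_six α)
      have := abs_add_pos hα k
      gcongr
      linarith
    have h0 : 0 ≤ ∑' k : ℤ, 1 / (|(k : ℝ) + α| ^ 3 + t ^ 3) ^ 2 :=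
      tsum_nonneg fun k => by positivity
    calc _ ≤ 1 * ∑' k : ℤ, 1 / (|(k : ℝ) + α| ^ 3 + t ^ 3) ^ 2 := by
          gcongr
          exact pow_le_one₀ ht h
      _ ≤ _ := by rwa [one_mul]
  · refine le_max_of_le_right ?_
    obtain ⟨hs, hle⟩ := sum_poisson_le (α := α) h
    rw [← tsum_mul_left]
    calc ∑' k : ℤ, t ^ 5 * (1 / (|(k : ℝ) + α| ^ 3 + t ^ 3) ^ 2)
        ≤ ∑' k : ℤ, 2 * (t / (t ^ 2 + ((k : ℝ) + α) ^ 2)) := by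
          refine ((summable_lattice hα hb0).mul_left _).tsum_le_tsum (fun k => ?_) (hs.mul_left 2)
          have := pow_five_mul_le (abs_add_pos hα k) (lt_of_lt_of_le one_pos h)
          rwa [sq_abs] at this
      _ ≤ 6 * Real.pi := by
          rw [tsum_mul_left]
          linarith

theorem pow_five_mul_le_latticeSup (hα : ∀ m : ℤ, α ≠ m) {t : ℝ} (ht : 0 ≤ t) :
    t ^ 5 * ∑' k : ℤ, 1 / (|(k : ℝ) + α| ^ 3 + t ^ 3) ^ 2 ≤ latticeSup α := by
  rw [← rpow_five_thirds_pow_three ht]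
  exact le_csSup (bddAbove_lattice hα) ⟨t ^ 3, pow_nonneg ht 3, rfl⟩

theorem latticeSup_pos (hα : ∀ m : ℤ, α ≠ m) : 0 < latticeSup α := by
  refine lt_of_lt_of_le ?_ (pow_five_mul_le_latticeSup hα zero_le_one)
  rw [one_pow, one_mul]
  refine (summable_lattice hα (by positivity)).tsum_pos (fun k => by positivity) 0 ?_
  positivity

/-- The `ℓ²` norm of the high-momentum part of the multiplier, uniformly in the cut-off. -/
theorem sum_one_sub_lowPass_sq_le (hα : ∀ m : ℤ, α ≠ m) {t : ℝ} (ht : 0 < t) :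
    Summable (fun k : ℤ => (1 - lowPass |(k : ℝ) + α| t) ^ 2) ∧
      ∑' k : ℤ, (1 - lowPass |(k : ℝ) + α| t) ^ 2 ≤ t * latticeSup α := by
  have e : (fun k : ℤ => (1 - lowPass |(k : ℝ) + α| t) ^ 2) =
      fun k : ℤ => t ^ 6 * (1 / (|(k : ℝ) + α| ^ 3 + t ^ 3) ^ 2) := by
    funext k
    rw [one_sub_lowPass (abs_add_pos hα k) ht, div_pow]
    ring
  rw [e]
  refine ⟨(summable_lattice hα (by positivity)).mul_left _, ?_⟩
  rw [tsum_mul_left, show t ^ 6 = t * t ^ 5 by ring, mul_assoc]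
  exact mul_le_mul_of_nonneg_left (pow_five_mul_le_latticeSup hα ht.le) ht.le

/-- `K₂` as the product of the constants of the pointwise bound and of the kinetic energy; the
length `L` cancels. -/
theorem K₂_eq (L : ℝ) (hL : 0 < L) : K₂ α = 15 * (latticeSup α / L) ^ 2 *
    (4 * Real.pi / (9 * √3) * (L / (2 * Real.pi)) ^ 2) := by
  have := Real.pi_pos
  have h3 : 0 < √3 := by positivity
  rw [K₂, ← latticeSup]
  field_simp
  ring

end CutOff

/-! ### The bound by `K₂` -/

section LowPass

variable {L α : ℝ}

/-- The low-momentum part of `f` at the cut-off scale `t`. -/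
noncomputable def lowPassFn (L α : ℝ) (f : ℝ → ℂ) (t x : ℝ) : ℂ :=
  modeSum L α (fun k => (lowPass |(k : ℝ) + α| t : ℂ) * modeCoeff L α f k) x

theorem norm_lowPass_mul_le (hα : ∀ m : ℤ, α ≠ m) (k : ℤ) (t : ℝ) (c : ℂ) :
    ‖(lowPass |(k : ℝ) + α| t : ℂ) * c‖ ≤ ‖c‖ := by
  rw [norm_mul, Complex.norm_real, Real.norm_of_nonneg (lowPass_nonneg (abs_add_pos hα k) t)]
  exact mul_le_of_le_one_left (norm_nonneg _) (lowPass_le_one (abs_add_pos hα k) t)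

theorem summable_lowPass_mul (hα : ∀ m : ℤ, α ≠ m) {c : ℤ → ℂ} (hc : Summable fun k => ‖c k‖)
    (t : ℝ) : Summable fun k : ℤ => ‖(lowPass |(k : ℝ) + α| t : ℂ) * c k‖ :=
  Summable.of_nonneg_of_le (fun _ => norm_nonneg _) (fun _ => norm_lowPass_mul_le hα _ t _) hc

theorem continuous_lowPassFn (hα : ∀ m : ℤ, α ≠ m) {f : ℝ → ℂ}
    (hs : Summable fun k => ‖modeCoeff L α f k‖) :
    Continuous fun p : ℝ × ℝ => lowPassFn L α f p.1 p.2 := by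
  refine continuous_tsum (fun k => ?_) hs fun k p => ?_
  · refine Continuous.mul (Continuous.mul ?_ continuous_const)
      ((continuous_mode k).comp continuous_snd)
    exact Complex.continuous_ofReal.comp
      ((continuous_lowPass (abs_add_pos hα k)).comp continuous_fst)
  · rw [norm_mul, norm_mode, mul_one]
    exact norm_lowPass_mul_le hα k _ _

/-- The kinetic energy is recovered by integrating the low-momentum parts over all scales. -/
theorem lintegral_lowPassFn (hα : ∀ m : ℤ, α ≠ m) (hL : 0 < L) {f f' : ℝ → ℂ}
    (hf : IsPrimitive 0 L f f')
    (hq : f L = Complex.exp ((2 * Real.pi * α : ℝ) * Complex.I) * f 0)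
    (hm : MemLp f' 2 (volume.restrict (Ioc 0 L))) :
    ∫⁻ x in Ioc 0 L, ∫⁻ t in Ioi (0 : ℝ), ENNReal.ofReal (2 * t * ‖lowPassFn L α f t x‖ ^ 2) =
      ENNReal.ofReal (4 * Real.pi / (9 * √3) * (L / (2 * Real.pi)) ^ 2 *
        ∫ x in (0 : ℝ)..L, ‖f' x‖ ^ 2) := by
  have hs := summable_modeCoeff hα hL hf hq hm
  have hcont := continuous_lowPassFn (L := L) hα hs
  have hpi := Real.pi_pos
  rw [lintegral_lintegral_swap]
  swap
  · refine (Measurable.ennreal_ofReal ?_).aemeasurable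
    have h : Continuous fun p : ℝ × ℝ => 2 * p.2 * ‖lowPassFn L α f p.2 p.1‖ ^ 2 :=
      (continuous_const.mul continuous_snd).mul ((hcont.comp continuous_swap).norm.pow 2)
    exact h.measurable
  have h1 : ∀ t ∈ Ioi (0 : ℝ), ∫⁻ x in Ioc 0 L, ENNReal.ofReal (2 * t * ‖lowPassFn L α f t x‖ ^ 2) =
      ∑' k : ℤ, ENNReal.ofReal (2 * t * lowPass |(k : ℝ) + α| t ^ 2) *
        ENNReal.ofReal (L * ‖modeCoeff L α f k‖ ^ 2) := by
    intro t ht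
    have ht0 : (0 : ℝ) < t := ht
    have hct : Continuous fun x => 2 * t * ‖lowPassFn L α f t x‖ ^ 2 :=
      continuous_const.mul ((hcont.comp (continuous_const.prodMk continuous_id)).norm.pow 2)
    have h2 := (hasSum_norm_sq_modeSum (α := α) hL (summable_lowPass_mul hα hs t)).mul_left (2 * t * L)
    rw [← ofReal_integral_eq_lintegral_ofReal
      ((intervalIntegrable_iff_integrableOn_Ioc_of_le hL.le).1 (hct.intervalIntegrable 0 L))
      (ae_of_all _ fun x => by simp only [Pi.zero_apply]; positivity),
      ← intervalIntegral.integral_of_le hL.le, intervalIntegral.integral_const_mul]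
    have e : 2 * t * ∫ x in (0 : ℝ)..L, ‖lowPassFn L α f t x‖ ^ 2 =
        2 * t * L * (1 / L * ∫ x in (0 : ℝ)..L, ‖lowPassFn L α f t x‖ ^ 2) := by
      field_simp
    rw [e]
    unfold lowPassFn
    rw [← h2.tsum_eq, ENNReal.ofReal_tsum_of_nonneg (fun k => by positivity) h2.summable]
    refine tsum_congr fun k => ?_
    rw [← ENNReal.ofReal_mul (by positivity), norm_mul, Complex.norm_real, mul_pow,
      Real.norm_eq_abs, sq_abs]
    congr 1
    ring
  rw [setLIntegral_congr_fun measurableSet_Ioi h1, lintegral_tsum]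
  swap
  · intro k
    have h : Continuous fun t : ℝ => 2 * t * lowPass |(k : ℝ) + α| t ^ 2 :=
      (continuous_const.mul continuous_id).mul ((continuous_lowPass (abs_add_pos hα k)).pow 2)
    exact (h.measurable.ennreal_ofReal.mul_const _).aemeasurable
  have h3 := (hasSum_norm_sq_modeCoeff (α := α) hL hm).mul_left
    (4 * Real.pi / (9 * √3) * (L / (2 * Real.pi)) ^ 2 * L)
  have e3 : 4 * Real.pi / (9 * √3) * (L / (2 * Real.pi)) ^ 2 * ∫ x in (0 : ℝ)..L, ‖f' x‖ ^ 2 =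
      4 * Real.pi / (9 * √3) * (L / (2 * Real.pi)) ^ 2 * L *
        (1 / L * ∫ x in (0 : ℝ)..L, ‖f' x‖ ^ 2) := by
    field_simp
  rw [e3, ← h3.tsum_eq, ENNReal.ofReal_tsum_of_nonneg (fun k => by positivity) h3.summable]
  refine tsum_congr fun k => ?_
  rw [lintegral_mul_const' _ _ ENNReal.ofReal_ne_top, lintegral_lowPass (abs_add_pos hα k),
    ← ENNReal.ofReal_mul (by positivity), modeCoeff_deriv hL hf hq, norm_mul, norm_mul,
    Complex.norm_real, Complex.norm_I, mul_one, mul_pow, Real.norm_eq_abs, sq_abs, sq_abs, freq]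
  congr 1
  field_simp

theorem lowPassFn_sum (hα : ∀ m : ℤ, α ≠ m) {N : ℕ} (c : Fin N → ℂ) {f : Fin N → ℝ → ℂ}
    (hf : ∀ n, IntervalIntegrable (f n) volume 0 L)
    (hs : ∀ n, Summable fun k => ‖modeCoeff L α (f n) k‖) (t x : ℝ) :
    lowPassFn L α (fun y => ∑ n, c n * f n y) t x = ∑ n, c n * lowPassFn L α (f n) t x := by
  unfold lowPassFn modeSum
  simp_rw [← tsum_mul_left]
  rw [← Summable.tsum_finsetSum fun n _ =>
    (summable_mul_mode (summable_lowPass_mul hα (hs n) t) x).mul_left _]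
  refine tsum_congr fun k => ?_
  rw [modeCoeff_sum c hf, Finset.mul_sum, Finset.sum_mul]
  exact Finset.sum_congr rfl fun n _ => by ring

/-- The Cauchy–Schwarz inequality for series. -/
theorem sq_tsum_mul_le {ι : Type*} {f g : ι → ℝ} (hf0 : ∀ i, 0 ≤ f i) (hg0 : ∀ i, 0 ≤ g i)
    (hf : Summable fun i => f i ^ 2) (hg : Summable fun i => g i ^ 2) :
    Summable (fun i => f i * g i) ∧
      (∑' i, f i * g i) ^ 2 ≤ (∑' i, f i ^ 2) * ∑' i, g i ^ 2 := by
  have hs : Summable fun i => f i * g i :=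
    Summable.of_nonneg_of_le (fun i => mul_nonneg (hf0 i) (hg0 i))
      (fun i => by nlinarith [sq_nonneg (f i - g i), hf0 i, hg0 i, mul_nonneg (hf0 i) (hg0 i)])
      (hf.add hg)
  refine ⟨hs, ?_⟩
  have h : ∀ s : ℝ, 0 ≤ (∑' i, f i ^ 2) * (s * s) + (2 * ∑' i, f i * g i) * s + ∑' i, g i ^ 2 := by
    intro s
    have e : ∑' i, (s * f i + g i) ^ 2 =
        (∑' i, f i ^ 2) * (s * s) + (2 * ∑' i, f i * g i) * s + ∑' i, g i ^ 2 := by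
      rw [← tsum_mul_right, ← tsum_mul_left, ← tsum_mul_right,
        ← (hf.mul_right _).tsum_add ((hs.mul_left _).mul_right _),
        ← ((hf.mul_right _).add ((hs.mul_left _).mul_right _)).tsum_add hg]
      exact tsum_congr fun i => by ring
    rw [← e]
    exact tsum_nonneg fun i => sq_nonneg _
  have := discrim_le_zero h
  rw [discrim] at this
  nlinarith

variable {M N : ℕ} {w w' : Fin N → ℝ → EuclideanSpace ℂ (Fin M)}

theorem isPrimitive_inner {a b : ℝ} (e : EuclideanSpace ℂ (Fin M))
    {u u' : ℝ → EuclideanSpace ℂ (Fin M)} (hu : IsPrimitive a b u u') :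
    IsPrimitive a b (fun x => inner ℂ e (u x)) (fun x => inner ℂ e (u' x)) :=
  hu.clm_comp ((innerSL ℂ e).restrictScalars ℝ)

theorem inner_quasiperiodic (e : EuclideanSpace ℂ (Fin M)) {u : ℝ → EuclideanSpace ℂ (Fin M)}
    {z : ℂ} (hq : u L = z • u 0) : inner ℂ e (u L) = z * inner ℂ e (u 0) := by
  rw [hq, inner_smul_right]

/-- The high-momentum parts of an orthonormal system are small pointwise: testing against
themselves, Bessel's inequality bounds them by the norm of the kernel of the cut-off. The Fourier
series is evaluated at `x`, which excludes the endpoint `L`. -/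
theorem sum_norm_sq_high_le (hα : ∀ m : ℤ, α ≠ m) (hL : 0 < L)
    (hw : ∀ n, IsPrimitive 0 L (w n) (w' n))
    (hq : ∀ n, w n L = Complex.exp ((2 * Real.pi * α : ℝ) * Complex.I) • w n 0)
    (hm : ∀ n, MemLp (w' n) 2 (volume.restrict (Ioc 0 L)))
    (ho : ∀ n m, ∫ x in (0 : ℝ)..L, inner ℂ (w n x) (w m x) = if n = m then 1 else 0)
    {x : ℝ} (hx : x ∈ Ico 0 L) {t : ℝ} (ht : 0 < t) {e : EuclideanSpace ℂ (Fin M)}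
    (he : ‖e‖ = 1) :
    ∑ n, ‖inner ℂ e (w n x) - lowPassFn L α (fun y => inner ℂ e (w n y)) t x‖ ^ 2 ≤
      t * (latticeSup α / L) := by
  set f : Fin N → ℝ → ℂ := fun n y => inner ℂ e (w n y) with hfdef
  set d : Fin N → ℂ := fun n => f n x - lowPassFn L α (f n) t x with hd
  have hf : ∀ n, IsPrimitive 0 L (f n) (fun y => inner ℂ e (w' n y)) := fun n =>
    isPrimitive_inner e (hw n)
  have hs : ∀ n, Summable fun k => ‖modeCoeff L α (f n) k‖ := fun n =>
    summable_modeCoeff hα hL (hf n) (inner_quasiperiodic e (hq n)) ((hm n).const_inner e)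
  have hfi : ∀ n, IntervalIntegrable (f n) volume 0 L := fun n => by
    refine ContinuousOn.intervalIntegrable ?_
    rw [uIcc_of_le hL.le]
    exact (hf n).continuousOn hL.le
  have hwL : ∀ n, MemLp (w n) 2 (volume.restrict (Ioc 0 L)) := fun n => (hw n).memLp hL.le 2
  -- the test function: its high-momentum part at `x` equals `R = ∑ ‖d n‖²`, and its norm is at
  -- most `√R` by orthonormality, so Cauchy–Schwarz on the Fourier side gives `R² ≤ const * R`
  set g : ℝ → ℂ := fun y => ∑ n, star (d n) * f n y with hg
  have hgdef : ∀ y, g y = inner ℂ e (∑ n, star (d n) • w n y) := fun y => by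
    simp only [hg, hfdef, inner_sum, inner_smul_right]
  set R := ∑ n, ‖d n‖ ^ 2 with hR
  have hR0 : 0 ≤ R := Finset.sum_nonneg fun n _ => by positivity
  have hgm : MemLp g 2 (volume.restrict (Ioc 0 L)) := by
    have := (memLp_finsetSum (Finset.univ) fun n _ => (hwL n).const_smul (star (d n))).const_inner
      (𝕜 := ℂ) e
    exact this.congr_norm
      (by
        refine AEStronglyMeasurable.congr this.aestronglyMeasurable (ae_of_all _ fun y => ?_)
        simp only [hgdef, Pi.smul_apply])
      (ae_of_all _ fun y => by simp only [hgdef, Pi.smul_apply])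
  have hgnorm : ∫ y in (0 : ℝ)..L, ‖g y‖ ^ 2 ≤ R := by
    have h := integral_norm_sq_inner_le hL.le hwL (fun n => star (d n)) he
    rw [integral_norm_sq_sum_smul_of_orthonormal hL.le hwL ho] at h
    simp only [norm_star] at h
    simpa only [hgdef] using h
  have hpars := hasSum_norm_sq_modeCoeff (α := α) hL hgm
  obtain ⟨hms, hmle⟩ := sum_one_sub_lowPass_sq_le hα ht
  obtain ⟨hcs, hcs2⟩ := sq_tsum_mul_le
    (fun k : ℤ => sub_nonneg.2 (lowPass_le_one (abs_add_pos hα k) t))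
    (fun k : ℤ => norm_nonneg (modeCoeff L α g k)) hms hpars.summable
  have hdn : ∀ n, HasSum (fun k : ℤ => (1 - lowPass |(k : ℝ) + α| t : ℂ) *
      modeCoeff L α (f n) k * mode L α k x) (d n) := fun n => by
    have h1 := hasSum_modeCoeff hL ((hf n).continuousOn hL.le) (inner_quasiperiodic e (hq n))
      (hs n) hx
    have h2 := (summable_mul_mode (L := L) (α := α) (summable_lowPass_mul hα (hs n) t) x).hasSum
    refine (h1.sub h2).congr_fun fun k => ?_
    ring
  have hRsum : HasSum (fun k : ℤ => (1 - lowPass |(k : ℝ) + α| t : ℂ) * modeCoeff L α g k *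
      mode L α k x) (R : ℂ) := by
    have h := hasSum_sum (s := Finset.univ) fun n _ => (hdn n).mul_left (star (d n))
    have e1 : ∑ n, star (d n) * d n = (R : ℂ) := by
      rw [hR, Complex.ofReal_sum]
      refine Finset.sum_congr rfl fun n _ => ?_
      rw [Complex.star_def, ← Complex.normSq_eq_conj_mul_self, Complex.normSq_eq_norm_sq]
    rw [e1] at h
    refine h.congr_fun fun k => ?_
    rw [hg, modeCoeff_sum _ hfi, Finset.mul_sum, Finset.sum_mul]
    exact Finset.sum_congr rfl fun n _ => by ring
  have hnorm : ∀ k : ℤ, ‖(1 - lowPass |(k : ℝ) + α| t : ℂ) * modeCoeff L α g k * mode L α k x‖ =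
      (1 - lowPass |(k : ℝ) + α| t) * ‖modeCoeff L α g k‖ := fun k => by
    rw [norm_mul, norm_mul, norm_mode, mul_one]
    congr 1
    rw [← Complex.ofReal_one, ← Complex.ofReal_sub, Complex.norm_real, Real.norm_of_nonneg
      (sub_nonneg.2 (lowPass_le_one (abs_add_pos hα k) t))]
  have hRle : R ≤ ∑' k : ℤ, (1 - lowPass |(k : ℝ) + α| t) * ‖modeCoeff L α g k‖ := by
    have h := norm_tsum_le_tsum_norm (f := fun k : ℤ => (1 - lowPass |(k : ℝ) + α| t : ℂ) *
      modeCoeff L α g k * mode L α k x) (by simpa only [hnorm] using hcs)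
    rw [hRsum.tsum_eq, Complex.norm_real, Real.norm_of_nonneg hR0] at h
    simpa only [hnorm] using h
  have hSpos := latticeSup_pos hα
  have hfin : R ^ 2 ≤ (t * latticeSup α) * (1 / L * R) := by
    calc R ^ 2 ≤ (∑' k : ℤ, (1 - lowPass |(k : ℝ) + α| t) * ‖modeCoeff L α g k‖) ^ 2 :=
          pow_le_pow_left₀ hR0 hRle 2
      _ ≤ _ := hcs2
      _ ≤ (t * latticeSup α) * (1 / L * R) := by
          rw [hpars.tsum_eq]
          exact mul_le_mul hmle (mul_le_mul_of_nonneg_left hgnorm (by positivity))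
            (mul_nonneg (by positivity) (intervalIntegral.integral_nonneg hL.le
              fun y _ => by positivity)) (by positivity)
  rcases hR0.eq_or_lt with h | h
  · rw [← h]
    positivity
  · have h2 : R * R ≤ (t * (latticeSup α / L)) * R := by
      calc R * R = R ^ 2 := (sq R).symm
        _ ≤ _ := hfin
        _ = _ := by ring
    exact le_of_mul_le_mul_right h2 h

/-- The pointwise lower bound for the low-momentum density in terms of the eigenvalues of `U(x)`: the
triangle inequality along each eigenvector, with the high-momentum part subtracted. -/
theorem sum_max_sqrt_sub_le (hα : ∀ m : ℤ, α ≠ m) (hL : 0 < L)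
    (hw : ∀ n, IsPrimitive 0 L (w n) (w' n))
    (hq : ∀ n, w n L = Complex.exp ((2 * Real.pi * α : ℝ) * Complex.I) • w n 0)
    (hm : ∀ n, MemLp (w' n) 2 (volume.restrict (Ioc 0 L)))
    (ho : ∀ n m, ∫ x in (0 : ℝ)..L, inner ℂ (w n x) (w m x) = if n = m then 1 else 0)
    {x : ℝ} (hx : x ∈ Ico 0 L) {t : ℝ} (ht : 0 < t) :
    ∑ j, max (√((isHermitian_densityMatrix w x).eigenvalues j) - √(t * (latticeSup α / L))) 0 ^ 2 ≤
      ∑ n, ∑ i, ‖lowPassFn L α (fun y => w n y i) t x‖ ^ 2 := by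
  set hU := isHermitian_densityMatrix w x
  set e := hU.eigenvectorBasis
  have hcomp : ∀ n i, IsPrimitive 0 L (fun y => w n y i) (fun y => w' n y i) := fun n i =>
    (hw n).clm_comp ((EuclideanSpace.proj (𝕜 := ℂ) i).restrictScalars ℝ)
  have hci : ∀ n i, IntervalIntegrable (fun y => w n y i) volume 0 L := fun n i => by
    refine ContinuousOn.intervalIntegrable ?_
    rw [uIcc_of_le hL.le]
    exact (hcomp n i).continuousOn hL.le
  have hcs : ∀ n i, Summable fun k => ‖modeCoeff L α (fun y => w n y i) k‖ := fun n i =>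
    summable_modeCoeff hα hL (hcomp n i) (by rw [hq n]; rfl)
      ((hm n).of_le ((EuclideanSpace.proj (𝕜 := ℂ) i).continuous.comp_aestronglyMeasurable
        (hm n).aestronglyMeasurable) (ae_of_all _ fun y => PiLp.norm_apply_le _ i))
  -- the low-momentum part of a component along `e j`
  have hlow : ∀ n j, lowPassFn L α (fun y => inner ℂ (e j) (w n y)) t x = inner ℂ (e j)
      (WithLp.toLp 2 fun i => lowPassFn L α (fun y => w n y i) t x) := fun n j => by
    have h := lowPassFn_sum hα (fun i => star (e j i)) (hci n) (hcs n) t x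
    have e1 : ∀ v : EuclideanSpace ℂ (Fin M), inner ℂ (e j) v = ∑ i, star (e j i) * v i :=
      fun v => by
        rw [PiLp.inner_apply]
        exact Finset.sum_congr rfl fun i _ => mul_comm _ _
    simp only [e1]
    exact h
  have hsum : ∑ n, ∑ i, ‖lowPassFn L α (fun y => w n y i) t x‖ ^ 2 =
      ∑ j, ∑ n, ‖lowPassFn L α (fun y => inner ℂ (e j) (w n y)) t x‖ ^ 2 := by
    symm
    rw [Finset.sum_comm]
    refine Finset.sum_congr rfl fun n _ => ?_
    simp only [hlow]
    rw [e.sum_sq_norm_inner_right, EuclideanSpace.norm_sq_eq]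
  rw [hsum]
  refine Finset.sum_le_sum fun j _ => ?_
  have hnn : 0 ≤ ∑ n, ‖lowPassFn L α (fun y => inner ℂ (e j) (w n y)) t x‖ ^ 2 :=
    Finset.sum_nonneg fun n _ => by positivity
  have htri : √(hU.eigenvalues j) ≤
      √(∑ n, ‖lowPassFn L α (fun y => inner ℂ (e j) (w n y)) t x‖ ^ 2) +
        √(t * (latticeSup α / L)) := by
    set A : EuclideanSpace ℂ (Fin N) := WithLp.toLp 2 fun n => inner ℂ (e j) (w n x)
    set B : EuclideanSpace ℂ (Fin N) :=
      WithLp.toLp 2 fun n => lowPassFn L α (fun y => inner ℂ (e j) (w n y)) t x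
    have h1 : √(hU.eigenvalues j) = ‖A‖ := by
      rw [EuclideanSpace.norm_eq, eigenvalues_densityMatrix]
    have h2 : √(∑ n, ‖lowPassFn L α (fun y => inner ℂ (e j) (w n y)) t x‖ ^ 2) = ‖B‖ := by
      rw [EuclideanSpace.norm_eq]
    have h3 : ‖A - B‖ ≤ √(t * (latticeSup α / L)) := by
      rw [EuclideanSpace.norm_eq]
      exact Real.sqrt_le_sqrt (sum_norm_sq_high_le hα hL hw hq hm ho hx ht (e.norm_eq_one j))
    rw [h1, h2]
    have := norm_add_le B (A - B)
    rw [add_sub_cancel] at this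
    linarith
  calc max (√(hU.eigenvalues j) - √(t * (latticeSup α / L))) 0 ^ 2
      ≤ √(∑ n, ‖lowPassFn L α (fun y => inner ℂ (e j) (w n y)) t x‖ ^ 2) ^ 2 := by
        refine pow_le_pow_left₀ (le_max_right _ _) (max_le ?_ (Real.sqrt_nonneg _)) 2
        linarith
    _ = _ := Real.sq_sqrt hnn

/-- Integrating the lower bound for the low-momentum density against `2 t dt` gives a multiple of
`Tr U³` on one side and of the kinetic energy on the other. -/
theorem isAdmissible_K₂ (hα : ∀ m : ℤ, α ≠ m) : IsAdmissible α (K₂ α) := by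
  have hpi := Real.pi_pos
  refine isAdmissible_of_quasiperiodic (by rw [K₂]; positivity) ?_
  intro L hL M N w w' hw hq hm ho
  have hS := latticeSup_pos hα
  set κ := latticeSup α / L with hκ
  have hκ0 : 0 < κ := by positivity
  set C := 4 * Real.pi / (9 * √3) * (L / (2 * Real.pi)) ^ 2 with hC
  have hC0 : 0 ≤ C := by positivity
  have hcomp : ∀ n i, IsPrimitive 0 L (fun y => w n y i) (fun y => w' n y i) := fun n i =>
    (hw n).clm_comp ((EuclideanSpace.proj (𝕜 := ℂ) i).restrictScalars ℝ)
  have hcm : ∀ n i, MemLp (fun y => w' n y i) 2 (volume.restrict (Ioc 0 L)) := fun n i =>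
    (hm n).of_le ((EuclideanSpace.proj (𝕜 := ℂ) i).continuous.comp_aestronglyMeasurable
        (hm n).aestronglyMeasurable) (ae_of_all _ fun y => PiLp.norm_apply_le _ i)
  have hcq : ∀ n i, w n L i = Complex.exp ((2 * Real.pi * α : ℝ) * Complex.I) * w n 0 i :=
    fun n i => by rw [hq n]; rfl
  have hcont : ∀ n i, Continuous fun p : ℝ × ℝ =>
      2 * p.2 * ‖lowPassFn L α (fun y => w n y i) p.2 p.1‖ ^ 2 := fun n i =>
    (continuous_const.mul continuous_snd).mul (((continuous_lowPassFn hα (summable_modeCoeff hα hL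
      (hcomp n i) (hcq n i) (hcm n i))).comp continuous_swap).norm.pow 2)
  have hpt : ∀ x ∈ Ico 0 L,
      ENNReal.ofReal ((Matrix.trace (densityMatrix w x ^ 3)).re / (15 * κ ^ 2)) ≤
        ∑ n, ∑ i, ∫⁻ t in Ioi (0 : ℝ),
          ENNReal.ofReal (2 * t * ‖lowPassFn L α (fun y => w n y i) t x‖ ^ 2) := by
    intro x hx
    have hmeas : ∀ n i, Measurable fun t : ℝ =>
        ENNReal.ofReal (2 * t * ‖lowPassFn L α (fun y => w n y i) t x‖ ^ 2) := fun n i =>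
      ((hcont n i).comp (continuous_const.prodMk continuous_id)).measurable.ennreal_ofReal
    have hmeas2 : ∀ j, Measurable fun t : ℝ => ENNReal.ofReal (2 * t *
        max (√((isHermitian_densityMatrix w x).eigenvalues j) - √(t * κ)) 0 ^ 2) := fun j => by
      refine Measurable.ennreal_ofReal (Continuous.measurable ?_)
      fun_prop
    calc ENNReal.ofReal ((Matrix.trace (densityMatrix w x ^ 3)).re / (15 * κ ^ 2))
        = ∑ j, ENNReal.ofReal
            ((isHermitian_densityMatrix w x).eigenvalues j ^ 3 / (15 * κ ^ 2)) := by
          rw [trace_pow_re (isHermitian_densityMatrix w x), Finset.sum_div,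
            ENNReal.ofReal_sum_of_nonneg]
          intro j _
          have := eigenvalues_densityMatrix_nonneg w x j
          positivity
      _ ≤ ∑ j, ∫⁻ t in Ioi (0 : ℝ), ENNReal.ofReal (2 * t *
            max (√((isHermitian_densityMatrix w x).eigenvalues j) - √(t * κ)) 0 ^ 2) :=
          Finset.sum_le_sum fun j _ =>
            ofReal_le_lintegral_sq_sub (eigenvalues_densityMatrix_nonneg w x j) hκ0
      _ = ∫⁻ t in Ioi (0 : ℝ), ∑ j, ENNReal.ofReal (2 * t *
            max (√((isHermitian_densityMatrix w x).eigenvalues j) - √(t * κ)) 0 ^ 2) :=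
          (lintegral_finsetSum _ fun j _ => hmeas2 j).symm
      _ ≤ ∫⁻ t in Ioi (0 : ℝ), ∑ n, ∑ i,
            ENNReal.ofReal (2 * t * ‖lowPassFn L α (fun y => w n y i) t x‖ ^ 2) := by
          refine setLIntegral_mono' measurableSet_Ioi fun t ht => ?_
          have ht0 : (0 : ℝ) < t := ht
          have e1 : ∀ n, ∑ i, ENNReal.ofReal (2 * t * ‖lowPassFn L α (fun y => w n y i) t x‖ ^ 2) =
              ENNReal.ofReal (∑ i, 2 * t * ‖lowPassFn L α (fun y => w n y i) t x‖ ^ 2) := fun n =>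
            (ENNReal.ofReal_sum_of_nonneg fun i _ => by positivity).symm
          simp only [e1]
          rw [← ENNReal.ofReal_sum_of_nonneg (fun j _ => by positivity),
            ← ENNReal.ofReal_sum_of_nonneg (fun n _ => Finset.sum_nonneg fun i _ => by positivity)]
          refine ENNReal.ofReal_le_ofReal ?_
          simp_rw [← Finset.mul_sum]
          exact mul_le_mul_of_nonneg_left (sum_max_sqrt_sub_le hα hL hw hq hm ho hx ht0)
            (by positivity)
      _ = _ := by
          rw [lintegral_finsetSum _ fun n _ => Finset.measurable_sum _ fun i _ => hmeas n i]
          exact Finset.sum_congr rfl fun n _ => lintegral_finsetSum _ fun i _ => hmeas n i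
  have hmeas3 : ∀ n i, Measurable fun x => ∫⁻ t in Ioi (0 : ℝ),
      ENNReal.ofReal (2 * t * ‖lowPassFn L α (fun y => w n y i) t x‖ ^ 2) := fun n i =>
    Measurable.lintegral_prod_right' (f := fun p : ℝ × ℝ =>
      ENNReal.ofReal (2 * p.2 * ‖lowPassFn L α (fun y => w n y i) p.2 p.1‖ ^ 2))
      (hcont n i).measurable.ennreal_ofReal
  have hci : IntervalIntegrable (fun x => (Matrix.trace (densityMatrix w x ^ 3)).re) volume 0 L := by
    refine ContinuousOn.intervalIntegrable ?_
    rw [uIcc_of_le hL.le]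
    exact continuousOn_trace_densityMatrix_pow (fun n => (hw n).continuousOn hL.le) 3
  have hcin : ∀ n i, 0 ≤ ∫ x in (0 : ℝ)..L, ‖w' n x i‖ ^ 2 := fun n i =>
    intervalIntegral.integral_nonneg hL.le fun y _ => by positivity
  have hmain : ENNReal.ofReal
      ((∫ x in (0 : ℝ)..L, (Matrix.trace (densityMatrix w x ^ 3)).re) / (15 * κ ^ 2)) ≤
      ENNReal.ofReal (C * ∑ n, ∫ x in (0 : ℝ)..L, ‖w' n x‖ ^ 2) := by
    rw [← intervalIntegral.integral_div, intervalIntegral.integral_of_le hL.le,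
      ofReal_integral_eq_lintegral_ofReal
        ((intervalIntegrable_iff_integrableOn_Ioc_of_le hL.le).1 (hci.div_const _))
        (ae_of_all _ fun x => div_nonneg (trace_densityMatrix_pow_three_nonneg w x)
          (by positivity))]
    calc ∫⁻ x in Ioc 0 L,
          ENNReal.ofReal ((Matrix.trace (densityMatrix w x ^ 3)).re / (15 * κ ^ 2))
        ≤ ∫⁻ x in Ioc 0 L, ∑ n, ∑ i, ∫⁻ t in Ioi (0 : ℝ),
            ENNReal.ofReal (2 * t * ‖lowPassFn L α (fun y => w n y i) t x‖ ^ 2) := by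
          refine lintegral_mono_ae ?_
          have hne : ∀ᵐ x ∂(volume.restrict (Ioc 0 L)), x ≠ L :=
            ae_restrict_of_ae (by simp [ae_iff, measure_singleton])
          filter_upwards [hne, ae_restrict_mem measurableSet_Ioc] with x h1 h2
          exact hpt x ⟨h2.1.le, lt_of_le_of_ne h2.2 h1⟩
      _ = ∑ n, ∑ i, ∫⁻ x in Ioc 0 L, ∫⁻ t in Ioi (0 : ℝ),
            ENNReal.ofReal (2 * t * ‖lowPassFn L α (fun y => w n y i) t x‖ ^ 2) := by
          rw [lintegral_finsetSum _ fun n _ => Finset.measurable_sum _ fun i _ => hmeas3 n i]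
          exact Finset.sum_congr rfl fun n _ => lintegral_finsetSum _ fun i _ => hmeas3 n i
      _ = ∑ n, ∑ i, ENNReal.ofReal (C * ∫ x in (0 : ℝ)..L, ‖w' n x i‖ ^ 2) :=
          Finset.sum_congr rfl fun n _ => Finset.sum_congr rfl fun i _ =>
            lintegral_lowPassFn hα hL (hcomp n i) (hcq n i) (hcm n i)
      _ = ∑ n, ENNReal.ofReal (∑ i, C * ∫ x in (0 : ℝ)..L, ‖w' n x i‖ ^ 2) :=
          Finset.sum_congr rfl fun n _ =>
            (ENNReal.ofReal_sum_of_nonneg fun i _ => mul_nonneg hC0 (hcin n i)).symm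
      _ = ENNReal.ofReal (∑ n, ∑ i, C * ∫ x in (0 : ℝ)..L, ‖w' n x i‖ ^ 2) :=
          (ENNReal.ofReal_sum_of_nonneg fun n _ =>
            Finset.sum_nonneg fun i _ => mul_nonneg hC0 (hcin n i)).symm
      _ = _ := by
          congr 1
          simp_rw [← Finset.mul_sum]
          congr 1
          refine Finset.sum_congr rfl fun n _ => ?_
          rw [← intervalIntegral.integral_finsetSum fun i _ =>
            MemLp.intervalIntegrable_norm_sq hL.le (hcm n i)]
          exact intervalIntegral.integral_congr fun x _ => (EuclideanSpace.norm_sq_eq _).symm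
  have h2 := (ENNReal.ofReal_le_ofReal_iff (mul_nonneg hC0 (Finset.sum_nonneg fun n _ =>
    intervalIntegral.integral_nonneg hL.le fun y _ => by positivity))).1 hmain
  rw [div_le_iff₀ (by positivity)] at h2
  rw [K₂_eq L hL, ← hκ, ← hC]
  linarith

end LowPass

/-! ### Eigenfunctions and the quadratic form -/

section Eigenfunctions

variable {M : ℕ} {L : ℝ} {a : ℝ → ℝ} {V : ℝ → Matrix (Fin M) (Fin M) ℂ}

/-- `u` is an eigenfunction of `(i d/dx - a)² - V` with eigenvalue `E` and magnetic derivative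
`v`; the functions are representatives, with `u'` and `v'` their a.e. derivatives. -/
structure IsEigenfunction (L : ℝ) (a : ℝ → ℝ) (V : ℝ → Matrix (Fin M) (Fin M) ℂ) (E : ℝ)
    (u u' v v' : ℝ → EuclideanSpace ℂ (Fin M)) : Prop where
  left : IsPeriodicAC L u u'
  right : IsPeriodicAC L v v'
  deriv_eq : ∀ᵐ x ∂(volume.restrict (Ioc 0 L)), v x = magDeriv a u u' x
  eigen : ∀ᵐ x ∂(volume.restrict (Ioc 0 L)),
    (E : ℂ) • u x = magDeriv a v v' x - Matrix.toEuclideanLin (V x) (u x)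

theorem exists_isEigenfunction {E : ℝ} {ψ : L2 L M} (h : ψ ∈ eigenspace L a V E) :
    ∃ u u' v v', (∀ᵐ x ∂(volume.restrict (Ioc 0 L)), ψ x = u x) ∧
      IsEigenfunction L a V E u u' v v' := by
  obtain ⟨u, u', v, v', hu, hv, h1, h2, h3⟩ := h
  refine ⟨u, u', v, v', h1, hu, hv, h2, ?_⟩
  filter_upwards [h1, h3, Lp.coeFn_smul (E : ℂ) ψ] with x h1 h3 h4
  rw [← h3, ← h1]
  exact h4.symm

theorem isPrimitive_inner_inner (hL : 0 ≤ L) {u u' v v' : ℝ → EuclideanSpace ℂ (Fin M)}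
    (hu : IsPrimitive 0 L u u') (hv : IsPrimitive 0 L v v') :
    IsPrimitive 0 L (fun x => inner ℂ (u x) (v x))
      (fun x => inner ℂ (u' x) (v x) + inner ℂ (u x) (v' x)) := by
  have hc : ∀ {w w' : ℝ → EuclideanSpace ℂ (Fin M)}, IsPrimitive 0 L w w' →
      ∀ i, IsPrimitive 0 L (fun y => w y i) (fun y => w' y i) := fun hw i =>
    hw.clm_comp ((EuclideanSpace.proj (𝕜 := ℂ) i).restrictScalars ℝ)
  have h := IsPrimitive.sum Finset.univ fun i _ => (hc hv i).mul hL (hc hu i).conj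
  convert h using 2 with x x
  · simp only [PiLp.inner_apply, RCLike.inner_apply]
    rfl
  · simp only [PiLp.inner_apply, RCLike.inner_apply, ← Finset.sum_add_distrib]
    rfl

theorem inner_magDeriv_sub (u u' v v' : ℝ → EuclideanSpace ℂ (Fin M)) (x : ℝ) :
    inner ℂ (magDeriv a u u' x) (v x) - inner ℂ (u x) (magDeriv a v v' x) =
      -Complex.I * (inner ℂ (u' x) (v x) + inner ℂ (u x) (v' x)) := by
  simp only [magDeriv, inner_sub_left, inner_sub_right, inner_smul_left, inner_smul_right,
    Complex.conj_I, Complex.conj_ofReal]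
  ring

/-- The magnetic derivative is symmetric on periodic absolutely continuous functions. -/
theorem integral_inner_magDeriv (hL : 0 < L) {u u' v v' w : ℝ → EuclideanSpace ℂ (Fin M)}
    (hu : IsPeriodicAC L u u') (hv : IsPeriodicAC L v v')
    (hw : MemLp w 2 (volume.restrict (Ioc 0 L)))
    (hwv : ∀ᵐ x ∂(volume.restrict (Ioc 0 L)), w x = magDeriv a v v' x) :
    IntervalIntegrable (fun x => inner ℂ (magDeriv a u u' x) (v x)) volume 0 L ∧
      ∫ x in (0 : ℝ)..L, inner ℂ (magDeriv a u u' x) (v x) =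
        ∫ x in (0 : ℝ)..L, inner ℂ (u x) (w x) := by
  have hp := isPrimitive_inner_inner hL.le hu.isPrimitive hv.isPrimitive
  have hi := intervalIntegrable_inner hL.le (hu.isPrimitive.memLp hL.le 2) hw
  have hI := hp.integral_eq_sub hL.le
  rw [hu.periodic, hv.periodic, sub_self] at hI
  have hae : ∀ᵐ x ∂(volume.restrict (Ioc 0 L)), inner ℂ (magDeriv a u u' x) (v x) =
      inner ℂ (u x) (w x) + -Complex.I * (inner ℂ (u' x) (v x) + inner ℂ (u x) (v' x)) := by
    filter_upwards [hwv] with x hx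
    rw [hx, ← inner_magDeriv_sub]
    ring
  have hii := hi.add (hp.integrable.const_mul (-Complex.I))
  rw [← uIoc_of_le hL.le] at hae
  refine ⟨hii.congr_ae (hae.mono fun x hx => hx.symm), ?_⟩
  rw [intervalIntegral.integral_congr_ae_restrict hae,
    intervalIntegral.integral_add hi (hp.integrable.const_mul _),
    intervalIntegral.integral_const_mul, hI, mul_zero, add_zero]

namespace IsEigenfunction

variable {E E₁ E₂ : ℝ} {u u' v v' u₁ u₁' v₁ v₁' u₂ u₂' v₂ v₂' : ℝ → EuclideanSpace ℂ (Fin M)}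

theorem memLp_left (h : IsEigenfunction L a V E u u' v v') (hL : 0 < L) :
    MemLp u 2 (volume.restrict (Ioc 0 L)) := h.left.isPrimitive.memLp hL.le 2

theorem memLp_right (h : IsEigenfunction L a V E u u' v v') (hL : 0 < L) :
    MemLp v 2 (volume.restrict (Ioc 0 L)) := h.right.isPrimitive.memLp hL.le 2

/-- The quadratic form of `V` on eigenfunctions, including its integrability: it follows from the
eigenvalue equation, no integrability of `V` itself being available. -/
theorem integral_inner_potential (hL : 0 < L) (h₁ : IsEigenfunction L a V E₁ u₁ u₁' v₁ v₁')
    (h₂ : IsEigenfunction L a V E₂ u₂ u₂' v₂ v₂') :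
    IntervalIntegrable (fun x => inner ℂ (Matrix.toEuclideanLin (V x) (u₁ x)) (u₂ x)) volume 0 L ∧
      ∫ x in (0 : ℝ)..L, inner ℂ (Matrix.toEuclideanLin (V x) (u₁ x)) (u₂ x) =
        (∫ x in (0 : ℝ)..L, inner ℂ (v₁ x) (v₂ x)) -
          E₁ * ∫ x in (0 : ℝ)..L, inner ℂ (u₁ x) (u₂ x) := by
  obtain ⟨i1, e1⟩ := integral_inner_magDeriv hL h₁.right h₂.left (h₂.memLp_right hL) h₂.deriv_eq
  have i2 := (intervalIntegrable_inner hL.le (h₁.memLp_left hL) (h₂.memLp_left hL)).const_mul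
    (E₁ : ℂ)
  have hae : ∀ᵐ x ∂(volume.restrict (uIoc 0 L)),
      inner ℂ (Matrix.toEuclideanLin (V x) (u₁ x)) (u₂ x) =
        inner ℂ (magDeriv a v₁ v₁' x) (u₂ x) - E₁ * inner ℂ (u₁ x) (u₂ x) := by
    rw [uIoc_of_le hL.le]
    filter_upwards [h₁.eigen] with x hx
    have h : Matrix.toEuclideanLin (V x) (u₁ x) = magDeriv a v₁ v₁' x - (E₁ : ℂ) • u₁ x := by
      rw [hx]
      abel
    rw [h, inner_sub_left, inner_smul_left, Complex.conj_ofReal]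
  refine ⟨(i1.sub i2).congr_ae (hae.mono fun x hx => hx.symm), ?_⟩
  rw [intervalIntegral.integral_congr_ae_restrict hae, intervalIntegral.integral_sub i1 i2, e1,
    intervalIntegral.integral_const_mul]

theorem integral_inner_conj (f g : ℝ → EuclideanSpace ℂ (Fin M)) :
    ∫ x in (0 : ℝ)..L, inner ℂ (g x) (f x) = star (∫ x in (0 : ℝ)..L, inner ℂ (f x) (g x)) := by
  rw [Complex.star_def]
  simp only [intervalIntegral, map_sub, ← integral_conj, inner_conj_symm]

/-- Eigenfunctions with different eigenvalues are orthogonal, by comparing the quadratic form of `V`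
evaluated from either side. -/
theorem integral_inner_eq_zero (hL : 0 < L)
    (hV : ∀ᵐ x ∂(volume.restrict (Ioc 0 L)), (V x).IsHermitian)
    (h₁ : IsEigenfunction L a V E₁ u₁ u₁' v₁ v₁') (h₂ : IsEigenfunction L a V E₂ u₂ u₂' v₂ v₂')
    (hne : E₁ ≠ E₂) : ∫ x in (0 : ℝ)..L, inner ℂ (u₁ x) (u₂ x) = 0 := by
  obtain ⟨-, e1⟩ := integral_inner_potential hL h₁ h₂
  obtain ⟨-, e2⟩ := integral_inner_potential hL h₂ h₁
  have e3 := congrArg star e2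
  rw [star_sub, star_mul', ← integral_inner_conj, ← integral_inner_conj, ← integral_inner_conj,
    Complex.star_def, Complex.conj_ofReal] at e3
  have hsym : ∫ x in (0 : ℝ)..L, inner ℂ (Matrix.toEuclideanLin (V x) (u₁ x)) (u₂ x) =
      ∫ x in (0 : ℝ)..L, inner ℂ (u₁ x) (Matrix.toEuclideanLin (V x) (u₂ x)) := by
    refine intervalIntegral.integral_congr_ae_restrict ?_
    rw [uIoc_of_le hL.le]
    filter_upwards [hV] with x hx
    exact inner_toEuclideanLin_comm hx _ _
  rw [e1, e3] at hsym
  have h : ((E₁ : ℂ) - E₂) * ∫ x in (0 : ℝ)..L, inner ℂ (u₁ x) (u₂ x) = 0 := by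
    linear_combination -hsym
  refine (mul_eq_zero.1 h).resolve_left ?_
  rw [sub_eq_zero]
  exact_mod_cast hne

end IsEigenfunction

/-- The right-hand side ignores the negative part of `f` and does not require it to vanish. -/
theorem ofReal_integral_le_lintegral {X : Type*} [MeasurableSpace X] {μ : Measure X} {f : X → ℝ}
    (hf : Integrable f μ) : ENNReal.ofReal (∫ x, f x ∂μ) ≤ ∫⁻ x, ENNReal.ofReal (f x) ∂μ := by
  rw [integral_eq_lintegral_pos_part_sub_lintegral_neg_part hf]
  refine (ENNReal.ofReal_le_ofReal (sub_le_self _ ENNReal.toReal_nonneg)).trans ?_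
  exact ENNReal.ofReal_toReal_le

/-- `Tr (A - τ)₊^{3/2}`. -/
noncomputable def tracePosPart (A : Matrix (Fin M) (Fin M) ℂ) (τ : ℝ) : ℝ :=
  (Matrix.trace (cfc (fun t : ℝ => max (t - τ) 0 ^ (3 / 2 : ℝ)) A)).re

/-- Duality: the inequality for orthonormal systems bounds the sum of `λₙ - τ` over an orthonormal
family of eigenfunctions with eigenvalues `-λₙ`. -/
theorem sum_sub_le_lintegral {α K : ℝ} (hK : IsAdmissible α K) (hK0 : 0 < K) (hL : 0 < L)
    (ha : IntervalIntegrable a volume 0 L) (hflux : flux L a = α)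
    (hV : ∀ᵐ x ∂(volume.restrict (Ioc 0 L)), (V x).IsHermitian) {N : ℕ} {l : Fin N → ℝ}
    {u u' v v' : Fin N → ℝ → EuclideanSpace ℂ (Fin M)}
    (h : ∀ n, IsEigenfunction L a V (-(l n)) (u n) (u' n) (v n) (v' n))
    (ho : ∀ n m, ∫ x in (0 : ℝ)..L, inner ℂ (u n x) (u m x) = if n = m then 1 else 0) (τ : ℝ) :
    ENNReal.ofReal (∑ n, (l n - τ)) ≤ ENNReal.ofReal (2 / (3 * √3) * √K) *
      ∫⁻ x in Ioc 0 L, ENNReal.ofReal (tracePosPart (V x) τ) := by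
  have hmag : ∀ n, MemLp (magDeriv a (u n) (u' n)) 2 (volume.restrict (Ioc 0 L)) := fun n =>
    ((h n).memLp_right hL).ae_eq (h n).deriv_eq
  have hadm := hK.2 L a hL ha hflux M N u u' (fun n => (h n).left) hmag ho
  have hnormv : ∀ n, ∫ x in (0 : ℝ)..L, ‖magDeriv a (u n) (u' n) x‖ ^ 2 =
      ∫ x in (0 : ℝ)..L, ‖v n x‖ ^ 2 := fun n => by
    refine intervalIntegral.integral_congr_ae_restrict ?_
    rw [uIoc_of_le hL.le]
    filter_upwards [(h n).deriv_eq] with x hx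
    rw [hx]
  simp only [hnormv] at hadm
  have hre : ∀ f : ℝ → EuclideanSpace ℂ (Fin M), MemLp f 2 (volume.restrict (Ioc 0 L)) →
      (∫ x in (0 : ℝ)..L, inner ℂ (f x) (f x)).re = ∫ x in (0 : ℝ)..L, ‖f x‖ ^ 2 := fun f hf => by
    have h2 := Complex.reCLM.intervalIntegral_comp_comm (intervalIntegrable_inner hL.le hf hf)
    simp only [Complex.reCLM_apply] at h2
    rw [← h2]
    exact intervalIntegral.integral_congr fun x _ => inner_self_eq_norm_sq (𝕜 := ℂ) _
  have hu1 : ∀ n, ∫ x in (0 : ℝ)..L, ‖u n x‖ ^ 2 = 1 := fun n => by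
    rw [← hre _ ((h n).memLp_left hL), ho, if_pos rfl, Complex.one_re]
  -- the integrand of the quadratic form of `V - τ`
  have hq : ∀ n, IntervalIntegrable (fun x => (inner ℂ (u n x)
      (Matrix.toEuclideanLin (V x) (u n x))).re - τ * ‖u n x‖ ^ 2) volume 0 L ∧
      ∫ x in (0 : ℝ)..L, ((inner ℂ (u n x) (Matrix.toEuclideanLin (V x) (u n x))).re -
        τ * ‖u n x‖ ^ 2) = (∫ x in (0 : ℝ)..L, ‖v n x‖ ^ 2) + l n - τ := fun n => by
    obtain ⟨i1, e1⟩ := IsEigenfunction.integral_inner_potential hL (h n) (h n)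
    have hr : ∀ x, (inner ℂ (u n x) (Matrix.toEuclideanLin (V x) (u n x))).re =
        (inner ℂ (Matrix.toEuclideanLin (V x) (u n x)) (u n x)).re := fun x =>
      inner_re_symm (𝕜 := ℂ) _ _
    simp only [hr]
    have i2 : IntervalIntegrable
        (fun x => (inner ℂ (Matrix.toEuclideanLin (V x) (u n x)) (u n x)).re) volume 0 L :=
      ⟨i1.1.re, i1.2.re⟩
    have i3 := (MemLp.intervalIntegrable_norm_sq hL.le ((h n).memLp_left hL)).const_mul τ
    refine ⟨i2.sub i3, ?_⟩
    have h2 := Complex.reCLM.intervalIntegral_comp_comm i1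
    simp only [Complex.reCLM_apply] at h2
    rw [intervalIntegral.integral_sub i2 i3, h2, e1, intervalIntegral.integral_const_mul, hu1,
      ho, if_pos rfl, Complex.sub_re, hre _ ((h n).memLp_right hL)]
    simp
  have hqs : IntervalIntegrable (fun x => ∑ n, ((inner ℂ (u n x)
      (Matrix.toEuclideanLin (V x) (u n x))).re - τ * ‖u n x‖ ^ 2)) volume 0 L := by
    have h := IntervalIntegrable.sum Finset.univ fun n _ => (hq n).1
    rwa [Finset.sum_fn] at h
  have hU : IntervalIntegrable (fun x => 1 / K * (Matrix.trace (densityMatrix u x ^ 3)).re)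
      volume 0 L := by
    refine IntervalIntegrable.const_mul (ContinuousOn.intervalIntegrable ?_) _
    rw [uIcc_of_le hL.le]
    exact continuousOn_trace_densityMatrix_pow
      (fun n => (h n).left.isPrimitive.continuousOn hL.le) 3
  have hle : ∑ n, (l n - τ) ≤ ∫ x in Ioc 0 L, (∑ n, ((inner ℂ (u n x)
      (Matrix.toEuclideanLin (V x) (u n x))).re - τ * ‖u n x‖ ^ 2) -
        1 / K * (Matrix.trace (densityMatrix u x ^ 3)).re) := by
    rw [← intervalIntegral.integral_of_le hL.le, intervalIntegral.integral_sub hqs hU,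
      intervalIntegral.integral_finsetSum fun n _ => (hq n).1,
      intervalIntegral.integral_const_mul, Finset.sum_congr rfl fun n _ => (hq n).2]
    have h3 : 1 / K * ∫ x in (0 : ℝ)..L, (Matrix.trace (densityMatrix u x ^ 3)).re ≤
        ∑ n, ∫ x in (0 : ℝ)..L, ‖v n x‖ ^ 2 := by
      rw [one_div, inv_mul_le_iff₀ hK0]
      exact hadm
    simp only [add_sub_assoc, Finset.sum_add_distrib] at h3 ⊢
    linarith
  refine (ENNReal.ofReal_le_ofReal hle).trans ((ofReal_integral_le_lintegral
    ((intervalIntegrable_iff_integrableOn_Ioc_of_le hL.le).1 (hqs.sub hU))).trans ?_)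
  rw [← lintegral_const_mul' _ _ ENNReal.ofReal_ne_top]
  refine lintegral_mono_ae ?_
  filter_upwards [hV] with x hx
  rw [← ENNReal.ofReal_mul (by positivity)]
  refine ENNReal.ofReal_le_ofReal ?_
  have := sum_inner_le_trace hx hK0 τ u x
  rw [tracePosPart]
  linarith

/-- The previous bound for the positive parts: only the eigenfunctions with `λ > τ` are used. -/
theorem sum_max_sub_le_lintegral {α K : ℝ} (hK : IsAdmissible α K) (hK0 : 0 < K) (hL : 0 < L)
    (ha : IntervalIntegrable a volume 0 L) (hflux : flux L a = α)
    (hV : ∀ᵐ x ∂(volume.restrict (Ioc 0 L)), (V x).IsHermitian) {ι : Type*} [Fintype ι]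
    {l : ι → ℝ} {u u' v v' : ι → ℝ → EuclideanSpace ℂ (Fin M)}
    (h : ∀ n, IsEigenfunction L a V (-(l n)) (u n) (u' n) (v n) (v' n))
    (ho : ∀ n m, n ≠ m → ∫ x in (0 : ℝ)..L, inner ℂ (u n x) (u m x) = 0)
    (ho1 : ∀ n, ∫ x in (0 : ℝ)..L, inner ℂ (u n x) (u n x) = 1) (τ : ℝ) :
    ENNReal.ofReal (∑ n, max (l n - τ) 0) ≤ ENNReal.ofReal (2 / (3 * √3) * √K) *
      ∫⁻ x in Ioc 0 L, ENNReal.ofReal (tracePosPart (V x) τ) := by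
  classical
  set e := (Fintype.equivFin {n // τ < l n}).symm
  have hs : ∑ n, max (l n - τ) 0 = ∑ j, (l (e j) - τ) := by
    rw [e.sum_comp fun n : {n // τ < l n} => l n - τ,
      ← Finset.sum_subtype (Finset.univ.filter fun n => τ < l n) (by simp) fun n => l n - τ,
      Finset.sum_filter]
    refine Finset.sum_congr rfl fun n _ => ?_
    split_ifs with hn
    · exact max_eq_left (sub_pos.2 hn).le
    · exact max_eq_right (sub_nonpos.2 (not_lt.1 hn))
  rw [hs]
  refine sum_sub_le_lintegral hK hK0 hL ha hflux hV (fun j => h (e j)) (fun i j => ?_) τ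
  split_ifs with hij
  · rw [hij, ho1]
  · exact ho _ _ fun h => hij (e.injective (Subtype.ext h))

end Eigenfunctions

/-! ### Lifting the moments: the Aizenman–Lieb argument -/

section Moments

variable {M : ℕ} {γ : ℝ}

/-- `∫₀^∞ γ(γ-1) τ^{γ-2} (s-τ)₊ dτ = s₊^γ`. -/
theorem lintegral_rpow_mul_max_sub (hγ : 1 < γ) (s : ℝ) :
    ∫⁻ τ in Ioi (0 : ℝ), ENNReal.ofReal (γ * (γ - 1) * τ ^ (γ - 2)) *
      ENNReal.ofReal (max (s - τ) 0) = ENNReal.ofReal (max s 0 ^ γ) := by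
  have hγ1 : 0 < γ - 1 := by linarith
  have hγ0 : 0 < γ := by linarith
  rcases le_or_gt s 0 with hs | hs
  · rw [max_eq_right hs, Real.zero_rpow hγ0.ne', ENNReal.ofReal_zero]
    refine (setLIntegral_congr_fun measurableSet_Ioi fun τ hτ => ?_).trans lintegral_zero
    have hτ0 : (0 : ℝ) < τ := hτ
    rw [max_eq_right (by linarith), ENNReal.ofReal_zero, mul_zero]
  · have hsub : Ioc 0 s ⊆ Ioi (0 : ℝ) := Ioc_subset_Ioi_self
    have hii : IntervalIntegrable (fun τ : ℝ => γ * (γ - 1) * τ ^ (γ - 2) * (s - τ)) volume 0 s :=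
      ((intervalIntegral.intervalIntegrable_rpow' (by linarith)).const_mul _).mul_continuousOn
        (by fun_prop)
    have hval : ∫ τ in (0 : ℝ)..s, γ * (γ - 1) * τ ^ (γ - 2) * (s - τ) = s ^ γ := by
      have hd : ∀ τ ∈ Ioo 0 s, HasDerivAt
          (fun τ : ℝ => γ * s * τ ^ (γ - 1) - (γ - 1) * τ ^ γ)
          (γ * (γ - 1) * τ ^ (γ - 2) * (s - τ)) τ := fun τ hτ => by
        have hτ0 : 0 < τ := hτ.1
        have h := ((Real.hasDerivAt_rpow_const (p := γ - 1) (Or.inl hτ0.ne')).const_mul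
          (γ * s)).sub ((Real.hasDerivAt_rpow_const (p := γ) (Or.inl hτ0.ne')).const_mul (γ - 1))
        refine h.congr_deriv ?_
        have e : τ ^ (γ - 1) = τ ^ (γ - 2) * τ := by
          rw [← Real.rpow_add_one hτ0.ne']
          congr 1
          ring
        rw [e, show γ - 1 - 1 = γ - 2 by ring]
        ring
      have hc : ContinuousOn (fun τ : ℝ => γ * s * τ ^ (γ - 1) - (γ - 1) * τ ^ γ) (Icc 0 s) :=
        ((continuous_const.mul (Real.continuous_rpow_const hγ1.le)).sub
          (continuous_const.mul (Real.continuous_rpow_const hγ0.le))).continuousOn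
      rw [intervalIntegral.integral_eq_sub_of_hasDerivAt_of_le hs.le hc hd hii,
        Real.zero_rpow hγ1.ne', Real.zero_rpow hγ0.ne', Real.rpow_sub_one hs.ne']
      field_simp
      ring
    have hIoc : ∫⁻ τ in Ioi (0 : ℝ), ENNReal.ofReal (γ * (γ - 1) * τ ^ (γ - 2)) *
        ENNReal.ofReal (max (s - τ) 0) = ∫⁻ τ in Ioc 0 s,
          ENNReal.ofReal (γ * (γ - 1) * τ ^ (γ - 2) * (s - τ)) := by
      rw [← Ioc_union_Ioi_eq_Ioi hs.le, lintegral_union measurableSet_Ioi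
        (Ioc_disjoint_Ioi le_rfl)]
      have h0 : ∫⁻ τ in Ioi s, ENNReal.ofReal (γ * (γ - 1) * τ ^ (γ - 2)) *
          ENNReal.ofReal (max (s - τ) 0) = 0 := by
        refine (setLIntegral_congr_fun measurableSet_Ioi fun τ hτ => ?_).trans lintegral_zero
        have hτ0 : s < τ := hτ
        rw [max_eq_right (by linarith), ENNReal.ofReal_zero, mul_zero]
      rw [h0, add_zero]
      refine setLIntegral_congr_fun measurableSet_Ioc fun τ hτ => ?_
      have hτ0 : 0 < τ := hτ.1
      rw [max_eq_left (sub_nonneg.2 hτ.2), ← ENNReal.ofReal_mul (by positivity)]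
    rw [hIoc, max_eq_left hs.le, ← hval, intervalIntegral.integral_of_le hs.le,
      ofReal_integral_eq_lintegral_ofReal
        ((intervalIntegrable_iff_integrableOn_Ioc_of_le hs.le).1 hii)]
    refine (ae_restrict_iff' measurableSet_Ioc).2 (ae_of_all _ fun τ hτ => ?_)
    have hτ0 : 0 < τ := hτ.1
    have := sub_nonneg.2 hτ.2
    simp only [Pi.zero_apply]
    positivity

theorem continuous_max_sub_sq_rpow (hγ : 0 ≤ γ) (s : ℝ) :
    Continuous fun ξ : ℝ => max (s - ξ ^ 2) 0 ^ γ :=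
  (Real.continuous_rpow_const hγ).comp (by fun_prop)

theorem integrable_max_sub_sq_rpow (hγ : 0 < γ) (s : ℝ) :
    Integrable fun ξ : ℝ => max (s - ξ ^ 2) 0 ^ γ := by
  refine (continuous_max_sub_sq_rpow hγ.le s).integrable_of_hasCompactSupport ?_
  refine HasCompactSupport.intro (isCompact_Icc (a := -√(max s 0)) (b := √(max s 0))) fun ξ hξ => ?_
  have h : s - ξ ^ 2 ≤ 0 := by
    by_contra hc
    push Not at hc
    refine hξ (abs_le.1 (Real.abs_le_sqrt ?_))
    exact (by linarith : ξ ^ 2 ≤ s).trans (le_max_left _ _)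
  rw [max_eq_right h, Real.zero_rpow hγ.ne']

/-- Scaling `ξ = √s η` in the integral defining `Lcl`. -/
theorem lintegral_max_sub_sq_rpow (hγ : 0 < γ) {s : ℝ} (hs : 0 ≤ s) :
    ∫⁻ ξ : ℝ, ENNReal.ofReal (max (s - ξ ^ 2) 0 ^ γ) =
      ENNReal.ofReal (2 * Real.pi * Lcl γ * s ^ (γ + 1 / 2)) := by
  rw [← ofReal_integral_eq_lintegral_ofReal (integrable_max_sub_sq_rpow hγ s)
    (ae_of_all _ fun ξ => by simp only [Pi.zero_apply]; positivity)]
  congr 1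
  have hpi := Real.pi_pos
  rcases hs.eq_or_lt with h | h
  · have h0 : ∀ ξ : ℝ, max (s - ξ ^ 2) 0 ^ γ = 0 := fun ξ => by
      rw [← h, max_eq_right (by nlinarith [sq_nonneg ξ]), Real.zero_rpow hγ.ne']
    simp only [h0, integral_zero]
    rw [← h, Real.zero_rpow (by positivity), mul_zero]
  · have e : ∀ ξ : ℝ, max (s - ξ ^ 2) 0 ^ γ = s ^ γ * max (1 - (ξ / √s) ^ 2) 0 ^ γ := fun ξ => by
      rw [← Real.mul_rpow hs (le_max_right _ _), mul_max_of_nonneg _ _ hs, mul_zero, div_pow,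
        Real.sq_sqrt hs, mul_sub, mul_one, mul_div_cancel₀ _ h.ne']
    simp only [e]
    rw [integral_const_mul, Measure.integral_comp_div (fun η : ℝ => max (1 - η ^ 2) 0 ^ γ) (√s),
      abs_of_nonneg (Real.sqrt_nonneg s), smul_eq_mul, Real.rpow_add h, ← Real.sqrt_eq_rpow, Lcl]
    field_simp

theorem Lcl_one : Lcl 1 = 2 / (3 * Real.pi) := by
  have hpi := Real.pi_pos
  have h : ∫ ξ : ℝ, max (1 - ξ ^ 2) 0 ^ (1 : ℝ) = 4 / 3 := by
    have h1 : ∀ ξ : ℝ, max (1 - ξ ^ 2) 0 ^ (1 : ℝ) =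
        (Ioc (-1 : ℝ) 1).indicator (fun ξ => 1 - ξ ^ 2) ξ := fun ξ => by
      rw [Real.rpow_one]
      by_cases hξ : ξ ∈ Ioc (-1 : ℝ) 1
      · rw [indicator_of_mem hξ]
        exact max_eq_left (by nlinarith [hξ.1, hξ.2])
      · rw [indicator_of_notMem hξ]
        refine max_eq_right ?_
        rw [mem_Ioc, not_and_or, not_lt, not_le] at hξ
        rcases hξ with h | h <;> nlinarith
    simp only [h1]
    rw [integral_indicator measurableSet_Ioc, ← intervalIntegral.integral_of_le (by norm_num),
      intervalIntegral.integral_sub (by simp) (by simp)]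
    norm_num [integral_pow]
  rw [Lcl, h]
  field_simp
  norm_num

theorem Lcl_nonneg (γ : ℝ) : 0 ≤ Lcl γ := by
  have hpi := Real.pi_pos
  exact mul_nonneg (by positivity) (integral_nonneg fun ξ => by positivity)

theorem max_sub_max_sub (s τ ξ : ℝ) : max (max (s - τ) 0 - ξ ^ 2) 0 = max (s - ξ ^ 2 - τ) 0 := by
  have := sq_nonneg ξ
  rcases le_total (s - τ) 0 with h | h
  · rw [max_eq_right h, max_eq_right (by linarith), max_eq_right (by linarith)]
  · rw [max_eq_left h]
    congr 1
    ring

/-- The semiclassical constants satisfy the same lifting relation as the moments: both sides are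
`∫∫ γ(γ-1) τ^{γ-2} (s - ξ² - τ)₊ dξ dτ`. -/
theorem lintegral_rpow_mul_max_sub_rpow (hγ : 1 < γ) {s : ℝ} (hs : 0 ≤ s) :
    ∫⁻ τ in Ioi (0 : ℝ), ENNReal.ofReal (γ * (γ - 1) * τ ^ (γ - 2)) *
      ENNReal.ofReal (max (s - τ) 0 ^ (3 / 2 : ℝ)) =
        ENNReal.ofReal (Lcl γ / Lcl 1 * s ^ (γ + 1 / 2)) := by
  have hpi := Real.pi_pos
  have hL1 : 0 < Lcl 1 := by rw [Lcl_one]; positivity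
  have hc0 : ENNReal.ofReal (2 * Real.pi * Lcl 1) ≠ 0 := by
    simp only [ne_eq, ENNReal.ofReal_eq_zero, not_le]
    positivity
  have hw : Measurable fun τ : ℝ => ENNReal.ofReal (γ * (γ - 1) * τ ^ (γ - 2)) :=
    ((measurable_id.pow_const _).const_mul _).ennreal_ofReal
  have key : ENNReal.ofReal (2 * Real.pi * Lcl 1) * ∫⁻ τ in Ioi (0 : ℝ),
      ENNReal.ofReal (γ * (γ - 1) * τ ^ (γ - 2)) *
        ENNReal.ofReal (max (s - τ) 0 ^ (3 / 2 : ℝ)) =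
      ENNReal.ofReal (2 * Real.pi * Lcl 1) *
        ENNReal.ofReal (Lcl γ / Lcl 1 * s ^ (γ + 1 / 2)) := by
    rw [← ENNReal.ofReal_mul (by positivity), ← lintegral_const_mul' _ _ ENNReal.ofReal_ne_top]
    have h1 : ∀ τ : ℝ, ENNReal.ofReal (2 * Real.pi * Lcl 1) *
        (ENNReal.ofReal (γ * (γ - 1) * τ ^ (γ - 2)) *
          ENNReal.ofReal (max (s - τ) 0 ^ (3 / 2 : ℝ))) =
        ∫⁻ ξ : ℝ, ENNReal.ofReal (γ * (γ - 1) * τ ^ (γ - 2)) *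
          ENNReal.ofReal (max (s - ξ ^ 2 - τ) 0) := fun τ => by
      have h := lintegral_max_sub_sq_rpow one_pos (le_max_right (s - τ) 0)
      simp only [Real.rpow_one, max_sub_max_sub] at h
      rw [lintegral_const_mul' _ _ ENNReal.ofReal_ne_top, h, mul_left_comm,
        ← ENNReal.ofReal_mul (by positivity)]
      norm_num
    simp only [h1]
    rw [lintegral_lintegral_swap]
    · simp only [lintegral_rpow_mul_max_sub hγ]
      rw [lintegral_max_sub_sq_rpow (by linarith) hs]
      congr 1
      field_simp
    · refine ((hw.comp measurable_fst).mul (Measurable.ennreal_ofReal ?_)).aemeasurable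
      exact Continuous.measurable (by fun_prop)
  exact (ENNReal.mul_right_inj hc0 ENNReal.ofReal_ne_top).1 key

/-- On Hermitian matrices the continuous functional calculus depends continuously on the matrix. -/
theorem continuous_trace_cfc {f : ℝ → ℝ} (hf : Continuous f) :
    Continuous fun A : {A : Matrix (Fin M) (Fin M) ℂ // A.IsHermitian} =>
      (Matrix.trace (cfc f A.1)).re := by
  refine Complex.continuous_re.comp (Continuous.matrix_trace ?_)
  open scoped Matrix.Norms.L2Operator in
  exact Continuous.cfc_of_mem_nhdsSet (s := univ) f Filter.univ_mem continuous_subtype_val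
    (fun A => A.2) hf.continuousOn

/-- The Hermitian part of a matrix, given by its entries. It extends functions on Hermitian matrices to
all arrays of entries, on which a measurable structure is at hand. -/
noncomputable def hermitianPart (B : Fin M → Fin M → ℂ) :
    {A : Matrix (Fin M) (Fin M) ℂ // A.IsHermitian} :=
  ⟨Matrix.of fun i j => (1 / 2 : ℂ) * (B i j + star (B j i)), by
    ext i j
    simp [mul_add, add_comm]⟩

theorem continuous_hermitianPart : Continuous (hermitianPart (M := M)) := by
  refine Continuous.subtype_mk ?_ _
  refine continuous_matrix fun i j => ?_
  simp only [Matrix.of_apply]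
  fun_prop

theorem hermitianPart_eq {A : Matrix (Fin M) (Fin M) ℂ} (hA : A.IsHermitian) :
    (hermitianPart fun i j => A i j).1 = A := by
  ext i j
  have := hA.apply i j
  simp only [hermitianPart, Matrix.of_apply, this]
  ring

theorem tracePosPart_eq {A : Matrix (Fin M) (Fin M) ℂ} (hA : A.IsHermitian) (τ : ℝ) :
    tracePosPart A τ = ∑ j, max (hA.eigenvalues j - τ) 0 ^ (3 / 2 : ℝ) :=
  trace_cfc_re hA _

theorem continuous_max_sub_rpow (τ : ℝ) : Continuous fun t : ℝ => max (t - τ) 0 ^ (3 / 2 : ℝ) :=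
  (Real.continuous_rpow_const (by norm_num)).comp (by fun_prop)

theorem continuous_tracePosPart_hermitianPart (τ : ℝ) :
    Continuous fun B : Fin M → Fin M → ℂ => tracePosPart (hermitianPart B).1 τ :=
  (continuous_trace_cfc (continuous_max_sub_rpow τ)).comp continuous_hermitianPart

theorem continuous_tracePosPart {A : Matrix (Fin M) (Fin M) ℂ} (hA : A.IsHermitian) :
    Continuous (tracePosPart A) := by
  have e : tracePosPart A = fun τ => ∑ j, max (hA.eigenvalues j - τ) 0 ^ (3 / 2 : ℝ) :=
    funext fun τ => tracePosPart_eq hA τ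
  rw [e]
  refine continuous_finsetSum _ fun j _ => ?_
  exact (Real.continuous_rpow_const (by norm_num)).comp (by fun_prop)

theorem measurable_tracePosPart_hermitianPart {W : ℝ → Fin M → Fin M → ℂ} (hW : Measurable W) :
    Measurable fun p : ℝ × ℝ => tracePosPart (hermitianPart (W p.1)).1 p.2 := by
  have hmeas : ∀ τ, Measurable fun x => tracePosPart (hermitianPart (W x)).1 τ := fun τ =>
    Measurable.comp (g := fun B : Fin M → Fin M → ℂ => tracePosPart (hermitianPart B).1 τ)
      (continuous_tracePosPart_hermitianPart τ).measurable hW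
  have h := (measurable_uncurry_of_continuous_of_measurable
    (u := fun τ x => tracePosPart (hermitianPart (W x)).1 τ)
    (fun x => continuous_tracePosPart (hermitianPart (W x)).2) hmeas).comp measurable_swap
  simpa only [Function.comp_def, Function.uncurry_def, Prod.fst_swap, Prod.snd_swap] using h

/-- Joint measurability of `(x, τ) ↦ Tr (V(x) - τ)₊^{3/2}`: it is continuous in `τ`, and measurable
in `x` by continuity of the functional calculus. -/
theorem aemeasurable_tracePosPart {μ ν : Measure ℝ} [SFinite μ] [SFinite ν]
    {V : ℝ → Matrix (Fin M) (Fin M) ℂ}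
    (hVm : ∀ i j, AEMeasurable (fun x => V x i j) μ) (hV : ∀ᵐ x ∂μ, (V x).IsHermitian) :
    AEMeasurable (fun p : ℝ × ℝ => tracePosPart (V p.1) p.2) (μ.prod ν) := by
  obtain ⟨W, hW, hVW⟩ : ∃ W : ℝ → Fin M → Fin M → ℂ, Measurable W ∧
      ∀ᵐ x ∂μ, ∀ i j, V x i j = W x i j :=
    ⟨fun x i j => (hVm i j).mk _ x,
      measurable_pi_iff.2 fun i => measurable_pi_iff.2 fun j => (hVm i j).measurable_mk,
      ae_all_iff.2 fun i => ae_all_iff.2 fun j => (hVm i j).ae_eq_mk⟩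
  refine ⟨_, measurable_tracePosPart_hermitianPart hW, ?_⟩
  have hae : ∀ᵐ x ∂μ, V x = (hermitianPart (W x)).1 := by
    filter_upwards [hVW, hV] with x h1 h2
    rw [← hermitianPart_eq h2]
    congr 3
    funext i j
    exact h1 i j
  filter_upwards [Measure.quasiMeasurePreserving_fst.ae hae] with p hp
  rw [hp]

theorem trPow_eq {A : Matrix (Fin M) (Fin M) ℂ} (hA : A.IsHermitian) (p : ℝ) :
    trPow A p = ∑ j, hA.eigenvalues j ^ p :=
  trace_cfc_re hA _

theorem trPow_nonneg {A : Matrix (Fin M) (Fin M) ℂ} (hA : A.PosSemidef) (p : ℝ) :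
    0 ≤ trPow A p := by
  rw [trPow_eq hA.1]
  exact Finset.sum_nonneg fun j _ => Real.rpow_nonneg (hA.eigenvalues_nonneg j) p

theorem tracePosPart_zero {A : Matrix (Fin M) (Fin M) ℂ} (hA : A.PosSemidef) :
    tracePosPart A 0 = trPow A (3 / 2) := by
  rw [tracePosPart_eq hA.1, trPow_eq hA.1]
  refine Finset.sum_congr rfl fun j _ => ?_
  rw [sub_zero, max_eq_left (hA.eigenvalues_nonneg j)]

theorem lintegral_rpow_mul_tracePosPart (hγ : 1 < γ) {A : Matrix (Fin M) (Fin M) ℂ}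
    (hA : A.PosSemidef) :
    ∫⁻ τ in Ioi (0 : ℝ), ENNReal.ofReal (γ * (γ - 1) * τ ^ (γ - 2)) *
      ENNReal.ofReal (tracePosPart A τ) =
        ENNReal.ofReal (Lcl γ / Lcl 1 * trPow A (γ + 1 / 2)) := by
  have hL1 : 0 < Lcl 1 := by rw [Lcl_one]; have := Real.pi_pos; positivity
  have h1 : ∀ τ : ℝ, ENNReal.ofReal (γ * (γ - 1) * τ ^ (γ - 2)) *
      ENNReal.ofReal (tracePosPart A τ) =
      ∑ j, ENNReal.ofReal (γ * (γ - 1) * τ ^ (γ - 2)) *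
        ENNReal.ofReal (max (hA.1.eigenvalues j - τ) 0 ^ (3 / 2 : ℝ)) := fun τ => by
    rw [tracePosPart_eq hA.1, ENNReal.ofReal_sum_of_nonneg (fun j _ => by positivity),
      Finset.mul_sum]
  simp only [h1]
  rw [lintegral_finsetSum]
  · rw [trPow_eq hA.1, Finset.mul_sum, ENNReal.ofReal_sum_of_nonneg]
    · exact Finset.sum_congr rfl fun j _ =>
        lintegral_rpow_mul_max_sub_rpow hγ (hA.eigenvalues_nonneg j)
    · intro j _
      exact mul_nonneg (div_nonneg (Lcl_nonneg γ) hL1.le)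
        (Real.rpow_nonneg (hA.eigenvalues_nonneg j) _)
  · intro j _
    refine Measurable.mul ((measurable_id.pow_const _).const_mul _).ennreal_ofReal ?_
    exact Measurable.ennreal_ofReal
      ((Real.continuous_rpow_const (by norm_num)).comp (by fun_prop)).measurable

end Moments

/-! ### The Riesz means -/

section RieszMean

variable {M : ℕ} {L α γ K : ℝ} {a : ℝ → ℝ} {V : ℝ → Matrix (Fin M) (Fin M) ℂ}

/-- Moment bound for a finite orthonormal family of eigenfunctions: for `γ > 1` the bound for
`∑ (λₙ - τ)₊` is integrated against `γ(γ-1) τ^{γ-2} dτ`. -/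
theorem sum_rpow_le_lintegral (hK : IsAdmissible α K) (hK0 : 0 < K) (hγ : 1 ≤ γ) (hL : 0 < L)
    (ha : IntervalIntegrable a volume 0 L) (hflux : flux L a = α)
    (hVm : ∀ i j, AEMeasurable (fun x => V x i j) (volume.restrict (Ioc 0 L)))
    (hV : ∀ᵐ x ∂(volume.restrict (Ioc 0 L)), (V x).PosSemidef) {ι : Type*} [Fintype ι]
    {l : ι → ℝ} {u u' v v' : ι → ℝ → EuclideanSpace ℂ (Fin M)} (hl : ∀ n, 0 ≤ l n)
    (h : ∀ n, IsEigenfunction L a V (-(l n)) (u n) (u' n) (v n) (v' n))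
    (ho : ∀ n m, n ≠ m → ∫ x in (0 : ℝ)..L, inner ℂ (u n x) (u m x) = 0)
    (ho1 : ∀ n, ∫ x in (0 : ℝ)..L, inner ℂ (u n x) (u n x) = 1) :
    ∑ n, ENNReal.ofReal (l n ^ γ) ≤ ENNReal.ofReal (2 / (3 * √3) * √K) *
      ∫⁻ x in Ioc 0 L, ENNReal.ofReal (Lcl γ / Lcl 1 * trPow (V x) (γ + 1 / 2)) := by
  have hVh : ∀ᵐ x ∂(volume.restrict (Ioc 0 L)), (V x).IsHermitian := hV.mono fun x hx => hx.1
  have hL1 : 0 < Lcl 1 := by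
    have := Real.pi_pos
    rw [Lcl_one]
    positivity
  have hτ := sum_max_sub_le_lintegral hK hK0 hL ha hflux hVh h ho ho1
  rcases hγ.eq_or_lt with rfl | hγ
  · have h0 := hτ 0
    rw [ENNReal.ofReal_sum_of_nonneg fun n _ => le_max_right _ _] at h0
    refine le_trans (le_of_eq ?_) (h0.trans (le_of_eq ?_))
    · exact Finset.sum_congr rfl fun n _ => by rw [sub_zero, max_eq_left (hl n), Real.rpow_one]
    · congr 1
      refine lintegral_congr_ae ?_
      filter_upwards [hV] with x hx
      rw [tracePosPart_zero hx, div_self hL1.ne', one_mul]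
      norm_num
  · have hw : Measurable fun τ : ℝ => ENNReal.ofReal (γ * (γ - 1) * τ ^ (γ - 2)) :=
      ((measurable_id.pow_const _).const_mul _).ennreal_ofReal
    calc ∑ n, ENNReal.ofReal (l n ^ γ)
        = ∑ n, ∫⁻ τ in Ioi (0 : ℝ), ENNReal.ofReal (γ * (γ - 1) * τ ^ (γ - 2)) *
            ENNReal.ofReal (max (l n - τ) 0) := Finset.sum_congr rfl fun n _ => by
          rw [lintegral_rpow_mul_max_sub hγ, max_eq_left (hl n)]
      _ = ∫⁻ τ in Ioi (0 : ℝ), ENNReal.ofReal (γ * (γ - 1) * τ ^ (γ - 2)) *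
            ENNReal.ofReal (∑ n, max (l n - τ) 0) := by
          rw [← lintegral_finsetSum]
          · refine lintegral_congr fun τ => ?_
            rw [ENNReal.ofReal_sum_of_nonneg fun n _ => le_max_right _ _, Finset.mul_sum]
          · exact fun n _ => hw.mul (by fun_prop)
      _ ≤ ∫⁻ τ in Ioi (0 : ℝ), ENNReal.ofReal (2 / (3 * √3) * √K) *
            ∫⁻ x in Ioc 0 L, ENNReal.ofReal (γ * (γ - 1) * τ ^ (γ - 2)) *
              ENNReal.ofReal (tracePosPart (V x) τ) := by
          refine lintegral_mono fun τ => ?_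
          rw [lintegral_const_mul' _ _ ENNReal.ofReal_ne_top, mul_left_comm]
          exact mul_le_mul_right (hτ τ) _
      _ = ENNReal.ofReal (2 / (3 * √3) * √K) * ∫⁻ x in Ioc 0 L, ∫⁻ τ in Ioi (0 : ℝ),
            ENNReal.ofReal (γ * (γ - 1) * τ ^ (γ - 2)) *
              ENNReal.ofReal (tracePosPart (V x) τ) := by
          have hm : AEMeasurable (fun p : ℝ × ℝ => ENNReal.ofReal (γ * (γ - 1) * p.2 ^ (γ - 2)) *
              ENNReal.ofReal (tracePosPart (V p.1) p.2))
              ((volume.restrict (Ioc 0 L)).prod (volume.restrict (Ioi 0))) :=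
            (hw.comp measurable_snd).aemeasurable.mul
              (aemeasurable_tracePosPart hVm hVh).ennreal_ofReal
          rw [lintegral_const_mul' _ _ ENNReal.ofReal_ne_top, ← lintegral_lintegral_swap
            (f := fun x τ => ENNReal.ofReal (γ * (γ - 1) * τ ^ (γ - 2)) *
              ENNReal.ofReal (tracePosPart (V x) τ)) hm]
      _ = _ := by
          congr 1
          refine lintegral_congr_ae ?_
          filter_upwards [hV] with x hx
          exact lintegral_rpow_mul_tracePosPart hγ hx

theorem exists_orthonormal_of_le_rank {E : Type*} [NormedAddCommGroup E] [InnerProductSpace ℂ E]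
    (S : Submodule ℂ E) {m : ℕ} (hm : (m : ℕ∞) ≤ (Module.rank ℂ S).toENat) :
    ∃ e : Fin m → E, Orthonormal ℂ e ∧ ∀ i, e i ∈ S := by
  have hr : (m : Cardinal) ≤ Module.rank ℂ S := Cardinal.natCast_le_toENat.1 hm
  obtain ⟨f, hf⟩ := Module.le_rank_iff.1 hr
  exact ⟨_, (InnerProductSpace.gramSchmidtNormed_orthonormal hf).comp_linearIsometry S.subtypeₗᵢ,
    fun i => Subtype.property _⟩

theorem enat_eq_iSup (c : ℕ∞) : (c : ENNReal) = ⨆ n : ℕ, ((min c n).toNat : ENNReal) := by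
  induction c with
  | top => simp [ENNReal.iSup_natCast]
  | coe k =>
    refine le_antisymm (le_iSup_of_le k (by simp)) (iSup_le fun n => ?_)
    have : (min (k : ℕ∞) n).toNat ≤ k := ENat.toNat_le_of_le_natCast (min_le_left _ _)
    simpa using this

/-- A series with multiplicities in `[0,∞]` is bounded once all its finite partial sums with finite,
smaller multiplicities are. -/
theorem tsum_enat_mul_le {ι : Type*} {c : ι → ℕ∞} {f : ι → ENNReal} {B : ENNReal}
    (h : ∀ (s : Finset ι) (m : ι → ℕ), (∀ i, (m i : ℕ∞) ≤ c i) → ∑ i ∈ s, m i * f i ≤ B) :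
    ∑' i, (c i : ENNReal) * f i ≤ B := by
  rw [ENNReal.tsum_eq_iSup_sum]
  refine iSup_le fun s => ?_
  simp only [enat_eq_iSup (c _), ENNReal.iSup_mul]
  rw [ENNReal.finsetSum_iSup_of_monotone]
  · refine iSup_le fun n => h s (fun i => (min (c i) n).toNat) fun i => ?_
    rw [ENat.natCast_toNat (ne_top_of_le_ne_top (ENat.natCast_ne_top n) (min_le_right _ _))]
    exact min_le_left _ _
  · intro i n n' hn
    have h1 : (min (c i) n).toNat ≤ (min (c i) n').toNat :=
      ENat.toNat_le_toNat (min_le_min le_rfl (by exact_mod_cast hn))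
        (ne_top_of_le_ne_top (ENat.natCast_ne_top n') (min_le_right _ _))
    simp only
    gcongr

/-- Any finitely many eigenvalues, with finite parts of their multiplicities, are realized by an
orthonormal family of eigenfunctions; neither the finiteness of multiplicities nor the discreteness
of the spectrum is assumed. -/
theorem rieszMean_le_lintegral (hK : IsAdmissible α K) (hK0 : 0 < K) (hγ : 1 ≤ γ) (hL : 0 < L)
    (ha : IntervalIntegrable a volume 0 L) (hflux : flux L a = α)
    (hVm : ∀ i j, AEMeasurable (fun x => V x i j) (volume.restrict (Ioc 0 L)))
    (hV : ∀ᵐ x ∂(volume.restrict (Ioc 0 L)), (V x).PosSemidef) :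
    rieszMean L a V γ ≤ ENNReal.ofReal (2 / (3 * √3) * √K) *
      ∫⁻ x in Ioc 0 L, ENNReal.ofReal (Lcl γ / Lcl 1 * trPow (V x) (γ + 1 / 2)) := by
  refine tsum_enat_mul_le fun s m hm => ?_
  choose e he heS using fun l => exists_orthonormal_of_le_rank _ (hm l)
  choose u u' v v' hu hev using fun (l : Ioi (0 : ℝ)) (i : Fin (m l)) =>
    exists_isEigenfunction (heS l i)
  have hinner : ∀ l i j, ∫ x in (0 : ℝ)..L, inner ℂ (u l i x) (u l j x) =
      inner ℂ (e l i) (e l j) := fun l i j => by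
    rw [MeasureTheory.L2.inner_def, intervalIntegral.integral_of_le hL.le]
    refine integral_congr_ae ?_
    filter_upwards [hu l i, hu l j] with x hi hj
    rw [hi, hj]
  have key := sum_rpow_le_lintegral hK hK0 hγ hL ha hflux hVm hV
    (ι := Σ l : s, Fin (m l)) (l := fun n => (n.1 : Ioi (0 : ℝ)))
    (fun n => (n.1.1.2 : (0 : ℝ) < _).le) (fun n => hev n.1 n.2) ?_ ?_
  · refine le_trans (le_of_eq ?_) key
    rw [Fintype.sum_sigma, ← Finset.sum_coe_sort s]
    refine Finset.sum_congr rfl fun l _ => ?_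
    simp
  · rintro ⟨l, i⟩ ⟨l', j⟩ hne
    by_cases hll : l = l'
    · subst hll
      simp only
      rw [hinner]
      exact (he l).2 fun hij => hne (by rw [hij])
    · refine IsEigenfunction.integral_inner_eq_zero hL (hV.mono fun x hx => hx.1) (hev l i)
        (hev l' j) fun hE => hll ?_
      exact Subtype.ext (Subtype.ext (neg_injective hE))
  · intro n
    rw [hinner, inner_self_eq_norm_sq_to_K, (he n.1).1]
    simp

theorem rieszMean_le_of_isAdmissible (hK : IsAdmissible α K) (hK0 : 0 < K) (hγ : 1 ≤ γ)
    (hL : 0 < L) (ha : IntervalIntegrable a volume 0 L) (hflux : flux L a = α)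
    (hVm : ∀ i j, AEMeasurable (fun x => V x i j) (volume.restrict (Ioc 0 L)))
    (hV : ∀ᵐ x ∂(volume.restrict (Ioc 0 L)), (V x).PosSemidef)
    (hVi : IntervalIntegrable (fun x => trPow (V x) (γ + 1 / 2)) volume 0 L) :
    rieszMean L a V γ ≤ ENNReal.ofReal (2 / (3 * √3) * √K * (Lcl γ / Lcl 1) *
      ∫ x in (0 : ℝ)..L, trPow (V x) (γ + 1 / 2)) := by
  refine (rieszMean_le_lintegral hK hK0 hγ hL ha hflux hVm hV).trans (le_of_eq ?_)
  rw [mul_assoc _ (Lcl γ / Lcl 1), ENNReal.ofReal_mul (p := 2 / (3 * √3) * √K) (by positivity),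
    ← intervalIntegral.integral_const_mul,
    intervalIntegral.integral_of_le hL.le, ofReal_integral_eq_lintegral_ofReal
      (((intervalIntegrable_iff_integrableOn_Ioc_of_le hL.le).1 hVi).const_mul _)]
  filter_upwards [hV] with x hx
  exact mul_nonneg (div_nonneg (Lcl_nonneg γ) (Lcl_nonneg 1)) (trPow_nonneg hx _)

end RieszMean

section BestConstant

variable {α K : ℝ}

theorem bddBelow_isAdmissible : BddBelow {K : ℝ | IsAdmissible α K} := ⟨0, fun _ h => h.1⟩

theorem KConst_nonneg : 0 ≤ KConst α := Real.sInf_nonneg fun _ h => h.1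

theorem KConst_le (hK : IsAdmissible α K) : KConst α ≤ K := csInf_le bddBelow_isAdmissible hK

theorem IsAdmissible.mono {K' : ℝ} (hK : IsAdmissible α K) (h : K ≤ K') : IsAdmissible α K' :=
  ⟨hK.1.trans h, fun L a hL ha hf M N ψ ψ' h1 h2 h3 =>
    (hK.2 L a hL ha hf M N ψ ψ' h1 h2 h3).trans
      (mul_le_mul_of_nonneg_right h (Finset.sum_nonneg fun _ _ =>
        intervalIntegral.integral_nonneg hL.le fun _ _ => by positivity))⟩

/-- Admissible constants exist, so the infimum is not a junk value, and they form an upper set. -/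
theorem isAdmissible_of_KConst_lt (hα : ∀ m : ℤ, α ≠ m) (h : KConst α < K) : IsAdmissible α K := by
  obtain ⟨K', hK', hlt⟩ := exists_lt_of_csInf_lt (s := {K : ℝ | IsAdmissible α K})
    ⟨_, isAdmissible_K₁ hα⟩ h
  exact IsAdmissible.mono hK' hlt.le

theorem const_mul_Lcl_div (c γ : ℝ) :
    2 / (3 * √3) * c * (Lcl γ / Lcl 1) = Real.pi / √3 * c * Lcl γ := by
  have hpi := Real.pi_pos
  rw [Lcl_one]
  field_simp

end BestConstant

end MagneticLT

theorem corollary3p1 (α γ : ℝ) (hα : ∀ m : ℤ, α ≠ m) (hγ : 1 ≤ γ) :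
    MagneticLT.KConst α ≤ min (MagneticLT.K₁ α) (MagneticLT.K₂ α) ∧
    2 / (3 * √3) * √(MagneticLT.KConst α) * (MagneticLT.Lcl γ / MagneticLT.Lcl 1) =
      Real.pi / √3 * √(MagneticLT.KConst α) * MagneticLT.Lcl γ ∧
    ∃ Lγ : ℝ, Lγ ≤ Real.pi / √3 * √(MagneticLT.KConst α) * MagneticLT.Lcl γ ∧
      ∀ (L : ℝ) (a : ℝ → ℝ), 0 < L → IntervalIntegrable a volume 0 L →
        MagneticLT.flux L a = α →
        ∀ (M : ℕ) (V : ℝ → Matrix (Fin M) (Fin M) ℂ),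
          (∀ i j, AEMeasurable (fun x => V x i j) (volume.restrict (Ioc 0 L))) →
          (∀ᵐ x ∂(volume.restrict (Ioc 0 L)), (V x).PosSemidef) →
          IntervalIntegrable (fun x => MagneticLT.trPow (V x) (γ + 1 / 2)) volume 0 L →
          MagneticLT.rieszMean L a V γ ≤
            ENNReal.ofReal
              (Lγ * ∫ x in (0 : ℝ)..L, MagneticLT.trPow (V x) (γ + 1 / 2)) := by
  refine ⟨le_min (MagneticLT.KConst_le (MagneticLT.isAdmissible_K₁ hα))
    (MagneticLT.KConst_le (MagneticLT.isAdmissible_K₂ hα)), MagneticLT.const_mul_Lcl_div _ _, _,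
    le_rfl, fun L a hL ha hflux M V hVm hV hVi => ?_⟩
  rw [← MagneticLT.const_mul_Lcl_div]
  -- the infimum `K(α)` need not be attained a priori, so the bound is passed to the limit `K ↓ K(α)`
  have hlim : Filter.Tendsto (fun K : ℝ => ENNReal.ofReal (2 / (3 * √3) * √K *
      (MagneticLT.Lcl γ / MagneticLT.Lcl 1) *
        ∫ x in (0 : ℝ)..L, MagneticLT.trPow (V x) (γ + 1 / 2)))
      (nhdsWithin (MagneticLT.KConst α) (Ioi (MagneticLT.KConst α)))
      (nhds (ENNReal.ofReal (2 / (3 * √3) * √(MagneticLT.KConst α) *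
        (MagneticLT.Lcl γ / MagneticLT.Lcl 1) *
          ∫ x in (0 : ℝ)..L, MagneticLT.trPow (V x) (γ + 1 / 2)))) := by
    refine ENNReal.tendsto_ofReal (Filter.Tendsto.mono_left (Continuous.tendsto ?_ _)
      nhdsWithin_le_nhds)
    fun_prop
  refine ge_of_tendsto hlim ?_
  filter_upwards [self_mem_nhdsWithin] with K hK
  exact MagneticLT.rieszMean_le_of_isAdmissible (MagneticLT.isAdmissible_of_KConst_lt hα hK)
    (MagneticLT.KConst_nonneg.trans_lt hK) hγ hL ha hflux hVm hV hVi
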